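/- **Setting.** Let $\mathbb F$ be a field, $S\subset\mathbb F$ a finite non-empty set, $A\in\mathbb F^{m\times n}$ a matrix of rank $r$. The row (column) rank profile of $A$ is the lexicographically minimal sequence of $r$ indices of independent rows (columns). The rank profile matrix $\mathcal R_A$ is the unique $m\times n$ $\{0,1\}$-matrix with $r$ nonzero entries every leading submatrix of which has the same rank as the corresponding leading submatrix of $A$. Field elements and indices have size $1$; Verifier cost is the number of field operations $+,-,\times,/$, a product of $A$ with a vector (on either side) being charged $\mu(A)$, the worse of the least arithmetic costs of the maps $v\mapsto Av$ and $v\mapsto A^Tv$. All samples are independent and uniform in $S$, and the Verifier rejects as soon as a check fails. For increasing indices $c=(c_1,\dots,c_r)$, $E_{k,c}$ is the $k\times r$ matrix whose $j$-th column is the $c_j$-th canonical basis vector. **Sub-protocols.** For $M\in\{A,A^T\}$ with $b$ columns and an increasing sequence $c$ of $r$ column indices: *Independence* $(M,c)$: the Verifier samples $\alpha\in S^r$ and sends $ME_{b,c}\,\alpha$; the Prover answers $\beta\in\mathbb F^r$; check $\beta=\alpha$. *Minimality* $(M,c)$: the Verifier samples and sends $v\in S^b$. For $j=r,r-1,\dots,1$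 he samples and sends $x_j$ and receives $y_j$. He samples $x_0$ (not sent). With $c_{r+1}=b+1$ and $W=[\mathbb 1_{i<c_{j+1}}]_{1\le i\le b,\,0\le j\le r}$ he forms $z=\mathrm{Diag}(v)Wx-E_{b,c}\,y$ and checks $Mz=0$. *Invertible RPM* on $B=A_{\mathcal I,\mathcal J}\in\mathbb F^{r\times r}$: the Prover sends a permutation matrix $P$ and $D=\mathrm{Diag}(d_1,\dots,d_r)$ (checked to be a permutation matrix, and to have all $d_i\ne0$). For $i=1,\dots,r$ the Verifier sends a sample $e_i$ and receives $f_i$. For $i=r,\dots,2$ he sends samples $\varphi_i,\psi_i$, receives $\bar x_{i-1},\bar y_{i-1}$, sends a sample $\lambda_i$, receives $\bar z_{i-1}$; then he samples $\varphi_1,\psi_1,\lambda_1$ (not sent), sets $x=\varphi+(\bar x,0)$, $y=\psi+(\bar y,0)$, $z=\lambda+(\bar z,0)$, and checks $z^TDx=\lambda^TBP^T\varphi$, $z^TDy=\lambda^TBP^T\psi$ and $e^TP^Tx=f^TP^T\varphi$. **Protocol.** The Prover commits one of the two profiles: $\mathcal J$ (columns first) or $\mathcal I$ (rows first); it is certified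 by Independence and Minimality (on $A$ for $\mathcal J$, on $A^T$ for $\mathcal I$). Then she commits the other profile, with the same number of indices, which is certified by Minimality only. Then Invertible RPM is run on $A_{\mathcal I,\mathcal J}$. If no check failed, the Verifier accepts with output $E_{m,\mathcal I}\,P\,E_{n,\mathcal J}^T$. **Theorem.** For both orders: 1. (Perfect completeness, Prover cost.) Let $\omega>2$ and $c$ be such that $k\times k$ matrices over $\mathbb F$ can be multiplied with at most $c\,k^{\omega}$ field operations for all $k$. There are a constant $C$ depending only on $\omega$ and $c$ and, for all $m,n$, an honest Prover algorithm (an algebraic computation tree on the entries of $A$ and the received challenges) that performs at most $C\,mn\max(r,1)^{\omega-2}$ field operations and zero tests on every $A\in\mathbb F^{m\times n}$ and for all challenges, and with which the Verifier always accepts, with output $\mathcal R_A$. 2. (Soundness.) For every Prover strategy, the probability that the Verifier accepts with an output different from $\mathcal R_A$ is at most $1-\bigl(1-\tfrac1{|S|}\bigr)^{2n}$; that is, a false result is rejected with probability at least $(1-\frac1{|S|})^{2n}$. 3. (Communication.) At most $m+n+\max(m,n)+17r$, and at most $m+n+\min(m,n)+17r$ when the columns come first if $m\le n$ and the rows come first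 if $n<m$. 4. (Verifier cost.) At most $4\mu(A)+m+n+21r$. With the honest Prover the bounds 3 and 4 hold with $r=\operatorname{rank}A$; against an arbitrary Prover they hold with $r$ the number of indices in her first commitment. -/

import Mathlib

namespace RPMCert

universe u

/-! ### Rank profile matrix -/

section RankProfile

variable {F : Type u} [Field F] {m n : ℕ}

open Classical in
/-- `R` is the rank profile matrix of `A`: a `{0,1}`-matrix with `rank A` nonzero entries, every
leading submatrix of which has the same rank as the corresponding leading submatrix of `A`. -/
def IsRankProfileMatrix (A R : Matrix (Fin m) (Fin n) F) : Prop :=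
  (∀ i j, R i j = 0 ∨ R i j = 1) ∧
  (Finset.univ.filter fun p : Fin m × Fin n => R p.1 p.2 ≠ 0).card = A.rank ∧
  ∀ (k : ℕ) (hk : k ≤ m) (l : ℕ) (hl : l ≤ n),
    (R.submatrix (Fin.castLE hk) (Fin.castLE hl)).rank =
      (A.submatrix (Fin.castLE hk) (Fin.castLE hl)).rank

open Classical in
/-- The `m × r` matrix whose `j`-th column is the `c j`-th canonical basis vector. -/
def unitColumns {m r : ℕ} (F : Type u) [Field F] (c : Fin r → Fin m) : Matrix (Fin m) (Fin r) F :=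
  Matrix.of fun i j => if i = c j then 1 else 0

end RankProfile

/-! ### Arithmetic operations, straight-line programs, cost of matrix products -/

/-- The arithmetic operations of a field (with `a / 0 = 0`). -/
inductive ArithOp
  | add
  | sub
  | mul
  | div

/-- The value of an arithmetic operation. -/
def ArithOp.eval {F : Type u} [Field F] : ArithOp → F → F → F
  | .add, a, b => a + b
  | .sub, a, b => a - b
  | .mul, a, b => a * b
  | .div, a, b => a / b

/-- An instruction of a straight-line program: append a constant of the field to the memory, or
append the result of an arithmetic operation on the cells `i` and `j`. -/
inductive Instr (F : Type u)
  | const (c : F)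
  | op (o : ArithOp) (i j : ℕ)

/-- The final memory of a straight-line program that starts from the memory `mem`. Absent cells
read as `0`. -/
def runSLP {F : Type u} [Field F] : List (Instr F) → List F → List F
  | [], mem => mem
  | .const c :: p, mem => runSLP p (mem ++ [c])
  | .op o i j :: p, mem => runSLP p (mem ++ [o.eval (mem.getD i 0) (mem.getD j 0)])

/-- The number of arithmetic operations of a straight-line program. -/
def slpCost {F : Type u} : List (Instr F) → ℕ
  | [] => 0
  | .const _ :: p => slpCost p
  | .op _ _ _ :: p => slpCost p + 1

/-- The entries of a matrix, row by row. -/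
def entries {F : Type u} {m n : ℕ} (A : Matrix (Fin m) (Fin n) F) : List F :=
  List.ofFn fun p : Fin (m * n) => A p.divNat p.modNat

/-- `k × k` matrices over `F` can be multiplied with at most `c * k ^ ω` arithmetic operations,
for every `k`. -/
def MatMulFeasible (F : Type u) [Field F] (ω c : ℝ) : Prop :=
  ∀ k : ℕ, ∃ (p : List (Instr F)) (out : Fin k → Fin k → ℕ),
    (slpCost p : ℝ) ≤ c * (k : ℝ) ^ ω ∧
    ∀ (X Y : Matrix (Fin k) (Fin k) F) (i j : Fin k),
      (runSLP p (entries X ++ entries Y)).getD (out i j) 0 = (X * Y) i j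

/-- The least number of arithmetic operations of a straight-line program that computes `M v` from
an arbitrary vector `v`. -/
noncomputable def applyCost {F : Type u} [Field F] {a b : ℕ} (M : Matrix (Fin a) (Fin b) F) : ℕ :=
  sInf {k | ∃ (p : List (Instr F)) (out : Fin a → ℕ), slpCost p = k ∧
    ∀ (v : Fin b → F) (i : Fin a), (runSLP p (List.ofFn v)).getD (out i) 0 = M.mulVec v i}

/-- `μ(A)`: the arithmetic cost of multiplying `A` by a vector, on whichever side is worse. -/
noncomputable def mu {F : Type u} [Field F] {m n : ℕ} (A : Matrix (Fin m) (Fin n) F) : ℕ :=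
  max (applyCost A) (applyCost A.transpose)

/-! ### Messages and provers -/

/-- A transmitted message: a field element, an index, or a list of indices. -/
inductive Msg (F : Type u)
  | fld (a : F)
  | idx (i : ℕ)
  | lst (l : List ℕ)

/-- Communication space; a field element and an index have the same size. -/
def Msg.size {F : Type u} : Msg F → ℕ
  | .fld _ => 1
  | .idx _ => 1
  | .lst l => l.length

/-- An arbitrary (possibly dishonest, computationally unbounded) Prover: what she answers when the
Verifier expects a field element, an index, or a list of indices, as a function of all messages
exchanged so far (in both directions, in chronological order). -/
structure Prover (F : Type u) where
  fld : List (Msg F) → F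
  idx : List (Msg F) → ℕ
  lst : List (Msg F) → List ℕ

/-- A Prover's algorithm, as an algebraic computation tree. Values of the field are only accessible
through the arithmetic operations and the tests for zero; each of them costs `1`. -/
inductive ProverProg (F : Type u)
  | halt
  /-- append a constant of the field to the memory -/
  | const (c : F) (next : ProverProg F)
  /-- append the result of an arithmetic operation on the cells `i` and `j` -/
  | op (o : ArithOp) (i j : ℕ) (next : ProverProg F)
  /-- branch according to whether the cell `i` holds zero -/
  | test (i : ℕ) (ifZero ifNonzero : ProverProg F)
  /-- send the content of the cell `i` -/
  | sendFld (i : ℕ) (next : ProverProg F)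
  /-- send an index -/
  | sendIdx (a : ℕ) (next : ProverProg F)
  /-- send a list of indices -/
  | sendLst (l : List ℕ) (next : ProverProg F)
  /-- receive a field element and append it to the memory -/
  | recv (next : ProverProg F)

namespace ProverProg

variable {F : Type u} [Field F]

open Classical in
/-- The message that the program, started from the memory `mem`, sends after the exchange `h`. -/
noncomputable def reply : ProverProg F → List F → List (Msg F) → Msg F
  | halt, _, _ => .fld 0
  | const c p, mem, h => reply p (mem ++ [c]) h
  | op o i j p, mem, h => reply p (mem ++ [o.eval (mem.getD i 0) (mem.getD j 0)]) h
  | test i p q, mem, h => if mem.getD i 0 = 0 then reply p mem h else reply q mem h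
  | sendFld i _, mem, [] => .fld (mem.getD i 0)
  | sendFld _ p, mem, _ :: h => reply p mem h
  | sendIdx a _, _, [] => .idx a
  | sendIdx _ p, mem, _ :: h => reply p mem h
  | sendLst l _, _, [] => .lst l
  | sendLst _ p, mem, _ :: h => reply p mem h
  | recv p, mem, .fld a :: h => reply p (mem ++ [a]) h
  | recv _, _, _ => .fld 0

/-- The Prover that runs the program on the input matrix `A`. -/
noncomputable def toProver {m n : ℕ} (p : ProverProg F) (A : Matrix (Fin m) (Fin n) F) :
    Prover F where
  fld h := match p.reply (entries A) h with
    | .fld a => a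
    | _ => 0
  idx h := match p.reply (entries A) h with
    | .idx a => a
    | _ => 0
  lst h := match p.reply (entries A) h with
    | .lst l => l
    | _ => []

open Classical in
/-- The number of arithmetic operations and tests that the program performs from the memory `mem`
when it receives the field elements of the given list in turn. -/
noncomputable def cost : ProverProg F → List F → List F → ℕ
  | halt, _, _ => 0
  | const c p, mem, h => cost p (mem ++ [c]) h
  | op o i j p, mem, h => cost p (mem ++ [o.eval (mem.getD i 0) (mem.getD j 0)]) h + 1
  | test i p q, mem, h => (if mem.getD i 0 = 0 then cost p mem h else cost q mem h) + 1
  | sendFld _ p, mem, h => cost p mem h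
  | sendIdx _ p, mem, h => cost p mem h
  | sendLst _ p, mem, h => cost p mem h
  | recv p, mem, a :: h => cost p (mem ++ [a]) h
  | recv _, _, [] => 0

end ProverProg

/-! ### Verifiers -/

/-- An interactive, randomized algorithm of a Verifier who accesses an `m × n` matrix over `F` only
through products with vectors, and ends by accepting with a value in `α` or by rejecting. -/
inductive VProg (F : Type u) (m n : ℕ) (α : Type u) : Type u
  | accept (a : α)
  | reject
  /-- sample an element of the finite set `S` -/
  | sample (k : F → VProg F m n α)
  /-- send a field element to the Prover -/
  | send (a : F) (next : VProg F m n α)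
  /-- receive a field element from the Prover -/
  | recv (k : F → VProg F m n α)
  /-- receive an index from the Prover -/
  | recvIdx (k : ℕ → VProg F m n α)
  /-- receive a list of indices from the Prover -/
  | recvLst (k : List ℕ → VProg F m n α)
  /-- an arithmetic operation -/
  | op (o : ArithOp) (a b : F) (k : F → VProg F m n α)
  /-- the product of the matrix by a column vector -/
  | mulVec (v : Fin n → F) (k : (Fin m → F) → VProg F m n α)
  /-- the product of a row vector by the matrix -/
  | vecMul (v : Fin m → F) (k : (Fin n → F) → VProg F m n α)

/-- The outcome of an execution: the accepted value (`none` if the Verifier rejects), all messages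
exchanged, and the number of arithmetic operations of the Verifier. -/
structure Result (F : Type u) (α : Type u) where
  output : Option α
  transcript : List (Msg F)
  cost : ℕ

/-- The communication space of an execution. -/
def Result.comm {F α : Type u} (res : Result F α) : ℕ := (res.transcript.map Msg.size).sum

namespace VProg

variable {F : Type u} {m n : ℕ} {α β : Type u}

/-- Sequential composition. -/
def bind : VProg F m n α → (α → VProg F m n β) → VProg F m n β
  | accept a, f => f a
  | reject, _ => reject
  | sample k, f => sample fun a => bind (k a) f
  | send a p, f => send a (bind p f)
  | recv k, f => recv fun a => bind (k a) f
  | recvIdx k, f => recvIdx fun a => bind (k a) f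
  | recvLst k, f => recvLst fun a => bind (k a) f
  | op o a b k, f => op o a b fun c => bind (k c) f
  | mulVec v k, f => mulVec v fun w => bind (k w) f
  | vecMul v k, f => vecMul v fun w => bind (k w) f

instance : Monad (VProg F m n) where
  pure := accept
  bind := bind

/-- The distribution of the outcome when the Verifier interacts with the Prover `σ` about `A`, the
samples being independent and uniform in `S`; `h` and `t` are the messages exchanged and the
operations performed so far. A product of `A` and a vector is charged `μ(A)`. -/
noncomputable def run [Field F] (A : Matrix (Fin m) (Fin n) F) (S : Finset F) (hS : S.Nonempty)
    (σ : Prover F) : VProg F m n α → List (Msg F) → ℕ → PMF (Result F α)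
  | accept a, h, t => PMF.pure ⟨some a, h, t⟩
  | reject, h, t => PMF.pure ⟨none, h, t⟩
  | sample k, h, t => (PMF.uniformOfFinset S hS).bind fun a => run A S hS σ (k a) h t
  | send a p, h, t => run A S hS σ p (h ++ [.fld a]) t
  | recv k, h, t => run A S hS σ (k (σ.fld h)) (h ++ [.fld (σ.fld h)]) t
  | recvIdx k, h, t => run A S hS σ (k (σ.idx h)) (h ++ [.idx (σ.idx h)]) t
  | recvLst k, h, t => run A S hS σ (k (σ.lst h)) (h ++ [.lst (σ.lst h)]) t
  | op o a b k, h, t => run A S hS σ (k (o.eval a b)) h (t + 1)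
  | mulVec v k, h, t => run A S hS σ (k (A.mulVec v)) h (t + mu A)
  | vecMul v k, h, t => run A S hS σ (k (A.vecMul v)) h (t + mu A)

end VProg

/-! ### Building blocks of the Verifier -/

section Blocks

variable {F : Type u} {m n : ℕ} {α β : Type u}

/-- Sample an element of `S` and keep it. -/
def draw : VProg F m n F := .sample .accept

/-- Sample an element of `S` and send it to the Prover. -/
def challenge : VProg F m n F := .sample fun a => .send a (.accept a)

/-- Receive a field element. -/
def response : VProg F m n F := .recv .accept

/-- One arithmetic operation. -/
def arith (o : ArithOp) (a b : F) : VProg F m n F := .op o a b .accept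

open Classical in
/-- Reject unless `p` holds. -/
noncomputable def check (p : Prop) : VProg F m n PUnit.{u + 1} :=
  if p then .accept PUnit.unit else .reject

/-- Execute `f 0`, `f 1`, …, `f (r - 1)` in this order. -/
def forUp : (r : ℕ) → (Fin r → VProg F m n β) → VProg F m n (Fin r → β)
  | 0, _ => pure Fin.elim0
  | r + 1, f => do
    let a ← f 0
    let t ← forUp r fun i => f i.succ
    pure (Fin.cons a t)

/-- Execute `f (r - 1)`, …, `f 1`, `f 0` in this order. -/
def forDown : (r : ℕ) → (Fin r → VProg F m n β) → VProg F m n (Fin r → β)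
  | 0, _ => pure Fin.elim0
  | r + 1, f => do
    let a ← f (Fin.last r)
    let t ← forDown r fun i => f i.castSucc
    pure (Fin.snoc (α := fun _ => β) t a)

/-- Send the coordinates of a vector. -/
def sendVec : (r : ℕ) → (Fin r → F) → VProg F m n PUnit.{u + 1}
  | 0, _ => pure PUnit.unit
  | r + 1, v => .send (v 0) (sendVec r fun i => v i.succ)

/-- Receive `r` indices and continue with them. -/
def recvIdxs : (r : ℕ) → ((Fin r → ℕ) → VProg F m n α) → VProg F m n α
  | 0, k => k Fin.elim0
  | r + 1, k => .recvIdx fun a => recvIdxs r fun t => k (Fin.cons a t)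

open Classical in
/-- Reject unless `c` is a strictly increasing sequence of indices of `{0, …, b - 1}`. -/
noncomputable def withIncreasing {r : ℕ} (b : ℕ) (c : Fin r → ℕ)
    (k : (Fin r → Fin b) → VProg F m n α) : VProg F m n α :=
  if h : StrictMono c ∧ ∀ j, c j < b then k fun j => ⟨c j, h.2 j⟩ else .reject

open Classical in
/-- Reject unless `p` is a permutation of `{0, …, r - 1}`. -/
noncomputable def withPermutation {r : ℕ} (p : Fin r → ℕ)
    (k : (Fin r → Fin r) → VProg F m n α) : VProg F m n α :=
  if h : Function.Injective p ∧ ∀ j, p j < r then k fun j => ⟨p j, h.2 j⟩ else .reject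

/-- The dot product of two vectors, with `2 r - 1` operations (none for `r = 0`). -/
def dot [Field F] : (r : ℕ) → (Fin r → F) → (Fin r → F) → VProg F m n F
  | 0, _, _ => pure 0
  | 1, u, w => arith .mul (u 0) (w 0)
  | r + 2, u, w => do
    let p ← arith .mul (u 0) (w 0)
    let s ← dot (r + 1) (fun i => u i.succ) (fun i => w i.succ)
    arith .add p s

/-- The sums `x j + x (j + 1) + ⋯ + x r`, for `j = 0, …, r`, with `r` additions. -/
def suffixSums : (r : ℕ) → (Fin (r + 1) → F) → VProg F m n (Fin (r + 1) → F)
  | 0, x => pure x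
  | r + 1, x => do
    let s ← suffixSums r fun i => x i.succ
    let t ← arith .add (x 0) (s 0)
    pure (Fin.cons t s)

end Blocks

/-! ### The protocol -/

section Protocol

variable {F : Type u} [Field F] {m n : ℕ}

/-- The product of the matrix by a column vector. -/
def timesA (v : Fin n → F) : VProg F m n (Fin m → F) := .mulVec v .accept

/-- The product of the transposed matrix by a column vector. -/
def timesAT (v : Fin m → F) : VProg F m n (Fin n → F) := .vecMul v .accept

/-- Certificate that the columns `c` of `M` are linearly independent, where `M` (which is `A` or
its transpose) is given through the procedure `mul` that multiplies it by a vector: the Prover has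
to recover a random combination of these columns. -/
noncomputable def lowerRank {a b r : ℕ} (mul : (Fin b → F) → VProg F m n (Fin a → F))
    (c : Fin r → Fin b) : VProg F m n PUnit.{u + 1} := do
  let α ← forUp r fun _ => draw
  let w ← mul (Function.extend c α 0)
  sendVec a w
  let β ← forUp r fun _ => response
  check (β = α)

/-- The number of `j` with `c j ≤ i`. -/
def segment {b r : ℕ} (c : Fin r → Fin b) (i : Fin b) : Fin (r + 1) :=
  ⟨(Finset.univ.filter fun j => c j ≤ i).card,
    Nat.lt_succ_of_le ((Finset.card_filter_le _ _).trans (by simp))⟩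

/-- Certificate that every column of `M` that precedes the column `c_{j+1}` is a combination of the
columns `c_1, …, c_j`, for `j = 0, …, r` (where `c_{r+1}` stands past the last column). With
`V = Diag(v) W`, `W = [1_{i < c_{j+1}}]` with columns `j = 0, …, r`, the Verifier checks that
`M V x = M_c y`, each `y_j` being committed before `x_{j-1}, …, x_0` are sampled. As no response
depends on `x_0`, it is not transmitted. -/
noncomputable def minimality {a b r : ℕ} (mul : (Fin b → F) → VProg F m n (Fin a → F))
    (c : Fin r → Fin b) : VProg F m n PUnit.{u + 1} := do
  let v ← forUp b fun _ => draw
  sendVec b v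
  let xy ← forDown r fun _ => do
    let x ← challenge
    let y ← response
    pure (x, y)
  let x₀ ← draw
  -- coordinate `i` of `W x` is the sum of the `x_j` with `i < c_{j+1}`
  let s ← suffixSums r (Fin.cons x₀ fun j => (xy j).1)
  let z ← forUp b fun i => arith .mul (v i) (s (segment c i))
  let d ← forUp r fun j => arith .sub (z (c j)) (xy j).2
  let w ← mul (Function.extend c d z)
  check (w = 0)

/-- The vectors exchanged in the certificate of an LDUP decomposition, completed by the Verifier. -/
structure LDUPData (F : Type u) (r : ℕ) where
  φ : Fin r → F
  ψ : Fin r → F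
  l : Fin r → F
  x : Fin r → F
  y : Fin r → F
  z : Fin r → F

/-- The interactive part of the certificate of an LDUP decomposition. In each round the Verifier
samples `φ_i, ψ_i`, receives `x_{i-1}, y_{i-1}`, samples `λ_i` and receives `z_{i-1}`, for `i` from
`r` down to `2`; then he samples `φ_1, ψ_1, λ_1` and adds `φ, ψ, λ` to the responses, completed by
a last coordinate `0`. -/
def ldupRounds : (r : ℕ) → VProg F m n (LDUPData F r)
  | 0 => pure ⟨Fin.elim0, Fin.elim0, Fin.elim0, Fin.elim0, Fin.elim0, Fin.elim0⟩
  | r + 1 => do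
    let t ← forDown r fun _ => do
      let φ ← challenge
      let ψ ← challenge
      let x ← response
      let y ← response
      let l ← challenge
      let z ← response
      pure (φ, ψ, x, y, l, z)
    let φ₁ ← draw
    let ψ₁ ← draw
    let l₁ ← draw
    let φ : Fin (r + 1) → F := Fin.cons φ₁ fun i => (t i).1
    let ψ : Fin (r + 1) → F := Fin.cons ψ₁ fun i => (t i).2.1
    let l : Fin (r + 1) → F := Fin.cons l₁ fun i => (t i).2.2.2.2.1
    let x ← forUp r fun i => arith .add (φ i.castSucc) (t i).2.2.1
    let y ← forUp r fun i => arith .add (ψ i.castSucc) (t i).2.2.2.1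
    let z ← forUp r fun i => arith .add (l i.castSucc) (t i).2.2.2.2.2
    pure ⟨φ, ψ, l, Fin.snoc (α := fun _ => F) x (φ (Fin.last r)),
      Fin.snoc (α := fun _ => F) y (ψ (Fin.last r)), Fin.snoc (α := fun _ => F) z (l (Fin.last r))⟩

/-- Certificate for the rank profile matrix `P` of the submatrix `B` of `A` on the rows `I` and the
columns `J`, through a decomposition `B = L D U P` with `L`, `U` unit triangular and `Pᵀ U P` upper
triangular. The Prover commits `P` and `D`; `p i` is the row of the nonzero entry of column `i` of
`P`. The Verifier accepts with the `m × n` matrix that has `P` on the rows `I` and columns `J` and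
zeros elsewhere. -/
noncomputable def rpmInvertible {r : ℕ} (I : Fin r → Fin m) (J : Fin r → Fin n) :
    VProg F m n (Matrix (Fin m) (Fin n) F) :=
  recvIdxs r fun q => withPermutation q fun p => do
    let D ← forUp r fun _ => response
    check (∀ i, D i ≠ 0)
    let ef ← forUp r fun _ => do
      let e ← challenge
      let f ← response
      pure (e, f)
    let t ← ldupRounds r
    -- `λᵀ B`, read off `(E_I λ)ᵀ A`
    let w ← timesAT (Function.extend I t.l 0)
    let zD ← forUp r fun i => arith .mul (t.z i) (D i)
    let left₁ ← dot r zD t.x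
    let right₁ ← dot r (fun j => w (J j)) (fun j => t.φ (p j))
    check (left₁ = right₁)
    let left₂ ← dot r zD t.y
    let right₂ ← dot r (fun j => w (J j)) (fun j => t.ψ (p j))
    check (left₂ = right₂)
    let left₃ ← dot r (fun j => (ef j).1) (fun j => t.x (p j))
    let right₃ ← dot r (fun j => (ef j).2) (fun j => t.φ (p j))
    check (left₃ = right₃)
    pure (unitColumns F I * unitColumns F p * (unitColumns F J).transpose)

/-- The Verifier of the certificate for the rank profile matrix of an `m × n` matrix. One of the
two rank profiles is certified first, including the linear independence of its rows or columns:
the row rank profile if `rowsFirst` is true, else the column rank profile. -/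
noncomputable def rpmVerifier (F : Type u) [Field F] (m n : ℕ) (rowsFirst : Bool) :
    VProg F m n (Matrix (Fin m) (Fin n) F) :=
  match rowsFirst with
  | true => .recvLst fun i => withIncreasing m i.get fun I => do
      lowerRank timesAT I
      minimality timesAT I
      recvIdxs i.length fun j => withIncreasing n j fun J => do
        minimality timesA J
        rpmInvertible I J
  | false => .recvLst fun j => withIncreasing n j.get fun J => do
      lowerRank timesA J
      minimality timesA J
      recvIdxs j.length fun i => withIncreasing m i fun I => do
        minimality timesAT I
        rpmInvertible I J

/-- The distribution of the outcome of the protocol on `A` with the Prover `σ`. -/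
noncomputable def execution (rowsFirst : Bool) (A : Matrix (Fin m) (Fin n) F) (S : Finset F)
    (hS : S.Nonempty) (σ : Prover F) : PMF (Result F (Matrix (Fin m) (Fin n) F)) :=
  (rpmVerifier F m n rowsFirst).run A S hS σ [] 0

end Protocol

end RPMCert

open RPMCert

set_option linter.unusedSectionVars false

/-! Soundness rests on one fact of linear algebra, `isRankProfileMatrix_of_spanned`. Suppose every
row of `A` is a combination of those rows of `I` that do not follow it, likewise for the columns and
`J`, and `A_{I,J} = L D U P` with `L`, `U` unit triangular, `D` invertible and `Pᵀ U P` upper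
triangular. Then `A` is the product of a column echelon form with pivots `I` and a matrix whose rows
have their first nonzero entries in the columns `J`, in the order given by `P`. Completing both
factors to invertible triangular matrices leaves all leading ranks unchanged, so the rank profile
matrix can be read off (`isRankProfileMatrix_of_echelon`). Linear independence is not assumed: it
follows from the invertibility of `L D U`.

A false output therefore forces one of these hypotheses to be false, and each is refuted by a
quantity that is affine in a sample drawn after everything else it depends on. Such a sample hits
the only root with probability at most `1/|S|`, and every decisive sample contributes a factor `ρ =
1 - 1/|S|` (`sampleMean_le_of_ne`). Minimality has two decisive samples (`expect_minimality_le`).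
For the invertible submatrix, elimination with the committed pivots either succeeds or stops at a
first wrong pivot (`exists_ldu_or_mismatch`). In both cases a discrepancy arises, which survives
each later round at the price of one factor (`expect_ldup_rounds_le`). This takes `r + 1` decisive
samples, and `r + 1 ≤ 2r ≤ 2n` when `r ≥ 1`.

The honest Prover eliminates recursively on halves of the rows. A node needs six products whose
inner dimension is a rank found below it. The measure `m r^(ω-2)` decreases by a constant factor
when the rows are halved (`halving_le`), so the costs form a geometric series (`computes_elim`). The
answers then cost `18 m n` more operations at most.

Verifiers are interpreted compositionally by `interp`: with means for sampling it gives acceptance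
probabilities, with universal quantifiers it gives perfect completeness. `Interact` describes the
joint run of a Verifier and a Prover's program. -/

namespace RPMCert

universe u v

/-! ### Rank profile matrices from echelon forms -/

section LinearAlgebra

variable {F : Type u} [Field F] {m n r : ℕ}

open Classical in
/-- The square matrix that has the columns of `C` at the positions `I` and is the identity
elsewhere. -/
noncomputable def completeColumns (C : Matrix (Fin m) (Fin r) F) (I : Fin r → Fin m) :
    Matrix (Fin m) (Fin m) F :=
  Matrix.of fun i i' => if h : ∃ k, I k = i' then C i h.choose else if i = i' then 1 else 0

theorem completeColumns_apply {C : Matrix (Fin m) (Fin r) F} {I : Fin r → Fin m}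
    (hI : Function.Injective I) (i : Fin m) (k : Fin r) : completeColumns C I i (I k) = C i k := by
  have h : ∃ k', I k' = I k := ⟨k, rfl⟩
  have : h.choose = k := hI h.choose_spec
  simp only [completeColumns, Matrix.of_apply]
  rw [dif_pos h, this]

theorem completeColumns_mul {C : Matrix (Fin m) (Fin r) F} {I : Fin r → Fin m}
    (hI : Function.Injective I) : completeColumns C I * unitColumns F I = C := by
  ext i k
  simp [Matrix.mul_apply, unitColumns, completeColumns_apply hI]

theorem completeColumns_lower {C : Matrix (Fin m) (Fin r) F} {I : Fin r → Fin m}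
    (h0 : ∀ i k, i < I k → C i k = 0) (i i' : Fin m) (h : i < i') :
    completeColumns C I i i' = 0 := by
  simp only [completeColumns, Matrix.of_apply]
  split_ifs with h1 h2
  · exact h0 _ _ (by rw [h1.choose_spec]; exact h)
  · exact absurd h2 h.ne
  · rfl

theorem completeColumns_diag {C : Matrix (Fin m) (Fin r) F} {I : Fin r → Fin m}
    (h1 : ∀ k, C (I k) k ≠ 0) (i : Fin m) : completeColumns C I i i ≠ 0 := by
  simp only [completeColumns, Matrix.of_apply]
  split_ifs with h
  · have := h1 h.choose
    rwa [h.choose_spec] at this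
  · exact one_ne_zero

/-- The first `k` rows of `L * X` involve only the leading `k × k` block of `L`, because `L` is
lower triangular, and the nonzero diagonal makes this block invertible. -/
theorem rank_leading_lower_mul (L : Matrix (Fin m) (Fin m) F) (hL : ∀ i j, i < j → L i j = 0)
    (hd : ∀ i, L i i ≠ 0) {ι : Type*} [Fintype ι] (X : Matrix (Fin m) ι F) {k : ℕ} (hk : k ≤ m) :
    ((L * X).submatrix (Fin.castLE hk) id).rank = (X.submatrix (Fin.castLE hk) id).rank := by
  have h : (L * X).submatrix (Fin.castLE hk) id =
      L.submatrix (Fin.castLE hk) (Fin.castLE hk) * X.submatrix (Fin.castLE hk) id := by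
    ext i j
    simp only [Matrix.submatrix_apply, Matrix.mul_apply, id]
    have : ∑ x, L (Fin.castLE hk i) x * X x j =
        ∑ x ∈ Finset.univ.map (Fin.castLEEmb hk), L (Fin.castLE hk i) x * X x j := by
      refine (Finset.sum_subset (Finset.subset_univ _) fun x _ hx => ?_).symm
      rw [hL, zero_mul]
      by_contra hc
      apply hx
      simp only [Finset.mem_map, Finset.mem_univ, true_and]
      have hx' : (x : ℕ) ≤ i := by simpa [Fin.lt_def] using hc
      exact ⟨⟨x, by omega⟩, by ext; simp⟩
    rw [this, Finset.sum_map]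
    rfl
  rw [h]
  apply Matrix.rank_mul_eq_right_of_isUnit_det
  rw [Matrix.det_of_isLowerTriangular]
  · rw [isUnit_iff_ne_zero, Finset.prod_ne_zero_iff]
    intro i _
    exact hd _
  · intro i j hij
    exact hL _ _ (by simpa using hij)

theorem unitColumns_mul_transpose_apply {I : Fin r → Fin m} {J : Fin r → Fin n} (i : Fin m)
    (j : Fin n) : (unitColumns F I * (unitColumns F J).transpose) i j =
      ∑ k, (if i = I k ∧ j = J k then 1 else 0) := by
  simp only [Matrix.mul_apply, unitColumns, Matrix.transpose_apply, Matrix.of_apply]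
  refine Finset.sum_congr rfl fun k _ => ?_
  by_cases h : i = I k <;> by_cases h' : j = J k <;> simp [h, h']

theorem unitColumns_transpose_mul {I : Fin r → Fin m} (hI : Function.Injective I) :
    (unitColumns F I).transpose * unitColumns F I = 1 := by
  ext k l
  simp only [Matrix.mul_apply, unitColumns, Matrix.transpose_apply, Matrix.of_apply, ite_mul,
    one_mul, zero_mul, Finset.sum_ite_eq', Finset.mem_univ, if_true, Matrix.one_apply, hI.eq_iff]

theorem rank_unitColumns_mul_transpose {I : Fin r → Fin m} {J : Fin r → Fin n}
    (hI : Function.Injective I) (hJ : Function.Injective J) :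
    (unitColumns F I * (unitColumns F J).transpose).rank = r := by
  apply le_antisymm
  · exact (Matrix.rank_mul_le_left _ _).trans ((Matrix.rank_le_width _))
  · have h : (unitColumns F I).transpose * (unitColumns F I * (unitColumns F J).transpose) *
        unitColumns F J = 1 := by
      rw [← Matrix.mul_assoc, unitColumns_transpose_mul hI, Matrix.one_mul,
        unitColumns_transpose_mul hJ]
    have h2 := (Matrix.rank_mul_le_left ((unitColumns F I).transpose *
      (unitColumns F I * (unitColumns F J).transpose)) (unitColumns F J)).trans
      (Matrix.rank_mul_le_right _ _)
    rw [h, Matrix.rank_one, Fintype.card_fin] at h2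
    exact h2

/-- A factorization through echelon forms reveals the rank profile matrix. -/
theorem isRankProfileMatrix_of_echelon {A : Matrix (Fin m) (Fin n) F} {I : Fin r → Fin m}
    {J : Fin r → Fin n} (hI : Function.Injective I) (hJ : Function.Injective J)
    {C : Matrix (Fin m) (Fin r) F} {R : Matrix (Fin r) (Fin n) F} (hA : A = C * R)
    (hC0 : ∀ i k, i < I k → C i k = 0) (hC1 : ∀ k, C (I k) k ≠ 0)
    (hR0 : ∀ k j, j < J k → R k j = 0) (hR1 : ∀ k, R k (J k) ≠ 0) :
    IsRankProfileMatrix A (unitColumns F I * (unitColumns F J).transpose) ∧ A.rank = r := by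
  have lead : ∀ (k : ℕ) (hk : k ≤ m) (l : ℕ) (hl : l ≤ n),
    ((unitColumns F I * (unitColumns F J).transpose).submatrix (Fin.castLE hk)
      (Fin.castLE hl)).rank = (A.submatrix (Fin.castLE hk) (Fin.castLE hl)).rank := by
    intro k hk l hl
    -- Completing `C` and the transpose of `R` gives `A = L E Vᵀ` with `L`, `V` invertible lower
    -- triangular and `E` the candidate. Truncating rows allows `L` to be dropped, truncating
    -- columns allows `V` to be dropped.
    have hA' : A = completeColumns C I * (unitColumns F I * (unitColumns F J).transpose *
        (completeColumns R.transpose J).transpose) := by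
      rw [Matrix.mul_assoc, ← Matrix.transpose_mul, completeColumns_mul hJ,
        Matrix.transpose_transpose, ← Matrix.mul_assoc, completeColumns_mul hI, hA]
    set E := unitColumns F I * (unitColumns F J).transpose
    set V := completeColumns R.transpose J
    have e1 : (A.submatrix (Fin.castLE hk) (Fin.castLE hl)) =
        ((completeColumns C I * (E * V.transpose).submatrix id (Fin.castLE hl)).submatrix
          (Fin.castLE hk) id) := by
      rw [hA']; ext; simp [Matrix.mul_apply]
    rw [e1, rank_leading_lower_mul _ (completeColumns_lower hC0) (completeColumns_diag hC1)]
    -- Transposition turns the truncation of columns into one of rows, so the same lemma removes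
    -- `V`.
    have e2 : ((E * V.transpose).submatrix id (Fin.castLE hl)).submatrix (Fin.castLE hk) id =
        (((V * (E.submatrix (Fin.castLE hk) id).transpose).submatrix
          (Fin.castLE hl) id)).transpose := by
      ext; simp [Matrix.mul_apply, mul_comm]
    rw [e2, Matrix.rank_transpose, rank_leading_lower_mul _
      (completeColumns_lower (C := R.transpose) fun j k h => hR0 k j h) (completeColumns_diag hR1),
      ← Matrix.rank_transpose]
    rfl
  have hrank : A.rank = r := by
    have := lead m le_rfl n le_rfl
    simp only [Fin.castLE_rfl] at this
    rw [← rank_unitColumns_mul_transpose (F := F) hI hJ]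
    simpa using this.symm
  refine ⟨⟨?_, ?_, lead⟩, hrank⟩
  · intro i j
    rw [unitColumns_mul_transpose_apply]
    by_cases h : ∃ k, i = I k ∧ j = J k
    · obtain ⟨k, rfl, rfl⟩ := h
      right
      rw [Finset.sum_eq_single k] <;> simp +contextual [hI.eq_iff, eq_comm]
    · left
      exact Finset.sum_eq_zero fun k _ => if_neg fun hk => h ⟨k, hk⟩
  · rw [hrank]
    classical
    have : (Finset.univ.filter fun p : Fin m × Fin n =>
        (unitColumns F I * (unitColumns F J).transpose) p.1 p.2 ≠ 0) =
        Finset.univ.image fun k => (I k, J k) := by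
      ext ⟨i, j⟩
      simp only [Finset.mem_filter, Finset.mem_univ, true_and, Finset.mem_image,
        unitColumns_mul_transpose_apply, Prod.mk.injEq]
      constructor
      · intro h
        obtain ⟨k, _, hk⟩ := Finset.exists_ne_zero_of_sum_ne_zero h
        have := (ite_ne_right_iff.1 hk).1
        exact ⟨k, this.1.symm, this.2.symm⟩
      · rintro ⟨k, rfl, rfl⟩
        rw [Finset.sum_eq_single k] <;> simp +contextual [hI.eq_iff, eq_comm]
    convert (congrArg Finset.card this).trans ?_
    rw [Finset.card_image_of_injective _ fun a b h => hI (Prod.mk.inj h).1]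
    simp

/-- Absorbs `P` into the list of columns; echelon forms with unordered pivot columns then match the
output of the protocol. -/
theorem unitColumns_mul_perm {I : Fin r → Fin m} {J : Fin r → Fin n} (p : Equiv.Perm (Fin r)) :
    unitColumns F I * unitColumns F p * (unitColumns F J).transpose =
      unitColumns F I * (unitColumns F (J ∘ p.symm)).transpose := by
  rw [Matrix.mul_assoc]
  congr 1
  ext k j
  rw [Matrix.mul_apply, Finset.sum_eq_single (p.symm k)]
  · simp [unitColumns]
  · intro b _ hb
    have : k ≠ p b := fun h => hb (by simp [h])
    simp [unitColumns, this]
  · simp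

/-- Every column of `M` is a combination of the columns `c k` of `M` that do not follow it. -/
def SpannedByPreceding {b : ℕ} {ι : Type*} (M : Matrix ι (Fin b) F) (c : Fin r → Fin b) : Prop :=
  ∀ i, ∃ q : Fin r → F, (∀ k, i < c k → q k = 0) ∧ ∀ a, M a i = ∑ k, M a (c k) * q k

/-- The columns `c` are not assumed independent, so the coefficients of the column `c l` are not
unique. Choosing the unit vector there gives `Y` pivots equal to one. -/
theorem SpannedByPreceding.exists_echelon {b : ℕ} {ι : Type*} {M : Matrix ι (Fin b) F}
    {c : Fin r → Fin b} (hc : Function.Injective c) (h : SpannedByPreceding M c) :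
    ∃ Y : Matrix (Fin r) (Fin b) F, M = M.submatrix id c * Y ∧
      (∀ k i, i < c k → Y k i = 0) ∧ ∀ k l, Y k (c l) = if k = l then 1 else 0 := by
  have h' : ∀ i, ∃ q : Fin r → F, (∀ k, i < c k → q k = 0) ∧
      (∀ a, M a i = ∑ k, M a (c k) * q k) ∧ ∀ l, i = c l → ∀ k, q k = if k = l then 1 else 0 := by
    intro i
    by_cases hi : ∃ l, i = c l
    · obtain ⟨l, rfl⟩ := hi
      refine ⟨fun k => if k = l then 1 else 0, fun k hk => if_neg ?_, by simp, ?_⟩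
      · rintro rfl
        exact lt_irrefl _ hk
      · intro l' hl k
        rw [hc hl]
    · obtain ⟨q, h1, h2⟩ := h i
      exact ⟨q, h1, h2, fun l hl => absurd ⟨l, hl⟩ hi⟩
  choose q h1 h2 h3 using h'
  exact ⟨Matrix.of fun k i => q i k, by ext a i; simp [Matrix.mul_apply, h2 i a],
    fun k i => h1 i k, fun k l => h3 _ l rfl k⟩

/-- Spanning gives `A = Xᵀ A_{I,J} Y`, and `A_{I,J} Pᵀ = L D U`, so `A = (Xᵀ L D) (U P Y)`. The
first factor is an echelon form with pivots `I`. The second has pivots in the columns `J ∘ p.symm`,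
and this is where the triangularity of `Pᵀ U P` enters. -/
theorem isRankProfileMatrix_of_spanned {A : Matrix (Fin m) (Fin n) F} {I : Fin r → Fin m}
    {J : Fin r → Fin n} (hI : StrictMono I) (hJ : StrictMono J)
    (hAI : SpannedByPreceding A.transpose I) (hAJ : SpannedByPreceding A J)
    (p : Equiv.Perm (Fin r)) {d : Fin r → F} (hd : ∀ k, d k ≠ 0) {L U : Fin r → Fin r → F}
    (hLDU : ∀ i k, A (I i) (J (p.symm k)) = ∑ x, L i x * d x * U x k)
    (hL0 : ∀ i k, i < k → L i k = 0) (hL1 : ∀ k, L k k = 1) (hU1 : ∀ k, U k k = 1)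
    (hU : ∀ i j, j < i → U (p i) (p j) = 0) :
    IsRankProfileMatrix A (unitColumns F I * unitColumns F p * (unitColumns F J).transpose) := by
  obtain ⟨X, hX, hX0, hX1⟩ := hAI.exists_echelon hI.injective
  obtain ⟨Y, hY, hY0, hY1⟩ := hAJ.exists_echelon hJ.injective
  rw [unitColumns_mul_perm]
  have hLDU' : A.submatrix I (J ∘ p.symm) =
      Matrix.of L * Matrix.diagonal d * Matrix.of U := by
    ext i k
    rw [Matrix.mul_apply]
    simp [hLDU]
  refine (isRankProfileMatrix_of_echelon (C := X.transpose * (Matrix.of L * Matrix.diagonal d))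
    (R := Matrix.of U * Y.submatrix p.symm id) hI.injective (hJ.injective.comp p.symm.injective)
    ?_ ?_ ?_ ?_ ?_).1
  · have e1 : A = X.transpose * A.submatrix I id := by
      conv_lhs => rw [← Matrix.transpose_transpose A, hX]
      rw [Matrix.transpose_mul]; rfl
    have e2 : A.submatrix I id = A.submatrix I J * Y := by
      conv_lhs => rw [hY]
      ext; simp [Matrix.mul_apply]
    have e3 : A.submatrix I J * Y = A.submatrix I (J ∘ p.symm) * Y.submatrix p.symm id := by
      ext i j
      simp only [Matrix.mul_apply, Matrix.submatrix_apply, id, Function.comp]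
      exact (Equiv.sum_comp p.symm fun k => A (I i) (J k) * Y k j).symm
    rw [Matrix.mul_assoc, ← Matrix.mul_assoc _ (Matrix.of U), ← hLDU', ← e3, ← e2, ← e1]
  · intro i k hik
    rw [Matrix.mul_apply]
    refine Finset.sum_eq_zero fun l _ => ?_
    rw [Matrix.mul_diagonal, Matrix.transpose_apply, Matrix.of_apply]
    -- For `l < k` the entry of `L` vanishes; for `l ≥ k` the row `l` of `X` starts at `I l ≥ I k`,
    -- beyond `i`.
    by_cases hl : l < k
    · rw [hL0 _ _ hl]; ring
    · rw [hX0 _ _ (hik.trans_le (hI.monotone (not_lt.1 hl)))]; ring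
  · intro k
    rw [Matrix.mul_apply, Finset.sum_eq_single k]
    · simp [hX1, hL1, hd]
    · intro l _ hl
      simp [hX1, hl]
    · simp
  · intro k j hj
    rw [Matrix.mul_apply]
    refine Finset.sum_eq_zero fun l _ => ?_
    -- The relevant order is that of the columns before permutation: `Pᵀ U P` vanishes below its
    -- diagonal, and otherwise the row of `Y` starts beyond `j`.
    by_cases hl : p.symm l < p.symm k
    · have := hU _ _ hl
      simp only [Equiv.apply_symm_apply] at this
      rw [Matrix.of_apply, this, zero_mul]
    · rw [Matrix.submatrix_apply, id, hY0 _ _ (lt_of_lt_of_le hj (hJ.monotone (not_lt.1 hl))),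
          mul_zero]
  · intro k
    rw [Matrix.mul_apply, Finset.sum_eq_single k]
    · simp [hY1, hU1]
    · intro l _ hl
      simp [hY1, hl]
    · simp

/-- Elimination with prescribed pivots `d`: it succeeds, or it fails at a first index `i`. -/
theorem exists_ldu_or_mismatch (M : Matrix (Fin r) (Fin r) F) {d : Fin r → F}
    (hd : ∀ k, d k ≠ 0) :
    ∃ (i : ℕ) (L U N : Fin r → Fin r → F), i ≤ r ∧
      (∀ j k, M j k = (∑ x : Fin r, L j x * (if (x : ℕ) < i then d x else 0) * U x k) + N j k) ∧
      (∀ j k, j < k → L j k = 0) ∧ (∀ k, L k k = 1) ∧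
      (∀ j k, k < j → U j k = 0) ∧ (∀ k, U k k = 1) ∧
      (∀ j k : Fin r, (j : ℕ) < i → N j k = 0) ∧ (∀ j k : Fin r, (k : ℕ) < i → N j k = 0) ∧
      ∀ k : Fin r, (k : ℕ) = i → N k k ≠ d k := by
  -- If no index fails, the elimination goes through up to `r`. At `i = r` the condition on the next
  -- pivot is vacuous, so the statement holds after all.
  by_contra hcon
  have key : ∀ i ≤ r, ∃ (L U N : Fin r → Fin r → F),
      (∀ j k, M j k = (∑ x : Fin r, L j x * (if (x : ℕ) < i then d x else 0) * U x k) + N j k) ∧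
      (∀ j k, j < k → L j k = 0) ∧ (∀ k, L k k = 1) ∧
      (∀ j k, k < j → U j k = 0) ∧ (∀ k, U k k = 1) ∧
      (∀ j k : Fin r, (j : ℕ) < i → N j k = 0) ∧ (∀ j k : Fin r, (k : ℕ) < i → N j k = 0) := by
    intro i
    induction i with
    | zero =>
      intro _
      refine ⟨fun j k => (1 : Matrix _ _ F) j k, fun j k => (1 : Matrix _ _ F) j k, M,
        by simp, ?_, by simp, ?_, by simp, by simp, by simp⟩
      · intro j k h; exact Matrix.one_apply_ne h.ne
      · intro j k h; exact Matrix.one_apply_ne h.ne'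
    | succ i ih =>
      intro hi
      obtain ⟨L, U, N, hM, hL0, hL1, hU0, hU1, hN1, hN2⟩ := ih (by omega)
      let t : Fin r := ⟨i, hi⟩
      have htt : N t t = d t := by
        by_contra h
        refine hcon ⟨i, L, U, N, by omega, hM, hL0, hL1, hU0, hU1, hN1, hN2, ?_⟩
        intro k hk
        obtain rfl : k = t := Fin.ext hk
        exact h
      have hdt := hd t
      -- One elimination step: the column and the row `t` of the residual, divided by the prescribed
      -- pivot, enter `L` and `U`. Their diagonal entries are one because `N t t = d t`.
      refine ⟨fun j k => if k = t then N j t / d t else L j k,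
        fun j k => if j = t then N t k / d t else U j k,
        fun j k => N j k - N j t * N t k / d t, ?_, ?_, ?_, ?_, ?_, ?_, ?_⟩
      · intro j k
        rw [hM, ← Finset.add_sum_erase _ _ (Finset.mem_univ t),
          ← Finset.add_sum_erase (Finset.univ : Finset (Fin r)) (fun x => (if x = t then N j t / d t
            else L j x) * (if (x : ℕ) < i + 1 then d x else 0) *
            (if x = t then N t k / d t else U x k)) (Finset.mem_univ t)]
        have : ∑ x ∈ Finset.univ.erase t, L j x * (if (x : ℕ) < i then d x else 0) * U x k =
            ∑ x ∈ Finset.univ.erase t, (if x = t then N j t / d t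
            else L j x) * (if (x : ℕ) < i + 1 then d x else 0) *
            (if x = t then N t k / d t else U x k) := by
          refine Finset.sum_congr rfl fun x hx => ?_
          have hxt := Finset.ne_of_mem_erase hx
          have : (x : ℕ) ≠ i := fun h => hxt (Fin.ext h)
          have e : ((x : ℕ) < i + 1) = ((x : ℕ) < i) := by
            apply propext; omega
          simp [hxt, e]
        rw [this]
        simp only [t, lt_irrefl, if_false, if_true, lt_add_one]
        field_simp
        ring
      · intro j k hjk
        dsimp only
        split_ifs with h
        · subst h
          rw [hN1 j t hjk, zero_div]
        · exact hL0 j k hjk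
      · intro k
        dsimp only
        split_ifs with h
        · subst h; rw [htt, div_self hdt]
        · exact hL1 k
      · intro j k hjk
        dsimp only
        split_ifs with h
        · subst h
          rw [hN2 t k hjk, zero_div]
        · exact hU0 j k hjk
      · intro k
        dsimp only
        split_ifs with h
        · subst h; rw [htt, div_self hdt]
        · exact hU1 k
      · intro j k hj
        dsimp only
        by_cases h : j = t
        · subst h; rw [htt]; field_simp; ring
        · have : (j : ℕ) < i := by
            have : (j : ℕ) ≠ i := fun h' => h (Fin.ext h')
            omega
          rw [hN1 j k this, hN1 j t this]; simp
      · intro j k hj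
        dsimp only
        by_cases h : k = t
        · subst h; rw [htt]; field_simp; ring
        · have : (k : ℕ) < i := by
            have : (k : ℕ) ≠ i := fun h' => h (Fin.ext h')
            omega
          rw [hN2 j k this, hN2 t k this]; simp
  obtain ⟨L, U, N, hM, hL0, hL1, hU0, hU1, hN1, hN2⟩ := key r le_rfl
  exact hcon ⟨r, L, U, N, le_rfl, hM, hL0, hL1, hU0, hU1, hN1, hN2,
    fun k hk => absurd hk k.2.ne⟩

end LinearAlgebra

/-! ### Compositional semantics of Verifiers -/

section Semantics

variable {F : Type u} [Field F] {m n : ℕ} {α β : Type u}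

theorem VProg.bind_eq (p : VProg F m n α) (f : α → VProg F m n β) : p >>= f = p.bind f := rfl

theorem VProg.pure_eq (a : α) : (pure a : VProg F m n α) = .accept a := rfl

/-- Compositional semantics of a Verifier with values in `X`, given the interpretations of sampling
and of rejection. -/
def interp {X : Type v} (A : Matrix (Fin m) (Fin n) F) (σ : Prover F) (smp : (F → X) → X)
    (rej : X) :
    VProg F m n α → (α → List (Msg F) → X) → List (Msg F) → X
  | .accept a, Q, h => Q a h
  | .reject, _, _ => rej
  | .sample k, Q, h => smp fun a => interp A σ smp rej (k a) Q h
  | .send a p, Q, h => interp A σ smp rej p Q (h ++ [.fld a])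
  | .recv k, Q, h => interp A σ smp rej (k (σ.fld h)) Q (h ++ [.fld (σ.fld h)])
  | .recvIdx k, Q, h => interp A σ smp rej (k (σ.idx h)) Q (h ++ [.idx (σ.idx h)])
  | .recvLst k, Q, h => interp A σ smp rej (k (σ.lst h)) Q (h ++ [.lst (σ.lst h)])
  | .op o a b k, Q, h => interp A σ smp rej (k (o.eval a b)) Q h
  | .mulVec v k, Q, h => interp A σ smp rej (k (A.mulVec v)) Q h
  | .vecMul v k, Q, h => interp A σ smp rej (k (A.vecMul v)) Q h

section Interp

variable {X : Type v} {A : Matrix (Fin m) (Fin n) F} {σ : Prover F} {smp : (F → X) → X} {rej : X}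

/-- Allows each block of the protocol to be analysed against an arbitrary continuation `Q`. -/
theorem interp_bind (p : VProg F m n α) (f : α → VProg F m n β) (Q : β → List (Msg F) → X)
    (h : List (Msg F)) : interp A σ smp rej (p >>= f) Q h =
      interp A σ smp rej p (fun a h' => interp A σ smp rej (f a) Q h') h := by
  rw [VProg.bind_eq]
  induction p generalizing h with
  | accept a => rfl
  | reject => rfl
  | sample k ih => simp only [VProg.bind, interp, ih]
  | send a p ih => simp only [VProg.bind, interp, ih]
  | recv k ih => simp only [VProg.bind, interp, ih]
  | recvIdx k ih => simp only [VProg.bind, interp, ih]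
  | recvLst k ih => simp only [VProg.bind, interp, ih]
  | op o a b k ih => simp only [VProg.bind, interp, ih]
  | mulVec v k ih => simp only [VProg.bind, interp, ih]
  | vecMul v k ih => simp only [VProg.bind, interp, ih]

@[simp] theorem interp_pure (a : α) (Q : α → List (Msg F) → X) (h : List (Msg F)) :
    interp (m := m) (n := n) A σ smp rej (pure a) Q h = Q a h := rfl

@[simp] theorem interp_draw (Q : F → List (Msg F) → X) (h : List (Msg F)) :
    interp A σ smp rej draw Q h = smp fun a => Q a h := rfl

@[simp] theorem interp_challenge (Q : F → List (Msg F) → X) (h : List (Msg F)) :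
    interp A σ smp rej challenge Q h = smp fun a => Q a (h ++ [.fld a]) := rfl

@[simp] theorem interp_response (Q : F → List (Msg F) → X) (h : List (Msg F)) :
    interp A σ smp rej response Q h = Q (σ.fld h) (h ++ [.fld (σ.fld h)]) := rfl

@[simp] theorem interp_arith (o : ArithOp) (a b : F) (Q : F → List (Msg F) → X)
    (h : List (Msg F)) : interp A σ smp rej (arith o a b) Q h = Q (o.eval a b) h := rfl

@[simp] theorem interp_timesA (v : Fin n → F) (Q : (Fin m → F) → List (Msg F) → X)
    (h : List (Msg F)) : interp A σ smp rej (timesA v) Q h = Q (A.mulVec v) h := rfl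

@[simp] theorem interp_timesAT (v : Fin m → F) (Q : (Fin n → F) → List (Msg F) → X)
    (h : List (Msg F)) : interp A σ smp rej (timesAT v) Q h = Q (A.vecMul v) h := rfl

open Classical in
@[simp] theorem interp_check (p : Prop) (Q : PUnit → List (Msg F) → X) (h : List (Msg F)) :
    interp A σ smp rej (check p) Q h = if p then Q PUnit.unit h else rej := by
  unfold check
  split_ifs <;> rfl

@[simp] theorem interp_sendVec (r : ℕ) (v : Fin r → F) (Q : PUnit → List (Msg F) → X)
    (h : List (Msg F)) : interp A σ smp rej (sendVec r v) Q h =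
      Q PUnit.unit (h ++ List.ofFn fun i => .fld (v i)) := by
  induction r generalizing h with
  | zero => simp [sendVec]
  | succ r ih => simp [sendVec, interp, ih]

theorem interp_forUp_succ (r : ℕ) (f : Fin (r + 1) → VProg F m n β)
    (Q : (Fin (r + 1) → β) → List (Msg F) → X) (h : List (Msg F)) :
    interp A σ smp rej (forUp (r + 1) f) Q h = interp A σ smp rej (f 0) (fun a h' =>
      interp A σ smp rej (forUp r fun i => f i.succ) (fun t h'' => Q (Fin.cons a t) h'') h') h := by
  simp only [forUp, interp_bind, interp_pure]

theorem interp_forDown_succ (r : ℕ) (f : Fin (r + 1) → VProg F m n β)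
    (Q : (Fin (r + 1) → β) → List (Msg F) → X) (h : List (Msg F)) :
    interp A σ smp rej (forDown (r + 1) f) Q h =
      interp A σ smp rej (f (Fin.last r)) (fun a h' =>
        interp A σ smp rej (forDown r fun i => f i.castSucc)
          (fun t h'' => Q (Fin.snoc (α := fun _ => β) t a) h'') h') h := by
  simp only [forDown, interp_bind, interp_pure]

theorem interp_forUp_of_forall (r : ℕ) (f : Fin r → VProg F m n β) (v : Fin r → β)
    (hf : ∀ i (Q : β → List (Msg F) → X) h, interp A σ smp rej (f i) Q h = Q (v i) h)
    (Q : (Fin r → β) → List (Msg F) → X) (h : List (Msg F)) :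
    interp A σ smp rej (forUp r f) Q h = Q v h := by
  induction r generalizing h with
  | zero => simp [forUp, Subsingleton.elim v Fin.elim0]
  | succ r ih =>
    rw [interp_forUp_succ, hf, ih _ (fun i => v i.succ) (fun i => hf i.succ)]
    congr
    exact Fin.cons_self_tail v

@[simp] theorem interp_forUp_arith (r : ℕ) (o : ArithOp) (a b : Fin r → F)
    (Q : (Fin r → F) → List (Msg F) → X) (h : List (Msg F)) :
    interp A σ smp rej (forUp r fun i => arith o (a i) (b i)) Q h =
      Q (fun i => o.eval (a i) (b i)) h :=
  interp_forUp_of_forall r _ _ (fun _ _ _ => rfl) Q h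

@[simp] theorem interp_suffixSums (r : ℕ) (x : Fin (r + 1) → F)
    (Q : (Fin (r + 1) → F) → List (Msg F) → X) (h : List (Msg F)) :
    interp A σ smp rej (suffixSums r x) Q h = Q (fun j => ∑ k, if j ≤ k then x k else 0) h := by
  induction r with
  | zero =>
    simp only [suffixSums, interp_pure]
    congr
    ext j
    obtain rfl : j = 0 := Fin.fin_one_eq_zero j
    simp
  | succ r ih =>
    simp only [suffixSums, interp_bind, interp_pure, ih, interp_arith]
    congr
    ext j
    refine Fin.cases ?_ (fun j => ?_) j
    · simp [ArithOp.eval, Fin.sum_univ_succ (n := r + 1)]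
    · rw [Fin.sum_univ_succ (n := r + 1)]
      simp

@[simp] theorem interp_dot (r : ℕ) (a b : Fin r → F) (Q : F → List (Msg F) → X)
    (h : List (Msg F)) : interp A σ smp rej (dot r a b) Q h = Q (∑ i, a i * b i) h := by
  induction r generalizing Q with
  | zero => simp [dot]
  | succ r ih =>
    cases r with
    | zero => simp [dot, ArithOp.eval]
    | succ r =>
      simp only [dot, interp_bind, interp_arith, ih, ArithOp.eval]
      rw [Fin.sum_univ_succ (n := r + 1)]

end Interp

/-! ### Expectation, almost sure postconditions, resources -/

variable (A : Matrix (Fin m) (Fin n) F) (S : Finset F) (hS : S.Nonempty) (σ : Prover F)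

/-- The mean value of a function on the finite set `S`. -/
noncomputable def sampleMean (S : Finset F) (k : F → ℝ) : ℝ := (∑ a ∈ S, k a) / S.card

/-- The expectation of `Q` over the accepting executions. -/
noncomputable abbrev expect (p : VProg F m n α) (Q : α → List (Msg F) → ℝ) (h : List (Msg F)) : ℝ :=
  interp A σ (sampleMean S) 0 p Q h

theorem sampleMean_le_of_forall {S : Finset F} (hS : S.Nonempty) {c : ℝ} {k : F → ℝ}
    (hk : ∀ a, k a ≤ c) : sampleMean S k ≤ c := by
  have hcard : (0 : ℝ) < S.card := by exact_mod_cast hS.card_pos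
  refine (div_le_iff₀ hcard).2 ?_
  refine (Finset.sum_le_sum fun a _ => hk a).trans ?_
  simp [mul_comm]

/-- For all samples, the Verifier accepts with a result and a transcript that satisfy `Q`. -/
def Ensures (p : VProg F m n α) (Q : α → List (Msg F) → Prop) (h : List (Msg F)) : Prop :=
  interp A σ (fun k => ∀ a, k a) False p Q h

theorem expect_nonneg (p : VProg F m n α) (Q : α → List (Msg F) → ℝ) (h : List (Msg F))
    (hQ : ∀ a h, 0 ≤ Q a h) : 0 ≤ expect A S σ p Q h := by
  unfold expect
  induction p generalizing h with
  | accept a => exact hQ _ _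
  | reject => exact le_rfl
  | sample k ih => exact div_nonneg (Finset.sum_nonneg fun a _ => ih a h) (by positivity)
  | send a p ih => exact ih _
  | recv k ih => exact ih _ _
  | recvIdx k ih => exact ih _ _
  | recvLst k ih => exact ih _ _
  | op o a b k ih => exact ih _ _
  | mulVec v k ih => exact ih _ _
  | vecMul v k ih => exact ih _ _

theorem expect_le_of_forall (hS : S.Nonempty) {c : ℝ} (hc : 0 ≤ c) (p : VProg F m n α)
    (Q : α → List (Msg F) → ℝ) (h : List (Msg F)) (hQ : ∀ a h, Q a h ≤ c) : expect A S σ p Q h ≤ c := by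
  unfold expect
  induction p generalizing h with
  | accept a => exact hQ _ _
  | reject => exact hc
  | sample k ih => exact sampleMean_le_of_forall hS fun a => ih a h
  | send a p ih => exact ih _
  | recv k ih => exact ih _ _
  | recvIdx k ih => exact ih _ _
  | recvLst k ih => exact ih _ _
  | op o a b k ih => exact ih _ _
  | mulVec v k ih => exact ih _ _
  | vecMul v k ih => exact ih _ _

-- Passes from the distribution of outcomes to nested means. Rejection contributes zero, so only
-- accepting executions count.
open Classical in
theorem toOuterMeasure_run (p : VProg F m n α) (Q : α → Prop) (h : List (Msg F)) (t : ℕ) :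
    (p.run A S hS σ h t).toOuterMeasure {res | ∃ R, res.output = some R ∧ Q R} =
      ENNReal.ofReal (expect A S σ p (fun a _ => if Q a then 1 else 0) h) := by
  have hQ0 : ∀ (a : α) (_ : List (Msg F)), (0 : ℝ) ≤ if Q a then 1 else 0 := by
    intro a _; split_ifs <;> simp
  induction p generalizing h t with
  | accept a =>
    rw [VProg.run, PMF.toOuterMeasure_pure_apply]
    simp only [expect, interp, Set.mem_ofPred_eq, Option.some.injEq, exists_eq_left']
    split_ifs <;> simp
  | reject =>
    rw [VProg.run, PMF.toOuterMeasure_pure_apply]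
    simp [expect, interp]
  | sample k ih =>
    rw [VProg.run, PMF.toOuterMeasure_bind_apply, tsum_eq_sum (s := S)]
    · have e : expect A S σ (.sample k) (fun a _ => if Q a then 1 else 0) h =
          (∑ a ∈ S, expect A S σ (k a) (fun a _ => if Q a then 1 else 0) h) / S.card := rfl
      rw [e, ENNReal.ofReal_div_of_pos (by exact_mod_cast hS.card_pos), ENNReal.ofReal_natCast,
        ENNReal.ofReal_sum_of_nonneg fun a _ => expect_nonneg A S σ _ _ h hQ0, div_eq_mul_inv,
        Finset.sum_mul]
      refine Finset.sum_congr rfl fun a ha => ?_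
      rw [ih, PMF.uniformOfFinset_apply_of_mem hS ha, mul_comm]
    · intro a ha
      rw [PMF.uniformOfFinset_apply_of_notMem hS ha, zero_mul]
  | send a p ih => exact ih _ _
  | recv k ih => exact ih _ _ _
  | recvIdx k ih => exact ih _ _ _
  | recvLst k ih => exact ih _ _ _
  | op o a b k ih => exact ih _ _ _
  | mulVec v k ih => exact ih _ _ _
  | vecMul v k ih => exact ih _ _ _

-- `Ensures` quantifies over all field elements and not just over `S`, so one proof covers every
-- sample set.
variable {A σ} in
theorem Ensures.of_mem_support {p : VProg F m n α} {Q : α → List (Msg F) → Prop}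
    {h : List (Msg F)} (hp : Ensures A σ p Q h) (t : ℕ) {res : Result F α}
    (hres : res ∈ (p.run A S hS σ h t).support) :
    ∃ a, res.output = some a ∧ Q a res.transcript := by
  unfold Ensures at hp
  induction p generalizing h t with
  | accept a =>
    simp only [VProg.run, PMF.support_pure, Set.mem_singleton_iff] at hres
    subst hres
    exact ⟨a, rfl, hp⟩
  | reject => exact hp.elim
  | sample k ih =>
    simp only [VProg.run, PMF.mem_support_bind_iff] at hres
    obtain ⟨a, _, ha⟩ := hres
    exact ih a (hp a) t ha
  | send a p ih => exact ih hp _ hres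
  | recv k ih => exact ih _ hp _ hres
  | recvIdx k ih => exact ih _ hp _ hres
  | recvLst k ih => exact ih _ hp _ hres
  | op o a b k ih => exact ih _ hp _ hres
  | mulVec v k ih => exact ih _ hp _ hres
  | vecMul v k ih => exact ih _ hp _ hres

theorem run_bind (p : VProg F m n α) (f : α → VProg F m n β) (h : List (Msg F)) (t : ℕ) :
    (p >>= f).run A S hS σ h t = (p.run A S hS σ h t).bind fun res =>
      match res.output with
      | some a => (f a).run A S hS σ res.transcript res.cost
      | none => PMF.pure ⟨none, res.transcript, res.cost⟩ := by
  rw [VProg.bind_eq]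
  induction p generalizing h t with
  | accept a => simp [VProg.bind, VProg.run]
  | reject => simp [VProg.bind, VProg.run]
  | sample k ih =>
    simp only [VProg.bind, VProg.run, PMF.bind_bind]
    congr 1
    ext1 a
    exact ih a h t
  | send a p ih => exact ih _ _
  | recv k ih => exact ih _ _ _
  | recvIdx k ih => exact ih _ _ _
  | recvLst k ih => exact ih _ _ _
  | op o a b k ih => exact ih _ _ _
  | mulVec v k ih => exact ih _ _ _
  | vecMul v k ih => exact ih _ _ _

/-- The communication space of a list of messages. -/
def commSize (h : List (Msg F)) : ℕ := (h.map Msg.size).sum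

/-- Whatever the Prover does, `p` communicates at most `s` and costs at most `c`. -/
def Spends (p : VProg F m n α) (s c : ℕ) : Prop :=
  ∀ h t, ∀ res ∈ (p.run A S hS σ h t).support, res.comm ≤ commSize h + s ∧ res.cost ≤ t + c

/-! ### Communication and arithmetic cost against an arbitrary Prover. -/

section Spends

variable {A S hS σ}

theorem Spends.mono {p : VProg F m n α} {s c s' c' : ℕ} (hp : Spends A S hS σ p s c)
    (hs : s ≤ s') (hc : c ≤ c') : Spends A S hS σ p s' c' := by
  intro h t res hres
  have := hp h t res hres
  omega

/-- The bounds add up because they are required for every past; a rejection in `p` merely leaves the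
second budget unspent. -/
theorem Spends.bind {p : VProg F m n α} {f : α → VProg F m n β} {s c s' c' : ℕ}
    (hp : Spends A S hS σ p s c) (hf : ∀ a, Spends A S hS σ (f a) s' c') :
    Spends A S hS σ (p >>= f) (s + s') (c + c') := by
  intro h t res hres
  rw [run_bind, PMF.mem_support_bind_iff] at hres
  obtain ⟨res', h', hres⟩ := hres
  have h1 := hp h t res' h'
  unfold Result.comm at h1
  split at hres
  · have h2 := hf _ _ _ res hres
    unfold commSize at h1 h2
    unfold commSize
    omega
  · rw [PMF.support_pure, Set.mem_singleton_iff] at hres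
    subst hres
    unfold commSize Result.comm
    unfold commSize at h1
    dsimp only
    omega

theorem Spends.pure (a : α) : Spends A S hS σ (Pure.pure a) 0 0 := by
  intro h t res hres
  rw [VProg.pure_eq, VProg.run, PMF.support_pure, Set.mem_singleton_iff] at hres
  subst hres
  exact ⟨le_rfl, le_rfl⟩

theorem Spends.reject : Spends A S hS σ (VProg.reject : VProg F m n α) 0 0 := by
  intro h t res hres
  rw [VProg.run, PMF.support_pure, Set.mem_singleton_iff] at hres
  subst hres
  exact ⟨le_rfl, le_rfl⟩

theorem Spends.sample {k : F → VProg F m n α} {s c : ℕ} (hk : ∀ a, Spends A S hS σ (k a) s c) :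
    Spends A S hS σ (.sample k) s c := by
  intro h t res hres
  simp only [VProg.run, PMF.mem_support_bind_iff] at hres
  obtain ⟨a, _, ha⟩ := hres
  exact hk a h t res ha

theorem commSize_append_singleton (h : List (Msg F)) (x : Msg F) :
    commSize (h ++ [x]) = commSize h + x.size := by
  simp [commSize]

theorem Spends.send {a : F} {p : VProg F m n α} {s c : ℕ} (hp : Spends A S hS σ p s c) :
    Spends A S hS σ (.send a p) (s + 1) c := by
  intro h t res hres
  have := hp _ _ res hres
  rw [commSize_append_singleton, Msg.size] at this
  omega

theorem Spends.recv {k : F → VProg F m n α} {s c : ℕ} (hk : ∀ a, Spends A S hS σ (k a) s c) :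
    Spends A S hS σ (.recv k) (s + 1) c := by
  intro h t res hres
  have := hk _ _ _ res hres
  rw [commSize_append_singleton, Msg.size] at this
  omega

theorem Spends.recvIdx {k : ℕ → VProg F m n α} {s c : ℕ} (hk : ∀ a, Spends A S hS σ (k a) s c) :
    Spends A S hS σ (.recvIdx k) (s + 1) c := by
  intro h t res hres
  have := hk _ _ _ res hres
  rw [commSize_append_singleton, Msg.size] at this
  omega

theorem Spends.draw : Spends A S hS σ (draw : VProg F m n F) 0 0 :=
  .sample fun a => .pure a

theorem Spends.challenge : Spends A S hS σ (challenge : VProg F m n F) 1 0 :=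
  .sample fun a => .send (.pure a)

theorem Spends.response : Spends A S hS σ (response : VProg F m n F) 1 0 :=
  .recv fun a => .pure a

theorem Spends.arith (o : ArithOp) (a b : F) :
    Spends A S hS σ (arith o a b : VProg F m n F) 0 1 := by
  intro h t res hres
  exact Spends.pure (A := A) (S := S) (hS := hS) (σ := σ) (o.eval a b) h (t + 1) res hres

theorem Spends.timesA (v : Fin n → F) : Spends A S hS σ (timesA v) 0 (mu A) := by
  intro h t res hres
  exact Spends.pure (A := A) (S := S) (hS := hS) (σ := σ) (A.mulVec v) h (t + mu A) res hres

theorem Spends.timesAT (v : Fin m → F) : Spends A S hS σ (timesAT v) 0 (mu A) := by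
  intro h t res hres
  exact Spends.pure (A := A) (S := S) (hS := hS) (σ := σ) (A.vecMul v) h (t + mu A) res hres

theorem Spends.check (p : Prop) : Spends A S hS σ (check p : VProg F m n PUnit) 0 0 := by
  unfold RPMCert.check
  split_ifs
  · exact .pure _
  · exact .reject

theorem Spends.forUp {r : ℕ} {f : Fin r → VProg F m n β} {s c : ℕ}
    (hf : ∀ i, Spends A S hS σ (f i) s c) : Spends A S hS σ (forUp r f) (r * s) (r * c) := by
  induction r with
  | zero => simpa [RPMCert.forUp] using Spends.pure _
  | succ r ih =>
    have := (hf 0).bind fun a => (ih fun i => hf i.succ).bind fun t =>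
      Spends.pure (Fin.cons (α := fun _ => β) a t)
    exact this.mono (by linarith) (by linarith)

theorem Spends.forDown {r : ℕ} {f : Fin r → VProg F m n β} {s c : ℕ}
    (hf : ∀ i, Spends A S hS σ (f i) s c) : Spends A S hS σ (forDown r f) (r * s) (r * c) := by
  induction r with
  | zero => simpa [RPMCert.forDown] using Spends.pure _
  | succ r ih =>
    have := (hf (Fin.last r)).bind fun a => (ih fun i => hf i.castSucc).bind fun t =>
      Spends.pure (Fin.snoc (α := fun _ => β) t a)
    exact this.mono (by linarith) (by linarith)

theorem Spends.sendVec (r : ℕ) (v : Fin r → F) :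
    Spends A S hS σ (sendVec r v : VProg F m n PUnit) r 0 := by
  induction r with
  | zero => exact .pure _
  | succ r ih => exact .send (ih _)

theorem Spends.recvIdxs {r : ℕ} {k : (Fin r → ℕ) → VProg F m n α} {s c : ℕ}
    (hk : ∀ t, Spends A S hS σ (k t) s c) : Spends A S hS σ (recvIdxs r k) (r + s) c := by
  induction r with
  | zero => simpa [RPMCert.recvIdxs] using hk _
  | succ r ih =>
    exact (Spends.recvIdx fun a => ih fun t => hk _).mono (by omega) le_rfl

theorem Spends.withIncreasing {r b : ℕ} {c : Fin r → ℕ} {k : (Fin r → Fin b) → VProg F m n α}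
    {s t : ℕ} (hk : ∀ c, StrictMono c → Spends A S hS σ (k c) s t) :
    Spends A S hS σ (withIncreasing b c k) s t := by
  unfold RPMCert.withIncreasing
  split_ifs with h
  · exact hk _ fun i j hij => h.1 hij
  · exact Spends.reject.mono (Nat.zero_le _) (Nat.zero_le _)

theorem Spends.withPermutation {r : ℕ} {p : Fin r → ℕ} {k : (Fin r → Fin r) → VProg F m n α}
    {s t : ℕ} (hk : ∀ p, Spends A S hS σ (k p) s t) :
    Spends A S hS σ (withPermutation p k) s t := by
  unfold RPMCert.withPermutation
  split_ifs with h
  · exact hk _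
  · exact Spends.reject.mono (Nat.zero_le _) (Nat.zero_le _)

theorem Spends.dot (r : ℕ) (a b : Fin r → F) :
    Spends A S hS σ (dot r a b : VProg F m n F) 0 (2 * r - 1) := by
  induction r with
  | zero => exact .pure _
  | succ r ih =>
    cases r with
    | zero => exact .arith _ _ _
    | succ r =>
      have := (Spends.arith (A := A) (S := S) (hS := hS) (σ := σ) .mul (a 0) (b 0)).bind fun p =>
        (ih (fun i => a i.succ) (fun i => b i.succ)).bind fun s =>
          Spends.arith (A := A) (S := S) (hS := hS) (σ := σ) .add p s
      exact this.mono (by omega) (by omega)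

theorem Spends.suffixSums (r : ℕ) (x : Fin (r + 1) → F) :
    Spends A S hS σ (suffixSums r x : VProg F m n _) 0 r := by
  induction r with
  | zero => exact .pure _
  | succ r ih =>
    have := (ih fun i => x i.succ).bind fun s =>
      (Spends.arith (A := A) (S := S) (hS := hS) (σ := σ) .add (x 0) (s 0)).bind fun t =>
        Spends.pure (Fin.cons (α := fun _ => F) t s)
    exact this.mono (by omega) (by omega)

theorem Spends.lowerRank {a b r : ℕ} {mul : (Fin b → F) → VProg F m n (Fin a → F)}
    (hmul : ∀ v, Spends A S hS σ (mul v) 0 (mu A)) (c : Fin r → Fin b) :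
    Spends A S hS σ (lowerRank mul c) (a + r) (mu A) :=
  (Spends.bind (.forUp fun _ => .draw) fun _ => .bind (hmul _) fun _ =>
    .bind (.sendVec _ _) fun _ => .bind (.forUp fun _ => .response) fun _ => .check _).mono
    (by omega) (by omega)

theorem Spends.minimality {a b r : ℕ} {mul : (Fin b → F) → VProg F m n (Fin a → F)}
    (hmul : ∀ v, Spends A S hS σ (mul v) 0 (mu A)) (c : Fin r → Fin b) :
    Spends A S hS σ (minimality mul c) (b + 2 * r) (mu A + b + 2 * r) :=
  (Spends.bind (.forUp fun _ => .draw) fun _ => .bind (.sendVec _ _) fun _ =>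
    .bind (.forDown fun _ => .bind .challenge fun _ => .bind .response fun _ => .pure _) fun _ =>
    .bind .draw fun _ => .bind (.suffixSums _ _) fun _ => .bind (.forUp fun _ => .arith _ _ _)
      fun _ => .bind (.forUp fun _ => .arith _ _ _) fun _ => .bind (hmul _) fun _ => .check _).mono
    (by omega) (by omega)

theorem Spends.ldupRounds (r : ℕ) :
    Spends A S hS σ (ldupRounds r : VProg F m n _) (6 * r) (3 * r) := by
  cases r with
  | zero => exact .pure _
  | succ r =>
    exact (Spends.bind (.forDown fun _ => .bind .challenge fun _ => .bind .challenge fun _ =>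
      .bind .response fun _ => .bind .response fun _ => .bind .challenge fun _ =>
      .bind .response fun _ => .pure _) fun _ => .bind .draw fun _ => .bind .draw fun _ =>
      .bind .draw fun _ => .bind (.forUp fun _ => .arith _ _ _) fun _ =>
      .bind (.forUp fun _ => .arith _ _ _) fun _ => .bind (.forUp fun _ => .arith _ _ _) fun _ =>
      .pure _).mono (by omega) (by omega)

theorem Spends.rpmInvertible {r : ℕ} (I : Fin r → Fin m) (J : Fin r → Fin n) :
    Spends A S hS σ (rpmInvertible I J) (10 * r) (mu A + 16 * r) :=
  (Spends.recvIdxs fun _ => .withPermutation fun _ => .bind (.forUp fun _ => .response) fun _ =>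
    .bind (.check _) fun _ => .bind (.forUp fun _ => .bind .challenge fun _ =>
    .bind .response fun _ => .pure _) fun _ => .bind (.ldupRounds r) fun _ =>
    .bind (.timesAT _) fun _ => .bind (.forUp fun _ => .arith _ _ _) fun _ =>
    .bind (.dot _ _ _) fun _ => .bind (.dot _ _ _) fun _ => .bind (.check _) fun _ =>
    .bind (.dot _ _ _) fun _ => .bind (.dot _ _ _) fun _ => .bind (.check _) fun _ =>
    .bind (.dot _ _ _) fun _ => .bind (.dot _ _ _) fun _ => .bind (.check _) fun _ =>
    .pure _).mono (by omega) (by omega)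

end Spends

/-- Communication: `2r` for the two commitments, the length of one product vector plus `r` for
Independence, `m + n + 4r` for the two Minimality checks, `10r` for the last phase. This is `m + n +
17r` plus the length of that vector, which is `n` if the rows come first and `m` otherwise.
Operations: four products and `m + n + 20r` more. -/
theorem execution_resources (rowsFirst : Bool) {res : Result F (Matrix (Fin m) (Fin n) F)}
    (hres : res ∈ (execution rowsFirst A S hS σ).support) :
    res.comm ≤ m + n + max m n + 17 * (σ.lst []).length ∧
      (rowsFirst = decide (n < m) → res.comm ≤ m + n + min m n + 17 * (σ.lst []).length) ∧
      res.cost ≤ 4 * mu A + m + n + 21 * (σ.lst []).length := by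
  unfold execution rpmVerifier at hres
  set r := (σ.lst []).length with hr
  cases rowsFirst with
  | true =>
    rw [VProg.run] at hres
    have := (Spends.withIncreasing (A := A) (S := S) (hS := hS) (σ := σ)
      (c := (σ.lst []).get) (b := m) fun I _ => .bind (.lowerRank .timesAT I) fun _ =>
      .bind (.minimality .timesAT I) fun _ => .recvIdxs fun j => .withIncreasing fun J _ =>
      .bind (.minimality .timesA J) fun _ => .rpmInvertible I J) _ _ res hres
    simp only [commSize, List.nil_append, List.map_cons, List.map_nil, List.sum_cons, List.sum_nil,
      Msg.size, ← hr] at this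
    refine ⟨by omega, fun h => ?_, by omega⟩
    have : n < m := by simpa using h.symm
    omega
  | false =>
    rw [VProg.run] at hres
    have := (Spends.withIncreasing (A := A) (S := S) (hS := hS) (σ := σ)
      (c := (σ.lst []).get) (b := n) fun I _ => .bind (.lowerRank .timesA I) fun _ =>
      .bind (.minimality .timesA I) fun _ => .recvIdxs fun j => .withIncreasing fun J _ =>
      .bind (.minimality .timesAT J) fun _ => .rpmInvertible J I) _ _ res hres
    simp only [commSize, List.nil_append, List.map_cons, List.map_nil, List.sum_cons, List.sum_nil,
      Msg.size, ← hr] at this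
    refine ⟨by omega, fun h => ?_, by omega⟩
    have : ¬ n < m := by simpa using h
    omega

end Semantics

/-! ### Soundness of the certificate of minimality -/

section Soundness

variable {F : Type u} [Field F] {m n : ℕ} {α β : Type u}

/-- The probability that a sample avoids a given element of `S`. -/
noncomputable def rho (S : Finset F) : ℝ := 1 - 1 / (S.card : ℝ)

theorem rho_nonneg {S : Finset F} (hS : S.Nonempty) : 0 ≤ rho S := by
  have h : (1 : ℝ) ≤ S.card := by exact_mod_cast hS.card_pos
  have := (div_le_one (by linarith)).2 h
  unfold rho
  linarith

theorem rho_le_one (S : Finset F) : rho S ≤ 1 := by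
  unfold rho
  have : (0 : ℝ) ≤ 1 / S.card := by positivity
  linarith

theorem one_sub_rho_pow_nonneg {S : Finset F} (hS : S.Nonempty) (j : ℕ) : 0 ≤ 1 - rho S ^ j := by
  have := pow_le_one₀ (n := j) (rho_nonneg hS) (rho_le_one S)
  linarith

theorem one_sub_rho_pow_mono {S : Finset F} (hS : S.Nonempty) {i j : ℕ} (hij : i ≤ j) :
    1 - rho S ^ i ≤ 1 - rho S ^ j := by
  have := pow_le_pow_of_le_one (rho_nonneg hS) (rho_le_one S) hij
  linarith

/-- At most one value in `S` is lost, with weight `1/|S|`, and the others leave the error `1 - ρ^j`;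
now `1/|S| + ρ (1 - ρ^j) = 1 - ρ^(j+1)`. Each decisive sample thus adds one factor `ρ`. -/
theorem sampleMean_le_of_ne {S : Finset F} (hS : S.Nonempty) {j : ℕ} {k : F → ℝ}
    (h1 : ∀ a, k a ≤ 1) (a₀ : F) (hk : ∀ a, a ≠ a₀ → k a ≤ 1 - rho S ^ j) :
    sampleMean S k ≤ 1 - rho S ^ (j + 1) := by
  classical
  have hcard : (0 : ℝ) < S.card := by exact_mod_cast hS.card_pos
  refine (div_le_iff₀ hcard).2 ?_
  have h : ∑ a ∈ S, k a ≤ ∑ a ∈ S, ((1 - rho S ^ j) + if a = a₀ then rho S ^ j else 0) := by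
    refine Finset.sum_le_sum fun a _ => ?_
    split_ifs with ha
    · linarith [h1 a]
    · linarith [hk a ha]
  have h' : ∑ a ∈ S, (if a = a₀ then rho S ^ j else 0) ≤ rho S ^ j := by
    rw [Finset.sum_ite_eq' S a₀]
    split_ifs
    · exact le_rfl
    · exact pow_nonneg (rho_nonneg hS) j
  rw [Finset.sum_add_distrib, Finset.sum_const, nsmul_eq_mul] at h
  have e : (1 - rho S ^ (j + 1)) * S.card = S.card * (1 - rho S ^ j) + rho S ^ j := by
    rw [pow_succ]
    nth_rewrite 2 [rho]
    field_simp
    ring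
  linarith

variable {A : Matrix (Fin m) (Fin n) F} {S : Finset F} {σ : Prover F}

/-- The decisive challenge is the one with the last index `i` as in `hi`. Responses from round `i`
on are the only ones that may depend on it, and they do not enter the form; given the past, the form
has a single root. Here `w` and `nxt` are the outcome and the transcript of a round, while `e` and
`f` read off its challenge and its response. -/
theorem expect_forUp_affine (hS : S.Nonempty) (step : VProg F m n β) (e f : β → F)
    (w : F → List (Msg F) → β) (nxt : F → List (Msg F) → List (Msg F))
    (hstep : ∀ Q h, expect A S σ step Q h = sampleMean S fun a => Q (w a h) (nxt a h))
    (he : ∀ a h, e (w a h) = a) {j r : ℕ} {κ μ : Fin r → F}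
    (hi : ∃ i, κ i ≠ 0 ∧ ∀ l, i ≤ l → μ l = 0) (c : F) {Q : (Fin r → β) → List (Msg F) → ℝ}
    (hQ1 : ∀ t h, Q t h ≤ 1)
    (hQ : ∀ t h, c + ∑ i, κ i * e (t i) + ∑ i, μ i * f (t i) ≠ 0 → Q t h ≤ 1 - rho S ^ j)
    (h : List (Msg F)) :
    expect A S σ (forUp r fun _ => step) Q h ≤ 1 - rho S ^ (j + 1) := by
  induction r generalizing c h with
  | zero => exact hi.choose.elim0
  | succ r ih =>
    rw [expect, interp_forUp_succ]
    refine (hstep _ _).trans_le ?_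
    -- As long as a decisive index lies further on, the present round is absorbed into the constant
    -- `c`. Otherwise the decisive index is `0`, no response enters the form, and the later `κ`
    -- vanish.
    by_cases hcase : ∃ i : Fin r, κ i.succ ≠ 0 ∧ ∀ l, i ≤ l → μ l.succ = 0
    · refine sampleMean_le_of_forall hS fun a => ?_
      refine ih hcase (c + κ 0 * a + μ 0 * f (w a h)) (fun t h => hQ1 _ _) ?_ _
      intro t h' ht
      refine hQ _ _ fun h0 => ht ?_
      rw [← h0, Fin.sum_univ_succ, Fin.sum_univ_succ (f := fun i => μ i * _)]
      simp only [Fin.cons_zero, Fin.cons_succ, he]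
      ring
    · obtain ⟨i, hi1, hi2⟩ := hi
      have hi0 : i = 0 := by
        by_contra hne
        obtain ⟨i', rfl⟩ := Fin.exists_succ_eq.2 hne
        exact hcase ⟨i', hi1, fun l hl => hi2 _ (Fin.succ_le_succ_iff.2 hl)⟩
      subst hi0
      have hμ : ∀ l, μ l = 0 := fun l => hi2 l (Fin.zero_le l)
      have hκ : ∀ l : Fin r, κ l.succ = 0 := by
        intro l
        by_contra hl
        exact hcase ⟨l, hl, fun l' _ => hμ _⟩
      refine sampleMean_le_of_ne hS (fun a => ?_) (-c / κ 0) fun a ha => ?_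
      · exact expect_le_of_forall A S σ hS zero_le_one _ _ _ fun t h => hQ1 _ _
      · refine expect_le_of_forall A S σ hS (one_sub_rho_pow_nonneg hS j) _ _ _ fun t h' => ?_
        refine hQ _ _ fun h0 => ha ?_
        rw [Fin.sum_univ_succ] at h0
        simp only [Fin.cons_zero, he, hμ, hκ, zero_mul, Finset.sum_const_zero, add_zero] at h0
        rw [eq_div_iff hi1]
        linear_combination h0

/-- Makes the lemma on affine forms, stated for increasing rounds, available for Minimality, whose
rounds run downwards. -/
theorem interp_forDown_eq_forUp {X : Type v} {smp : (F → X) → X} {rej : X} (r : ℕ)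
    (f : Fin r → VProg F m n β) (Q : (Fin r → β) → List (Msg F) → X) (h : List (Msg F)) :
    interp A σ smp rej (forDown r f) Q h =
      interp A σ smp rej (forUp r fun i => f i.rev) (fun t h' => Q (fun i => t i.rev) h') h := by
  induction r generalizing h with
  | zero =>
    simp only [forDown, forUp, interp_pure]
    congr
  | succ r ih =>
    rw [interp_forDown_succ, interp_forUp_succ, Fin.rev_zero]
    simp only [Fin.rev_succ]
    congr 1
    ext1 a
    ext1 h'
    rw [ih]
    congr 1
    ext1 t
    ext1 h''
    congr 1
    ext1 i
    refine Fin.lastCases ?_ (fun i => ?_) i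
    · simp
    · simp [Fin.rev_castSucc]

/-- As `c` increases, the `k` with `c k ≤ i` form an initial segment, which its cardinality
determines. -/
theorem lt_segment_iff {b r : ℕ} {c : Fin r → Fin b} (hc : StrictMono c) (i : Fin b)
    (j : Fin r) : (j : ℕ) < segment c i ↔ c j ≤ i := by
  unfold segment
  dsimp only
  constructor
  · intro h
    by_contra hj
    have : (Finset.univ.filter fun k => c k ≤ i) ⊆ Finset.Iio j := by
      intro k hk
      rw [Finset.mem_filter] at hk
      rw [Finset.mem_Iio]
      by_contra hkj
      exact hj ((hc.monotone (not_lt.1 hkj)).trans hk.2)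
    have := Finset.card_le_card this
    rw [Fin.card_Iio] at this
    omega
  · intro h
    have : Finset.Iic j ⊆ (Finset.univ.filter fun k => c k ≤ i) := by
      intro k hk
      rw [Finset.mem_Iic] at hk
      exact Finset.mem_filter.2 ⟨Finset.mem_univ _, (hc.monotone hk).trans h⟩
    have := Finset.card_le_card this
    rw [Fin.card_Iic] at this
    omega

theorem segment_mono {b r : ℕ} (c : Fin r → Fin b) : Monotone (segment c) := by
  intro i i' h
  rw [Fin.le_def]
  dsimp only [segment]
  exact Finset.card_le_card (Finset.monotone_filter_right _ fun k _ (hk : c k ≤ i) => hk.trans h)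

/-- A vector outside a subspace is separated from it by a functional. Testing against `g` reduces
the vector equation of the Minimality check to a scalar one. -/
theorem exists_separating {a b r : ℕ} (M : Matrix (Fin a) (Fin b) F) (c : Fin r → Fin b)
    (i₀ : Fin b) (h : ¬ ∃ q : Fin r → F, (∀ k, i₀ < c k → q k = 0) ∧
      ∀ x, M x i₀ = ∑ k, M x (c k) * q k) :
    ∃ g : Fin a → F, (∀ k, c k ≤ i₀ → ∑ x, M x (c k) * g x = 0) ∧ ∑ x, M x i₀ * g x ≠ 0 := by
  classical
  let p : Submodule F (Fin a → F) :=
    Submodule.span F (Set.range fun k : {k // c k ≤ i₀} => fun x => M x (c k))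
  have hp : (fun x => M x i₀) ∉ p := by
    intro hmem
    obtain ⟨q, hq⟩ := (Submodule.mem_span_range_iff_exists_fun F).1 hmem
    refine h ⟨fun k => if hk : c k ≤ i₀ then q ⟨k, hk⟩ else 0, fun k hk => dif_neg (not_le.2 hk),
      fun x => ?_⟩
    have := congrFun hq x
    rw [← this, Finset.sum_apply]
    refine Finset.sum_of_injOn Subtype.val (fun _ _ _ _ h => Subtype.ext h) (by simp) ?_ ?_
    · intro k _ hk
      dsimp only
      rw [dif_neg (fun hk' => hk ⟨⟨k, hk'⟩, by simp, rfl⟩), mul_zero]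
    · rintro ⟨k, hk⟩ _
      simp [hk, mul_comm]
  obtain ⟨f, hf, hpf⟩ := Submodule.exists_le_ker_of_notMem hp
  have hfx : ∀ y : Fin a → F, f y = ∑ x, y x * f (fun j => if x = j then 1 else 0) := fun y => by
    rw [LinearMap.pi_apply_eq_sum_univ f y]
    rfl
  refine ⟨fun x => f (fun j => if x = j then 1 else 0), fun k hk => ?_, ?_⟩
  · rw [← hfx fun x => M x (c k)]
    exact hpf (Submodule.subset_span ⟨⟨k, hk⟩, rfl⟩)
  · rwa [← hfx fun x => M x i₀]

/-- Isolates the effect of the overwritten coordinates: the vector formed in place by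
`Function.extend` becomes a sum of two terms, as in `Diag(v) W x - E y`. -/
theorem sum_extend {b r : ℕ} {c : Fin r → Fin b} (hc : Function.Injective c) (d : Fin r → F)
    (z μ : Fin b → F) : ∑ i, Function.extend c d z i * μ i =
      ∑ i, z i * μ i + ∑ j, (d j - z (c j)) * μ (c j) := by
  have h1 : ∀ i, Function.extend c d z i * μ i = z i * μ i +
      Function.extend c (fun j => d j - z (c j)) 0 i * μ i := by
    intro i
    by_cases hi : ∃ j, c j = i
    · obtain ⟨j, rfl⟩ := hi
      rw [hc.extend_apply, hc.extend_apply]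
      ring
    · rw [Function.extend_apply' _ _ _ hi, Function.extend_apply' _ _ _ hi]
      simp
  rw [Finset.sum_congr rfl fun i _ => h1 i, Finset.sum_add_distrib]
  congr 1
  rw [← Finset.sum_subset (Finset.subset_univ (Finset.univ.map ⟨c, hc⟩)), Finset.sum_map]
  · simp [hc.extend_apply]
  · intro i _ hi
    rw [Function.extend_apply' _ _ _ (by simpa using hi)]
    simp

/-- Soundness of the minimality certificate. -/
theorem expect_minimality_le (hS : S.Nonempty) {a b r : ℕ}
    {mul : (Fin b → F) → VProg F m n (Fin a → F)} {M : Matrix (Fin a) (Fin b) F}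
    (hmul : ∀ v Q h, interp A σ (sampleMean S) 0 (mul v) Q h = Q (M.mulVec v) h) {c : Fin r → Fin b}
    (hc : StrictMono c) (hM : ¬ SpannedByPreceding M c) {Q : PUnit → List (Msg F) → ℝ}
    (hQ : ∀ t h, Q t h ≤ 1) (h : List (Msg F)) :
    expect A S σ (minimality mul c) Q h ≤ 1 - rho S ^ 2 := by
  classical
  -- The first offending column is chosen, so that all columns before it are correctly spanned.
  obtain ⟨i₀, hi₀, hmin⟩ : ∃ i₀, (¬ ∃ q : Fin r → F, (∀ k, i₀ < c k → q k = 0) ∧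
      ∀ x, M x i₀ = ∑ k, M x (c k) * q k) ∧ ∀ i < i₀, ∃ q : Fin r → F,
      (∀ k, i < c k → q k = 0) ∧ ∀ x, M x i = ∑ k, M x (c k) * q k := by
    unfold SpannedByPreceding at hM
    push Not at hM
    obtain ⟨i, hi⟩ := hM
    have hne : (Finset.univ.filter fun i => ¬ ∃ q : Fin r → F, (∀ k, i < c k → q k = 0) ∧
      ∀ x, M x i = ∑ k, M x (c k) * q k).Nonempty := ⟨i, by simpa using hi⟩
    refine ⟨_, (Finset.mem_filter.1 (Finset.min'_mem _ hne)).2, fun i hi => ?_⟩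
    by_contra hcon
    exact absurd (Finset.min'_le _ i (Finset.mem_filter.2 ⟨Finset.mem_univ _, hcon⟩)) (not_le.2 hi)
  obtain ⟨g, hg, hg0⟩ := exists_separating M c i₀ hi₀
  set μ : Fin b → F := fun i => ∑ x, M x i * g x with hμ
  -- A column `i < i₀` is a combination of columns `c k ≤ i`, which `g` annihilates.
  have hμlt : ∀ i < i₀, μ i = 0 := by
    intro i hi
    obtain ⟨q, hq, hMi⟩ := hmin i hi
    have : μ i = ∑ k, q k * μ (c k) := by
      simp only [hμ, hMi, Finset.sum_mul, Finset.mul_sum]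
      rw [Finset.sum_comm]
      refine Finset.sum_congr rfl fun k _ => Finset.sum_congr rfl fun x _ => by ring
    rw [this]
    refine Finset.sum_eq_zero fun k _ => ?_
    by_cases hk : i < c k
    · rw [hq k hk, zero_mul]
    · rw [show μ (c k) = 0 from hg k ((not_lt.1 hk).trans hi.le), mul_zero]
  set j₀ := segment c i₀ with hj₀
  -- `co v k` is the coefficient of `x k` in the scalar equation. It involves only the columns `i`
  -- with `segment c i ≤ k`; for `k < j₀` these precede `i₀`, where `μ` vanishes.
  let co : (Fin b → F) → Fin (r + 1) → F := fun v k => ∑ i, if segment c i ≤ k then v i * μ i else 0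
  have hco : ∀ v k, k < j₀ → co v k = 0 := by
    intro v k hk
    refine Finset.sum_eq_zero fun i _ => ?_
    split_ifs with hik
    · rw [hμlt i, mul_zero]
      by_contra hi
      exact absurd (segment_mono c (not_lt.1 hi)) (not_le.2 (hik.trans_lt hk))
    · rfl
  -- the tested equation
  have hfin : ∀ (v : Fin b → F) (x : Fin (r + 1) → F) (y : Fin r → F),
      M.mulVec (Function.extend c (fun j => v (c j) *
        (∑ k, if segment c (c j) ≤ k then x k else 0) - y j)
        (fun i => v i * (∑ k, if segment c i ≤ k then x k else 0))) = 0 →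
      ∑ k, co v k * x k + ∑ j, -μ (c j) * y j = 0 := by
    intro v x y h0
    have h1 : ∑ i, Function.extend c (fun j => v (c j) *
        (∑ k, if segment c (c j) ≤ k then x k else 0) - y j)
        (fun i => v i * (∑ k, if segment c i ≤ k then x k else 0)) i * μ i = 0 := by
      have h2 := congrArg (fun u : Fin a → F => ∑ x, u x * g x) h0
      simp only [Matrix.mulVec, dotProduct, Pi.zero_apply, zero_mul, Finset.sum_const_zero,
        Finset.sum_mul] at h2
      rw [Finset.sum_comm] at h2
      refine Eq.trans ?_ h2
      refine Finset.sum_congr rfl fun i _ => ?_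
      rw [hμ, Finset.mul_sum]
      exact Finset.sum_congr rfl fun x _ => by ring
    rw [sum_extend hc.injective] at h1
    refine Eq.trans ?_ h1
    congr 1
    · simp only [co, Finset.sum_mul, Finset.mul_sum]
      rw [Finset.sum_comm]
      refine Finset.sum_congr rfl fun i _ => Finset.sum_congr rfl fun k _ => ?_
      split_ifs <;> ring
    · exact Finset.sum_congr rfl fun j _ => by ring
  simp only [minimality, interp_bind, interp_sendVec]
  -- First decisive sample: as a linear form in `v`, the coefficient `co v j₀` is nontrivial, since
  -- `v i₀` occurs in it with the factor `μ i₀ ≠ 0`.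
  refine expect_forUp_affine hS draw id (fun _ => 0) (fun a _ => a) (fun _ h => h)
    (fun Q h => rfl) (fun _ _ => rfl) (κ := fun i => if segment c i ≤ j₀ then μ i else 0)
    (μ := fun _ => 0) ⟨i₀, by rw [if_pos le_rfl]; exact hg0, fun _ _ => rfl⟩ 0 ?_ ?_ h
  · intro v h
    refine expect_le_of_forall A S σ hS zero_le_one _ _ _ fun t h => ?_
    refine expect_le_of_forall A S σ hS zero_le_one _ _ _ fun x₀ h => ?_
    simp only [interp_suffixSums, interp_forUp_arith]
    rw [hmul, interp_check]
    split_ifs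
    · exact hQ _ _
    · exact zero_le_one
  · intro v h hv
    have hv' : co v j₀ ≠ 0 := by
      intro h0
      apply hv
      refine Eq.trans ?_ h0
      simp only [co, zero_mul, Finset.sum_const_zero, add_zero, zero_add, id]
      refine Finset.sum_congr rfl fun i _ => ?_
      split_ifs <;> ring
    have hend : ∀ (t : Fin r → F × F) (x₀ : F) (h : List (Msg F)),
        co v 0 * x₀ + ∑ j, co v j.succ * (t j).1 + ∑ j, -μ (c j) * (t j).2 ≠ 0 →
        expect A S σ (do
          let s ← suffixSums r (Fin.cons x₀ fun j => (t j).1)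
          let z ← forUp b fun i => arith .mul (v i) (s (segment c i))
          let d ← forUp r fun j => arith .sub (z (c j)) (t j).2
          let w ← mul (Function.extend c d z)
          check (w = 0)) Q h ≤ 0 := by
      intro t x₀ h hne
      simp only [expect, interp_bind, interp_suffixSums, interp_forUp_arith]
      rw [hmul, interp_check, if_neg]
      intro h0
      apply hne
      refine Eq.trans ?_ (hfin v (Fin.cons x₀ fun j => (t j).1) (fun j => (t j).2) h0)
      rw [Fin.sum_univ_succ]
      simp
    -- Second decisive sample: `x j₀`. If `j₀ = 0`, it is drawn after all responses. Otherwise the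
    -- responses that follow it belong to columns `c j ≤ i₀`, so that their coefficients `-μ (c j)`
    -- vanish.
    by_cases hz : j₀ = 0
    · refine expect_le_of_forall A S σ hS (one_sub_rho_pow_nonneg hS 1) _ _ _ fun t h => ?_
      rw [interp_draw]
      rw [hz] at hv'
      refine sampleMean_le_of_ne hS (j := 0) ?_
        (-(∑ j, co v j.succ * (t j).1 + ∑ j, -μ (c j) * (t j).2) / co v 0) ?_
      · intro x₀
        simp only [interp_suffixSums, interp_forUp_arith]
        rw [hmul, interp_check]
        split_ifs
        · exact hQ _ _
        · exact zero_le_one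
      · intro x₀ hx₀
        rw [pow_zero, sub_self]
        have := hend t x₀ h (fun h0 => hx₀ (by rw [eq_div_iff hv']; linear_combination h0))
        simpa only [expect, interp_bind] using this
    -- The transmitted challenges omit `x₀`, so `x j₀` is the challenge of index `j₁ = j₀ - 1`; the
    -- reversals come from counting the rounds upwards.
    · obtain ⟨j₁, hj₁⟩ := Fin.exists_succ_eq.2 hz
      rw [interp_forDown_eq_forUp]
      refine expect_forUp_affine hS (j := 0) (do
          let x ← challenge
          let y ← response
          pure (x, y)) Prod.fst Prod.snd (fun a h => (a, σ.fld (h ++ [.fld a])))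
        (fun a h => h ++ [.fld a] ++ [.fld (σ.fld (h ++ [.fld a]))])
        (fun Q h => by simp only [expect, interp_bind]; rfl) (fun _ _ => rfl)
        (κ := fun i => co v i.rev.succ) (μ := fun i => -μ (c i.rev))
        ⟨j₁.rev, by rw [Fin.rev_rev, hj₁]; exact hv', fun l hl => ?_⟩ 0 ?_ ?_ _
      · have h1 : l.rev ≤ j₁ := by rw [← Fin.rev_rev j₁]; exact Fin.rev_le_rev.2 hl
        have h2 : ((l.rev : Fin r) : ℕ) < segment c i₀ := by
          rw [← hj₀, ← hj₁, Fin.val_succ]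
          exact Nat.lt_succ_of_le h1
        rw [show μ (c l.rev) = 0 from hg _ ((lt_segment_iff hc _ _).1 h2), neg_zero]
      · intro t h
        refine expect_le_of_forall A S σ hS zero_le_one _ _ _ fun x₀ h => ?_
        simp only [interp_suffixSums, interp_forUp_arith]
        rw [hmul, interp_check]
        split_ifs
        · exact hQ _ _
        · exact zero_le_one
      · intro t h ht
        rw [pow_zero, sub_self, interp_draw]
        refine sampleMean_le_of_forall hS fun x₀ => ?_
        have := hend (fun i => t i.rev) x₀ h (fun h0 => ht ?_)
        · simpa only [interp_bind] using this
        · refine Eq.trans ?_ h0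
          rw [hco v 0 (Fin.pos_iff_ne_zero.2 hz)]
          rw [← Equiv.sum_comp Fin.revPerm (fun j : Fin r => co v j.succ * (t j.rev).1),
            ← Equiv.sum_comp Fin.revPerm (fun j : Fin r => -μ (c j) * (t j.rev).2)]
          simp

end Soundness

/-! ### Soundness of the rounds of the certificate of an LDUP decomposition -/

section Discrepancy

variable {F : Type u} [Field F]

/-- The coefficients of the discrepancies in the two decisive tests of the certificate of an LDUP
decomposition, as functions of the last `k` messages: `c₁, c₂` are the contributions of the previous
messages, `a, b, α, β` their contributions to the coefficients. -/
structure Discrepancy (F : Type u) (k : ℕ) where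
  c₁ : F
  c₂ : F
  d : Fin k → F
  d' : Fin k → F
  g : Fin k → F
  h : Fin k → F
  a : Fin k → F
  b : Fin k → F
  α : Fin k → F
  β : Fin k → F
  L : Fin k → Fin k → F
  U : Fin k → Fin k → F
  N : Fin k → Fin k → F

namespace Discrepancy

variable {k : ℕ}

/-- The discrepancy in the test of `zᵀDx`. -/
def value₁ (s : Discrepancy F k) (φ l x z : Fin k → F) : F :=
  s.c₁ + ∑ i, (s.d i * (l i + z i) * (φ i + x i) -
    s.d' i * (s.b i + ∑ j, s.L j i * l j) * (s.a i + ∑ j, s.U i j * φ j)) -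
    ∑ i, ∑ j, l i * s.N i j * φ j - ∑ i, l i * s.α i - ∑ i, s.β i * φ i

/-- The discrepancy in the test of `eᵀPᵀx`. -/
def value₂ (s : Discrepancy F k) (φ x : Fin k → F) : F :=
  s.c₂ + ∑ i, (s.g i * φ i + s.h i * ((φ i + x i) - (s.a i + ∑ j, s.U i j * φ j)))

/-- The discrepancies after the first remaining messages, with last indices, are known. -/
def next (s : Discrepancy F (k + 1)) (φ l x z : F) : Discrepancy F k where
  c₁ := s.c₁ + (s.d (Fin.last k) * (l + z) * (φ + x) -
    s.d' (Fin.last k) * (s.b (Fin.last k) + l) * (s.a (Fin.last k) + φ)) -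
    l * s.N (Fin.last k) (Fin.last k) * φ - l * s.α (Fin.last k) - s.β (Fin.last k) * φ
  c₂ := s.c₂ + (s.g (Fin.last k) * φ +
    s.h (Fin.last k) * ((φ + x) - (s.a (Fin.last k) + φ)))
  d i := s.d i.castSucc
  d' i := s.d' i.castSucc
  g i := s.g i.castSucc
  h i := s.h i.castSucc
  a i := s.a i.castSucc + s.U i.castSucc (Fin.last k) * φ
  b i := s.b i.castSucc + s.L (Fin.last k) i.castSucc * l
  α i := s.α i.castSucc + s.N i.castSucc (Fin.last k) * φ
  β i := s.β i.castSucc + l * s.N (Fin.last k) i.castSucc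
  L i j := s.L i.castSucc j.castSucc
  U i j := s.U i.castSucc j.castSucc
  N i j := s.N i.castSucc j.castSucc

/-- The matrices `L` and `U` are unit triangular. -/
structure Unitriangular (s : Discrepancy F k) : Prop where
  L_diag : ∀ i, s.L i i = 1
  L_upper : ∀ i j, i < j → s.L i j = 0
  U_diag : ∀ i, s.U i i = 1
  U_lower : ∀ i j, j < i → s.U i j = 0

theorem Unitriangular.next {s : Discrepancy F (k + 1)} (hs : s.Unitriangular) (φ l x z : F) :
    (s.next φ l x z).Unitriangular where
  L_diag _ := hs.L_diag _
  L_upper _ _ h := hs.L_upper _ _ (Fin.castSucc_lt_castSucc_iff.2 h)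
  U_diag _ := hs.U_diag _
  U_lower _ _ h := hs.U_lower _ _ (Fin.castSucc_lt_castSucc_iff.2 h)

/-- By triangularity, the messages of the last index act on the rest only through the constant and
through `a`, `b`, `α`, `β`. The discrepancy therefore keeps its form with one index less. -/
theorem value₁_snoc {s : Discrepancy F (k + 1)} (hs : s.Unitriangular) (φ' l' x' z' : Fin k → F)
    (φ l x z : F) : s.value₁ (Fin.snoc (α := fun _ => F) φ' φ) (Fin.snoc (α := fun _ => F) l' l)
      (Fin.snoc (α := fun _ => F) x' x) (Fin.snoc (α := fun _ => F) z' z) =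
      (s.next φ l x z).value₁ φ' l' x' z' := by
  have h1 : ∀ i : Fin k, s.L i.castSucc (Fin.last k) = 0 := fun i =>
    hs.L_upper _ _ (Fin.castSucc_lt_last i)
  have h2 : ∀ i : Fin k, s.U (Fin.last k) i.castSucc = 0 := fun i =>
    hs.U_lower _ _ (Fin.castSucc_lt_last i)
  have hm : ∑ i : Fin k, (s.d i.castSucc * (l' i + z' i) * (φ' i + x' i) - s.d' i.castSucc *
      (s.b i.castSucc + s.L (Fin.last k) i.castSucc * l + ∑ j : Fin k,
        s.L j.castSucc i.castSucc * l' j) *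
      (s.a i.castSucc + s.U i.castSucc (Fin.last k) * φ + ∑ j : Fin k,
        s.U i.castSucc j.castSucc * φ' j)) =
      ∑ i : Fin k, (s.d i.castSucc * (l' i + z' i) * (φ' i + x' i) - s.d' i.castSucc *
      (s.b i.castSucc + (∑ j : Fin k, s.L j.castSucc i.castSucc * l' j +
        s.L (Fin.last k) i.castSucc * l)) *
      (s.a i.castSucc + (∑ j : Fin k, s.U i.castSucc j.castSucc * φ' j +
        s.U i.castSucc (Fin.last k) * φ))) :=
    Finset.sum_congr rfl fun i _ => by ring
  have hα : ∑ i : Fin k, l' i * (s.α i.castSucc + s.N i.castSucc (Fin.last k) * φ) =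
      ∑ i : Fin k, l' i * s.α i.castSucc +
        ∑ i : Fin k, l' i * s.N i.castSucc (Fin.last k) * φ := by
    rw [← Finset.sum_add_distrib]
    exact Finset.sum_congr rfl fun i _ => by ring
  have hβ : ∑ i : Fin k, (s.β i.castSucc + l * s.N (Fin.last k) i.castSucc) * φ' i =
      ∑ i : Fin k, s.β i.castSucc * φ' i +
        ∑ i : Fin k, l * s.N (Fin.last k) i.castSucc * φ' i := by
    rw [← Finset.sum_add_distrib]
    exact Finset.sum_congr rfl fun i _ => by ring
  simp only [value₁, next]
  rw [hm, hα, hβ]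
  simp only [Fin.sum_univ_castSucc, Fin.snoc_castSucc, Fin.snoc_last, h1, h2,
    hs.L_diag, hs.U_diag, zero_mul, Finset.sum_const_zero, zero_add, one_mul,
    Finset.sum_add_distrib]
  ring

theorem value₂_snoc {s : Discrepancy F (k + 1)} (hs : s.Unitriangular) (φ' x' : Fin k → F)
    (φ l x z : F) : s.value₂ (Fin.snoc (α := fun _ => F) φ' φ) (Fin.snoc (α := fun _ => F) x' x) =
      (s.next φ l x z).value₂ φ' x' := by
  have h2 : ∀ i : Fin k, s.U (Fin.last k) i.castSucc = 0 := fun i =>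
    hs.U_lower _ _ (Fin.castSucc_lt_last i)
  simp only [value₂, next, Fin.sum_univ_castSucc, Fin.snoc_castSucc, Fin.snoc_last, h2,
    hs.U_diag, zero_mul, Finset.sum_const_zero, zero_add, one_mul]
  simp only [add_assoc, add_comm]

/-- The decomposition `LDU` is correct. -/
structure Exact (s : Discrepancy F k) : Prop where
  d' : ∀ i, s.d' i = s.d i
  N : ∀ i j, s.N i j = 0
  α : ∀ i, s.α i = 0
  β : ∀ i, s.β i = 0

theorem Exact.next {s : Discrepancy F (k + 1)} (hs : s.Exact) (φ l x z : F) :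
    (s.next φ l x z).Exact := by
  constructor <;> intros <;> simp [Discrepancy.next, hs.d', hs.N, hs.α, hs.β]

/-- A discrepancy is left that does not depend on the next responses. -/
def Lost (s : Discrepancy F k) : Prop := s.c₁ ≠ 0 ∨ s.c₂ ≠ 0 ∨ ∃ i, s.g i ≠ 0

/-- The elimination with pivots `d` fails at the index `i`. -/
structure MismatchAt (s : Discrepancy F k) (i : Fin k) : Prop where
  d'_eq : s.d' i = 0
  N_ne : s.N i i ≠ s.d i
  d' : ∀ j < i, s.d' j = s.d j
  N_left : ∀ j < i, ∀ l, s.N j l = 0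
  N_right : ∀ j < i, ∀ l, s.N l j = 0
  α : ∀ j < i, s.α j = 0
  β : ∀ j < i, s.β j = 0

theorem MismatchAt.next {s : Discrepancy F (k + 1)} {i : Fin k} (hs : s.MismatchAt i.castSucc)
    (φ l x z : F) : (s.next φ l x z).MismatchAt i where
  d'_eq := hs.d'_eq
  N_ne := hs.N_ne
  d' j hj := hs.d' _ (Fin.castSucc_lt_castSucc_iff.2 hj)
  N_left j hj l := hs.N_left _ (Fin.castSucc_lt_castSucc_iff.2 hj) _
  N_right j hj l := hs.N_right _ (Fin.castSucc_lt_castSucc_iff.2 hj) _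
  α j hj := by
    have hj' := Fin.castSucc_lt_castSucc_iff.2 hj
    simp [Discrepancy.next, hs.α _ hj', hs.N_left _ hj']
  β j hj := by
    have hj' := Fin.castSucc_lt_castSucc_iff.2 hj
    simp [Discrepancy.next, hs.β _ hj', hs.N_right _ hj']

/-- Once the messages of the failing index are known, only indices below it remain, and there the
elimination has left no residual. -/
theorem MismatchAt.exact_next {s : Discrepancy F (k + 1)} (hs : s.MismatchAt (Fin.last k))
    (φ l x z : F) : (s.next φ l x z).Exact where
  d' j := hs.d' _ (Fin.castSucc_lt_last j)
  N j l := hs.N_left _ (Fin.castSucc_lt_last j) _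
  α j := by simp [Discrepancy.next, hs.α _ (Fin.castSucc_lt_last j),
    hs.N_left _ (Fin.castSucc_lt_last j)]
  β j := by simp [Discrepancy.next, hs.β _ (Fin.castSucc_lt_last j),
    hs.N_right _ (Fin.castSucc_lt_last j)]

/-- In the failing round the new constant `c₁` is affine in `l` with slope `(d - N) φ + d x - α`,
which in turn is affine in `φ` with slope `d - N ≠ 0`. Hence both `φ` and then `l` are decisive. -/
theorem MismatchAt.exists_forall {s : Discrepancy F (k + 1)} (hs : s.MismatchAt (Fin.last k))
    (x z : F) : ∃ φ₀, ∀ φ, φ ≠ φ₀ → ∃ l₀, ∀ l, l ≠ l₀ → (s.next φ l x z).Lost := by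
  have hne := sub_ne_zero.2 hs.N_ne.symm
  refine ⟨(s.α (Fin.last k) - s.d (Fin.last k) * x) /
    (s.d (Fin.last k) - s.N (Fin.last k) (Fin.last k)), fun φ hφ => ?_⟩
  have hsl : (s.d (Fin.last k) - s.N (Fin.last k) (Fin.last k)) * φ + s.d (Fin.last k) * x -
      s.α (Fin.last k) ≠ 0 := by
    intro h0
    apply hφ
    rw [eq_div_iff hne]
    linear_combination h0
  refine ⟨-(s.c₁ + s.d (Fin.last k) * z * (φ + x) - s.β (Fin.last k) * φ) /
    ((s.d (Fin.last k) - s.N (Fin.last k) (Fin.last k)) * φ + s.d (Fin.last k) * x -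
      s.α (Fin.last k)), fun l hl => Or.inl fun h0 => hl ?_⟩
  rw [eq_div_iff hsl]
  simp only [Discrepancy.next, hs.d'_eq] at h0
  linear_combination h0

/-- The correct responses are `x = a` and `z = b`. If `x ≠ a`, the new `c₁` has slope `d (x - a)` in
`l`; if only `z ≠ b`, it has slope `d (z - b)` in `φ`. If both are correct, `c₁` is unchanged and
`c₂` increases by `g φ`, so an existing discrepancy disappears for at most one `φ`. Trying to repair
a discrepancy thus costs the Prover no less than answering correctly. -/
theorem Lost.exists_forall {s : Discrepancy F (k + 1)} (hs : s.Exact)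
    (hd : s.d (Fin.last k) ≠ 0) (x z : F)
    (h : s.Lost ∨ x ≠ s.a (Fin.last k) ∨ z ≠ s.b (Fin.last k)) :
    (∃ φ₀, ∀ φ, φ ≠ φ₀ → ∀ l, (s.next φ l x z).Lost) ∨
      ∀ φ, ∃ l₀, ∀ l, l ≠ l₀ → (s.next φ l x z).Lost := by
  by_cases hx : x = s.a (Fin.last k)
  · left
    by_cases hz : z = s.b (Fin.last k)
    · rcases h with h | h | h
      · by_cases h1 : s.c₁ = 0
        · by_cases hg : ∃ i : Fin k, s.g i.castSucc ≠ 0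
          -- No value of `φ` needs to be excluded here; `0` is arbitrary.
          · exact ⟨0, fun φ _ l => Or.inr (Or.inr hg)⟩
          · by_cases hgl : s.g (Fin.last k) = 0
            · have h2 : s.c₂ ≠ 0 := by
                rcases h with h | h | ⟨i, hi⟩
                · exact absurd h1 h
                · exact h
                · exfalso
                  revert hi
                  refine Fin.lastCases (fun hi => hi hgl) (fun i hi => hg ⟨i, hi⟩) i
              refine ⟨0, fun φ _ l => Or.inr (Or.inl ?_)⟩
              simp only [Discrepancy.next, hgl, hx]
              intro h0
              exact h2 (by linear_combination h0)
            · refine ⟨-s.c₂ / s.g (Fin.last k), fun φ hφ l => Or.inr (Or.inl fun h0 => hφ ?_)⟩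
              rw [eq_div_iff hgl]
              simp only [Discrepancy.next, hx] at h0
              linear_combination h0
        · refine ⟨0, fun φ _ l => Or.inl fun h0 => h1 ?_⟩
          simp only [Discrepancy.next, hs.d', hs.N, hs.α, hs.β, hx, hz] at h0
          linear_combination h0
      · exact absurd hx h
      · exact absurd hz h
    · have hne := mul_ne_zero hd (sub_ne_zero.2 hz)
      refine ⟨-(s.c₁ + s.d (Fin.last k) * s.a (Fin.last k) * (z - s.b (Fin.last k))) /
        (s.d (Fin.last k) * (z - s.b (Fin.last k))), fun φ hφ l => Or.inl fun h0 => hφ ?_⟩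
      rw [eq_div_iff hne]
      simp only [Discrepancy.next, hs.d', hs.N, hs.α, hs.β, hx] at h0
      linear_combination h0
  · right
    intro φ
    have hne := mul_ne_zero hd (sub_ne_zero.2 hx)
    refine ⟨-(s.c₁ + s.d (Fin.last k) * (z * (φ + x) - s.b (Fin.last k) *
      (s.a (Fin.last k) + φ))) / (s.d (Fin.last k) * (x - s.a (Fin.last k))),
      fun l hl => Or.inl fun h0 => hl ?_⟩
    rw [eq_div_iff hne]
    simp only [Discrepancy.next, hs.d', hs.N, hs.α, hs.β] at h0
    linear_combination h0

end Discrepancy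
end Discrepancy

section Rounds

open Discrepancy

variable {F : Type u} [Field F] {m n : ℕ} {A : Matrix (Fin m) (Fin n) F} {S : Finset F}
  {σ : Prover F}

/-- One round of the certificate of an LDUP decomposition. -/
def ldupRound : VProg F m n (F × F × F × F × F × F) := do
  let φ ← challenge
  let ψ ← challenge
  let x ← response
  let y ← response
  let l ← challenge
  let z ← response
  pure (φ, ψ, x, y, l, z)

/-- In an ordinary round either `φ` or `l` is decisive. The sample `ψ` is averaged out: the test on
`y` is not needed for soundness. -/
theorem sampleMean_three_le {S : Finset F} (hS : S.Nonempty) {j : ℕ} {K : F → F → F → ℝ}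
    (h1 : ∀ φ ψ l, K φ ψ l ≤ 1) {good : F → F → Prop}
    (hK : ∀ φ ψ l, good φ l → K φ ψ l ≤ 1 - rho S ^ j)
    (h : (∃ φ₀, ∀ φ, φ ≠ φ₀ → ∀ l, good φ l) ∨ ∀ φ, ∃ l₀, ∀ l, l ≠ l₀ → good φ l) :
    (sampleMean S fun φ => sampleMean S fun ψ => sampleMean S fun l => K φ ψ l) ≤
      1 - rho S ^ (j + 1) := by
  rcases h with ⟨φ₀, h⟩ | h
  · refine sampleMean_le_of_ne hS (fun φ => ?_) φ₀ fun φ hφ => ?_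
    · exact sampleMean_le_of_forall hS fun ψ => sampleMean_le_of_forall hS fun l => h1 _ _ _
    · exact sampleMean_le_of_forall hS fun ψ => sampleMean_le_of_forall hS fun l =>
        hK _ _ _ (h φ hφ l)
  · refine sampleMean_le_of_forall hS fun φ => sampleMean_le_of_forall hS fun ψ => ?_
    obtain ⟨l₀, h⟩ := h φ
    exact sampleMean_le_of_ne hS (fun l => h1 _ _ _) l₀ fun l hl => hK _ _ _ (h l hl)

/-- The round of the failing pivot, where `φ` and `l` are both decisive. -/
theorem sampleMean_three_le' {S : Finset F} (hS : S.Nonempty) {j : ℕ} {K : F → F → F → ℝ}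
    (h1 : ∀ φ ψ l, K φ ψ l ≤ 1) {good : F → F → Prop}
    (hK : ∀ φ ψ l, good φ l → K φ ψ l ≤ 1 - rho S ^ j)
    (h : ∃ φ₀, ∀ φ, φ ≠ φ₀ → ∃ l₀, ∀ l, l ≠ l₀ → good φ l) :
    (sampleMean S fun φ => sampleMean S fun ψ => sampleMean S fun l => K φ ψ l) ≤
      1 - rho S ^ (j + 2) := by
  obtain ⟨φ₀, h⟩ := h
  refine sampleMean_le_of_ne hS (fun φ => ?_) φ₀ fun φ hφ => ?_
  · exact sampleMean_le_of_forall hS fun ψ => sampleMean_le_of_forall hS fun l => h1 _ _ _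
  · refine sampleMean_le_of_forall hS fun ψ => ?_
    obtain ⟨l₀, h⟩ := h φ hφ
    exact sampleMean_le_of_ne hS (fun l => h1 _ _ _) l₀ fun l hl => hK _ _ _ (h l hl)

theorem expect_ldupRound (Q : F × F × F × F × F × F → List (Msg F) → ℝ) (h : List (Msg F)) :
    ∃ (x y : F → F → F) (z : F → F → F → F) (h' : F → F → F → List (Msg F)),
      expect A S σ ldupRound Q h = sampleMean S fun φ => sampleMean S fun ψ => sampleMean S fun l =>
        Q (φ, ψ, x φ ψ, y φ ψ, l, z φ ψ l) (h' φ ψ l) := by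
  simp only [ldupRound, expect, interp_bind, interp_challenge, interp_response, interp_pure]
  exact ⟨_, _, _, _, rfl⟩

/-- Soundness of the rounds of the certificate of an LDUP decomposition. -/
theorem expect_ldup_rounds_le (hS : S.Nonempty) {r : ℕ} (s : Discrepancy F (r + 1))
    (hs : s.Unitriangular) (hd : ∀ i, s.d i ≠ 0) (x z : F)
    {G : (Fin r → F × F × F × F × F × F) → F → F → F → List (Msg F) → ℝ}
    (hG1 : ∀ t φ ψ l h, G t φ ψ l h ≤ 1)
    (hG : ∀ t φ ψ l h, ¬ (s.value₁ (Fin.cons φ fun i => (t i).1)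
        (Fin.cons l fun i => (t i).2.2.2.2.1)
        (Fin.snoc (α := fun _ => F) (fun i => (t i).2.2.1) x)
        (Fin.snoc (α := fun _ => F) (fun i => (t i).2.2.2.2.2) z) = 0 ∧
      s.value₂ (Fin.cons φ fun i => (t i).1)
        (Fin.snoc (α := fun _ => F) (fun i => (t i).2.2.1) x) = 0) → G t φ ψ l h ≤ 0)
    (h : List (Msg F)) :
    ((s.Exact → (s.Lost ∨ x ≠ s.a (Fin.last r) ∨ z ≠ s.b (Fin.last r)) →
      expect A S σ (forDown r fun _ => ldupRound) (fun t h => sampleMean S fun φ =>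
        sampleMean S fun ψ => sampleMean S fun l => G t φ ψ l h) h ≤ 1 - rho S ^ (r + 1)) ∧
    ∀ i, s.MismatchAt i →
      expect A S σ (forDown r fun _ => ldupRound) (fun t h => sampleMean S fun φ =>
        sampleMean S fun ψ => sampleMean S fun l => G t φ ψ l h) h ≤ 1 - rho S ^ (r + 2)) := by
  -- `x` and `z` are the responses for the last remaining index: they were fixed in the preceding
  -- round, before the samples of this index. At the start they are the zeros that complete the
  -- vectors.
  induction r generalizing x z h with
  | zero =>
    -- The samples that are not sent act as the final round. No index is left after it, so a
    -- surviving loss means that one of the two tests fails.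
    simp only [forDown, expect, interp_pure]
    have hK : ∀ φ ψ l, (s.next φ l x z).Lost → G Fin.elim0 φ ψ l h ≤ 1 - rho S ^ 0 := by
      intro φ ψ l hl
      rw [pow_zero, sub_self]
      refine hG _ _ _ _ _ fun hv => ?_
      have e1 := value₁_snoc hs Fin.elim0 Fin.elim0 Fin.elim0 Fin.elim0 φ l x z
      have e2 := value₂_snoc hs Fin.elim0 Fin.elim0 φ l x z
      have e0 : ∀ (u : F) (w : Fin 0 → F), (Fin.cons u w : Fin 1 → F) =
          Fin.snoc (α := fun _ => F) Fin.elim0 u := by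
        intro u w; ext i; obtain rfl : i = 0 := Fin.fin_one_eq_zero i
        rfl
      have e3 : ∀ (u : F) (w : Fin 0 → F), (Fin.snoc (α := fun _ => F) w u : Fin 1 → F) =
          Fin.snoc (α := fun _ => F) Fin.elim0 u := by
        intro u w; rw [Subsingleton.elim w Fin.elim0]
      rw [e0, e0, e3 x, e3 z] at hv
      rw [e1, e2] at hv
      rcases hl with hl | hl | ⟨i, _⟩
      · exact hl (by simpa [value₁] using hv.1)
      · exact hl (by simpa [value₂] using hv.2)
      · exact i.elim0
    refine ⟨fun hex hlost => ?_, fun i hi => ?_⟩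
    · exact sampleMean_three_le hS (fun _ _ _ => hG1 _ _ _ _ _) hK
        (Discrepancy.Lost.exists_forall hex (hd _) x z hlost)
    · obtain rfl : i = Fin.last 0 := Fin.fin_one_eq_zero i
      exact sampleMean_three_le' hS (fun _ _ _ => hG1 _ _ _ _ _) hK (hi.exists_forall x z)
  | succ r ih =>
    rw [expect, interp_forDown_succ]
    obtain ⟨x', y', z', h', e⟩ := expect_ldupRound (A := A) (S := S) (σ := σ) (fun a h' =>
      expect A S σ (forDown r fun _ => ldupRound) (fun t h'' => sampleMean S fun φ =>
        sampleMean S fun ψ => sampleMean S fun l =>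
          G (Fin.snoc (α := fun _ => F × F × F × F × F × F) t a) φ ψ l h'') h') h
    simp only [expect] at e
    rw [e]
    have hle1 : ∀ φ ψ l, expect A S σ (forDown r fun _ => ldupRound) (fun t h'' => sampleMean S
        fun φ' => sampleMean S fun ψ' => sampleMean S fun l' =>
          G (Fin.snoc (α := fun _ => F × F × F × F × F × F) t
            (φ, ψ, x' φ ψ, y' φ ψ, l, z' φ ψ l)) φ' ψ' l' h'') (h' φ ψ l) ≤ 1 := by
      intro φ ψ l
      refine expect_le_of_forall A S σ hS zero_le_one _ _ _ fun t h => ?_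
      exact sampleMean_le_of_forall hS fun _ => sampleMean_le_of_forall hS fun _ =>
        sampleMean_le_of_forall hS fun _ => hG1 _ _ _ _ _
    have hih := fun φ ψ l => ih (s.next φ l x z) (hs.next φ l x z) (fun i => hd i.castSucc)
      (x' φ ψ) (z' φ ψ l) (G := fun t φ' ψ' l' h => G (Fin.snoc (α := fun _ =>
        F × F × F × F × F × F) t (φ, ψ, x' φ ψ, y' φ ψ, l, z' φ ψ l)) φ' ψ' l' h)
      (fun _ _ _ _ _ => hG1 _ _ _ _ _) (by
        intro t φ' ψ' l' h hne
        refine hG _ _ _ _ _ fun hv => hne ?_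
        have es : ∀ (p : F × F × F × F × F × F → F) (q : F × F × F × F × F × F),
            (fun i => p (Fin.snoc (α := fun _ => F × F × F × F × F × F) t q i)) =
              Fin.snoc (α := fun _ => F) (fun i => p (t i)) (p q) := by
          intro p q
          ext i
          refine Fin.lastCases ?_ (fun i => ?_) i <;> simp
        rw [es (fun q => q.1), es (fun q => q.2.2.1), es (fun q => q.2.2.2.2.1),
          es (fun q => q.2.2.2.2.2), Fin.cons_snoc_eq_snoc_cons, Fin.cons_snoc_eq_snoc_cons,
          value₁_snoc hs, value₂_snoc hs _ _ _ l _ z] at hv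
        exact hv) (h' φ ψ l)
    refine ⟨fun hex hlost => ?_, fun i hi => ?_⟩
    · exact sampleMean_three_le hS hle1
        (fun φ ψ l hl => (hih φ ψ l).1 (hex.next φ l x z) (Or.inl hl))
        (Discrepancy.Lost.exists_forall hex (hd _) x z hlost)
    · revert hi
      refine Fin.lastCases (fun hi => ?_) (fun i hi => ?_) i
      -- Two decisive samples create the discrepancy; each remaining round then costs one factor.
      · exact sampleMean_three_le' hS hle1
          (fun φ ψ l hl => (hih φ ψ l).1 (hi.exact_next φ l x z) (Or.inl hl))
          (hi.exists_forall x z)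
      -- Rounds above the failing index cost nothing: the mismatch persists whatever is sent.
      · refine sampleMean_le_of_forall hS fun φ => sampleMean_le_of_forall hS fun ψ =>
          sampleMean_le_of_forall hS fun l => ((hih φ ψ l).2 i (hi.next φ l x z)).trans ?_
        exact one_sub_rho_pow_mono hS (by omega)

end Rounds

/-! ### Soundness of the protocol -/

section SoundnessTheorem

variable {F : Type u} [Field F] {m n : ℕ} {α β : Type u} {A : Matrix (Fin m) (Fin n) F}
  {S : Finset F} {σ : Prover F}

/-- The completed vectors take the uniform shape `φ + (x̄, 0)`, used for both soundness and
completeness. -/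
theorem interp_ldupRounds_succ {X : Type v} {smp : (F → X) → X} {rej : X} (r : ℕ)
    (Q : LDUPData F (r + 1) → List (Msg F) → X) (h : List (Msg F)) :
    interp A σ smp rej (ldupRounds (r + 1)) Q h =
      interp A σ smp rej (forDown r fun _ => ldupRound) (fun t h' => smp fun φ₁ => smp fun ψ₁ =>
        smp fun l₁ =>
        Q ⟨Fin.cons φ₁ fun i => (t i).1, Fin.cons ψ₁ fun i => (t i).2.1,
          Fin.cons l₁ fun i => (t i).2.2.2.2.1,
          fun k => (Fin.cons φ₁ fun i => (t i).1 : Fin (r + 1) → F) k +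
            (Fin.snoc (α := fun _ => F) (fun i => (t i).2.2.1) 0 : Fin (r + 1) → F) k,
          fun k => (Fin.cons ψ₁ fun i => (t i).2.1 : Fin (r + 1) → F) k +
            (Fin.snoc (α := fun _ => F) (fun i => (t i).2.2.2.1) 0 : Fin (r + 1) → F) k,
          fun k => (Fin.cons l₁ fun i => (t i).2.2.2.2.1 : Fin (r + 1) → F) k +
            (Fin.snoc (α := fun _ => F) (fun i => (t i).2.2.2.2.2) 0 : Fin (r + 1) → F) k⟩ h') h := by
  have e : ∀ (f : Fin (r + 1) → F) (x : Fin r → F),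
      (Fin.snoc (α := fun _ => F) (fun i => f i.castSucc + x i) (f (Fin.last r)) : Fin (r + 1) → F) =
        fun k => f k + (Fin.snoc (α := fun _ => F) x 0 : Fin (r + 1) → F) k := by
    intro f x
    ext k
    refine Fin.lastCases ?_ (fun k => ?_) k <;> simp
  simp only [ldupRounds, interp_bind, interp_draw, interp_forUp_arith, interp_pure, ArithOp.eval, e]
  rfl

theorem vecMul_extend {r : ℕ} {I : Fin r → Fin m} (hI : Function.Injective I) (l : Fin r → F)
    (j : Fin n) : A.vecMul (Function.extend I l 0) j = ∑ k, l k * A (I k) j := by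
  have := sum_extend hI l 0 fun i => A i j
  simpa [Matrix.vecMul, dotProduct] using this

theorem expect_le_of_bind {p : VProg F m n α} (hS : S.Nonempty) {f : α → VProg F m n β}
    {Q : β → List (Msg F) → ℝ} {c : ℝ} (hc : 0 ≤ c)
    (hf : ∀ a h, expect A S σ (f a) Q h ≤ c) (h : List (Msg F)) :
    expect A S σ (p >>= f) Q h ≤ c := by
  rw [expect, interp_bind]
  exact expect_le_of_forall A S σ hS hc _ _ _ hf

theorem expect_recvIdxs_le {r : ℕ} {k : (Fin r → ℕ) → VProg F m n α}
    {Q : α → List (Msg F) → ℝ} {c : ℝ} (hk : ∀ t h, expect A S σ (k t) Q h ≤ c)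
    (h : List (Msg F)) : expect A S σ (recvIdxs r k) Q h ≤ c := by
  induction r generalizing h with
  | zero => exact hk _ _
  | succ r ih => exact ih (fun t h => hk _ h) _

theorem expect_withIncreasing_le {r b : ℕ} {c : Fin r → ℕ} {k : (Fin r → Fin b) → VProg F m n α}
    {Q : α → List (Msg F) → ℝ} {e : ℝ} (he : 0 ≤ e)
    (hk : ∀ c, StrictMono c → ∀ h, expect A S σ (k c) Q h ≤ e) (h : List (Msg F)) :
    expect A S σ (withIncreasing b c k) Q h ≤ e := by
  unfold RPMCert.withIncreasing
  split_ifs with hc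
  · exact hk _ (fun i j hij => hc.1 hij) h
  · exact he

theorem expect_withPermutation_le {r : ℕ} {p : Fin r → ℕ} {k : (Fin r → Fin r) → VProg F m n α}
    {Q : α → List (Msg F) → ℝ} {e : ℝ} (he : 0 ≤ e)
    (hk : ∀ p : Equiv.Perm (Fin r), ∀ h, expect A S σ (k p) Q h ≤ e) (h : List (Msg F)) :
    expect A S σ (withPermutation p k) Q h ≤ e := by
  unfold RPMCert.withPermutation
  split_ifs with hp
  · have hinj : Function.Injective fun j => (⟨p j, hp.2 j⟩ : Fin r) := fun i j hij =>
      hp.1 (Fin.mk.inj hij)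
    exact hk (Equiv.ofBijective _ (Finite.injective_iff_bijective.1 hinj)) h
  · exact he

open Classical in
/-- Soundness of the certificate of the rank profile matrix of an invertible submatrix. -/
theorem expect_rpmInvertible_le (hS : S.Nonempty) {r : ℕ} {I : Fin r → Fin m} {J : Fin r → Fin n}
    (hI : StrictMono I) (hJ : StrictMono J) (hAI : SpannedByPreceding A.transpose I)
    (hAJ : SpannedByPreceding A J) (h : List (Msg F)) :
    expect A S σ (rpmInvertible I J)
      (fun R _ => if ¬ IsRankProfileMatrix A R then 1 else 0) h ≤ 1 - rho S ^ (2 * r) := by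
  have hpos := one_sub_rho_pow_nonneg hS (2 * r)
  refine expect_recvIdxs_le (fun q => expect_withPermutation_le hpos fun p h => ?_) h
  -- The output is fixed as soon as `P` is committed. If it is correct, no later message can make it
  -- false.
  by_cases hR : IsRankProfileMatrix A
    (unitColumns F I * unitColumns F p * (unitColumns F J).transpose)
  · simp only [expect, interp_bind, interp_check, interp_pure, hR, not_true_eq_false, if_false,
      ite_self]
    refine expect_le_of_forall A S σ hS hpos _ _ _ fun D h => ?_
    split_ifs
    swap; · exact hpos
    refine expect_le_of_forall A S σ hS hpos _ _ _ fun ef h => ?_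
    refine expect_le_of_forall A S σ hS hpos _ _ _ fun t h => ?_
    simp only [interp_timesAT, interp_forUp_arith, interp_dot, ite_self, hpos]
  rw [expect, interp_bind]
  refine expect_le_of_forall A S σ hS hpos _ _ _ fun D h => ?_
  rw [interp_bind, interp_check]
  split_ifs with hD
  swap; · exact hpos
  -- Elimination on `B Pᵀ` with the committed pivots.
  obtain ⟨i, L, U, N, hir, hM, hL0, hL1, hU0, hU1, hN1, hN2, hNd⟩ :=
    exists_ldu_or_mismatch (Matrix.of fun i k => A (I i) (J (p.symm k))) hD
  -- the elimination does not use all pivots, or `Pᵀ U P` is not triangular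
  have hbad : i = r → ∃ j k, k < j ∧ U (p j) (p k) ≠ 0 := by
    rintro rfl
    by_contra hcon
    push Not at hcon
    refine hR (isRankProfileMatrix_of_spanned hI hJ hAI hAJ p hD (L := L) (U := U) ?_ hL0 hL1 hU1
      fun j k hjk => hcon j k hjk)
    intro j k
    have := hM j k
    rw [hN1 j k j.2, add_zero] at this
    rw [← Matrix.of_apply (fun i k => A (I i) (J (p.symm k))), this]
    exact Finset.sum_congr rfl fun x _ => by rw [if_pos x.2]
  -- For `r = 0` the elimination is complete and `hbad` yields an index in `Fin 0`.
  obtain _ | r := r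
  · obtain rfl : i = 0 := by omega
    exact (hbad rfl).choose.elim0
  simp only [interp_bind, interp_ldupRounds_succ, interp_timesAT, interp_forUp_arith, interp_dot,
    interp_check, interp_pure]
  let st : (Fin (r + 1) → F × F) → Discrepancy F (r + 1) := fun ef =>
    { c₁ := 0, c₂ := 0, d := D, d' := fun k => if (k : ℕ) < i then D k else 0
      g := fun l => ∑ k, (ef (p.symm k)).1 * U k l - (ef (p.symm l)).2
      h := fun k => (ef (p.symm k)).1
      a := 0, b := 0, α := 0, β := 0, L := L, U := U, N := N }
  have hst : ∀ ef, (st ef).Unitriangular := fun ef => ⟨hL1, hL0, hU1, hU0⟩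
  have hd' : ∀ j k, A (I j) (J (p.symm k)) =
      (∑ x : Fin (r + 1), L j x * (if (x : ℕ) < i then D x else 0) * U x k) + N j k := hM
  have hv1 : ∀ ef φ l x z, (st ef).value₁ φ l x z = ∑ k, (l k + z k) * D k * (φ k + x k) -
      ∑ k, A.vecMul (Function.extend I l 0) (J k) * φ (p k) := by
    intro ef φ l x z
    have e1 : ∑ k, A.vecMul (Function.extend I l 0) (J k) * φ (p k) =
        ∑ k, ∑ j, l j * A (I j) (J (p.symm k)) * φ k := by
      rw [← Equiv.sum_comp p fun k => ∑ j, l j * A (I j) (J (p.symm k)) * φ k]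
      simp only [Equiv.symm_apply_apply, vecMul_extend hI.injective, Finset.sum_mul]
    have e2 : ∑ k, ∑ j, l j * A (I j) (J (p.symm k)) * φ k =
        ∑ x : Fin (r + 1), (if (x : ℕ) < i then D x else 0) * (∑ j, L j x * l j) *
          (∑ k, U x k * φ k) + ∑ j, ∑ k, l j * N j k * φ k := by
      simp only [hd', mul_add, add_mul, Finset.sum_add_distrib]
      congr 1
      · simp only [Finset.mul_sum, Finset.sum_mul]
        rw [Finset.sum_comm' (s := Finset.univ) (t := fun _ => Finset.univ)
          (t' := Finset.univ) (s' := fun _ => Finset.univ) (by simp)]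
        rw [Finset.sum_congr rfl fun j _ => Finset.sum_comm, Finset.sum_comm]
        refine Finset.sum_congr rfl fun x _ => ?_
        rw [Finset.sum_comm]
        refine Finset.sum_congr rfl fun k _ => Finset.sum_congr rfl fun j _ => by ring
      · rw [Finset.sum_comm]
    rw [e1, e2]
    simp only [st, Discrepancy.value₁, Pi.zero_apply, zero_add, mul_zero, zero_mul,
      Finset.sum_const_zero, sub_zero, Finset.sum_sub_distrib]
    rw [sub_sub]
    congr 1
    exact Finset.sum_congr rfl fun k _ => by ring
  have hv2 : ∀ ef φ x, (st ef).value₂ φ x = ∑ k, (ef k).1 * (φ (p k) + x (p k)) -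
      ∑ k, (ef k).2 * φ (p k) := by
    intro ef φ x
    rw [← Equiv.sum_comp p.symm fun k => (ef k).1 * (φ (p k) + x (p k)),
      ← Equiv.sum_comp p.symm fun k => (ef k).2 * φ (p k)]
    simp only [st, Discrepancy.value₂, Pi.zero_apply, zero_add, Equiv.apply_symm_apply,
      Finset.sum_add_distrib, sub_mul, mul_sub, Finset.sum_sub_distrib]
    have : ∑ l, (∑ k, (ef (p.symm k)).1 * U k l) * φ l =
        ∑ k, (ef (p.symm k)).1 * ∑ l, U k l * φ l := by
      simp only [Finset.sum_mul, Finset.mul_sum]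
      rw [Finset.sum_comm]
      exact Finset.sum_congr rfl fun k _ => Finset.sum_congr rfl fun j _ => by ring
    rw [this]
    ring
  -- The continuation contains the test on `y` as well; being one more condition for acceptance, it
  -- can only lower the expectation.
  have hround : ∀ (ef : Fin (r + 1) → F × F) (h : List (Msg F)), _ :=
    fun ef h => expect_ldup_rounds_le (A := A) (σ := σ) hS (st ef) (hst ef) hD 0 0 (G := fun t φ ψ l h =>
      if ∑ k, ArithOp.mul.eval
          ((Fin.cons l fun i => (t i).2.2.2.2.1 : Fin (r + 1) → F) k +
            (Fin.snoc (α := fun _ => F) (fun i => (t i).2.2.2.2.2) 0 : Fin (r + 1) → F) k) (D k) *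
          ((Fin.cons φ fun i => (t i).1 : Fin (r + 1) → F) k +
            (Fin.snoc (α := fun _ => F) (fun i => (t i).2.2.1) 0 : Fin (r + 1) → F) k) =
        ∑ k, A.vecMul (Function.extend I (Fin.cons l fun i => (t i).2.2.2.2.1) 0) (J k) *
          (Fin.cons φ fun i => (t i).1 : Fin (r + 1) → F) (p k) then
        if ∑ k, ArithOp.mul.eval
          ((Fin.cons l fun i => (t i).2.2.2.2.1 : Fin (r + 1) → F) k +
            (Fin.snoc (α := fun _ => F) (fun i => (t i).2.2.2.2.2) 0 : Fin (r + 1) → F) k) (D k) *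
          ((Fin.cons ψ fun i => (t i).2.1 : Fin (r + 1) → F) k +
            (Fin.snoc (α := fun _ => F) (fun i => (t i).2.2.2.1) 0 : Fin (r + 1) → F) k) =
          ∑ k, A.vecMul (Function.extend I (Fin.cons l fun i => (t i).2.2.2.2.1) 0) (J k) *
          (Fin.cons ψ fun i => (t i).2.1 : Fin (r + 1) → F) (p k) then
        if ∑ k, (ef k).1 * ((Fin.cons φ fun i => (t i).1 : Fin (r + 1) → F) (p k) +
            (Fin.snoc (α := fun _ => F) (fun i => (t i).2.2.1) 0 : Fin (r + 1) → F) (p k)) =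
          ∑ k, (ef k).2 * (Fin.cons φ fun i => (t i).1 : Fin (r + 1) → F) (p k) then
        if ¬ IsRankProfileMatrix A
          (unitColumns F I * unitColumns F p * (unitColumns F J).transpose) then 1 else 0
        else 0 else 0 else 0)
      (fun t φ ψ l h => by split_ifs <;> simp)
      (fun t φ ψ l h hne => by
        split_ifs with h1 h2 h3
        · refine absurd ⟨?_, ?_⟩ hne
          · rw [hv1, sub_eq_zero, ← h1]
            exact Finset.sum_congr rfl fun k _ => rfl
          · rw [hv2, sub_eq_zero, h3]
        all_goals exact le_rfl) h
  -- If the elimination goes through, `Pᵀ U P` has a nonzero entry `(j, k)` with `k < j`. The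
  -- response `f k` precedes the challenge `e j`, so `g (p k)` vanishes for at most one value of a
  -- decisive challenge; the rounds then need `r + 1` further decisive samples. If the elimination
  -- fails, the rounds alone contain `r + 2`. In both cases `r + 2 ≤ 2 (r + 1)`.
  by_cases hi : i = r + 1
  · obtain ⟨j, k, hkj, hU⟩ := hbad hi
    refine (expect_forUp_affine hS (j := r + 1) (do
          let e ← challenge
          let f ← response
          pure (e, f)) Prod.fst Prod.snd (fun a h => (a, σ.fld (h ++ [.fld a])))
        (fun a h => h ++ [.fld a] ++ [.fld (σ.fld (h ++ [.fld a]))])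
        (fun Q h => by simp only [expect, interp_bind]; rfl) (fun _ _ => rfl)
        (κ := fun l => U (p l) (p k)) (μ := fun l => if l = k then -1 else 0)
        ⟨j, hU, fun l hl => if_neg fun h => ?_⟩ 0 (fun ef h => ?_) (fun ef h hef => ?_) h).trans
      (one_sub_rho_pow_mono hS (by omega))
    · subst h
      exact absurd hl (not_le.2 hkj)
    · refine expect_le_of_forall A S σ hS zero_le_one _ _ _ fun t h => ?_
      refine sampleMean_le_of_forall hS fun _ => sampleMean_le_of_forall hS fun _ =>
        sampleMean_le_of_forall hS fun _ => ?_
      split_ifs <;> simp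
    · refine (hround ef h).1 ⟨fun x => ?_, fun x y => ?_, fun _ => rfl, fun _ => rfl⟩
        (Or.inl (Or.inr (Or.inr ⟨p k, fun h0 => hef ?_⟩)))
      · exact if_pos (by omega)
      · exact hN1 x y (by omega)
      · refine Eq.trans ?_ h0
        simp only [st, Equiv.symm_apply_apply]
        rw [← Equiv.sum_comp p fun x => (ef (p.symm x)).1 * U x (p k)]
        simp [sub_eq_add_neg, mul_comm]
  · refine expect_le_of_forall A S σ hS hpos _ _ _ fun ef h => ?_
    refine ((hround ef h).2 ⟨i, by omega⟩ ?_).trans (one_sub_rho_pow_mono hS (by omega))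
    exact
      { d'_eq := if_neg (lt_irrefl i)
        N_ne := hNd _ rfl
        d' := fun j hj => if_pos hj
        N_left := fun j hj l => hN1 j l hj
        N_right := fun j hj l => hN2 l j hj
        α := fun _ _ => rfl
        β := fun _ _ => rfl }

theorem SpannedByPreceding.of_isEmpty {r b : ℕ} {ι : Type*} [IsEmpty ι] (M : Matrix ι (Fin b) F)
    (c : Fin r → Fin b) : SpannedByPreceding M c :=
  fun _ => ⟨0, fun _ _ => rfl, fun a => isEmptyElim a⟩

-- The errors combine as a maximum, not as a sum. A commitment that violates minimality is caught by
-- its own check, whatever follows; if both are minimal, the last phase decides. The Independence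
-- check is passed over, since independence follows from the nonzero pivots in `D`.
open Classical in
theorem expect_rpmVerifier_le (hS : S.Nonempty) (rowsFirst : Bool) (h : List (Msg F)) :
    expect A S σ (rpmVerifier F m n rowsFirst)
      (fun R _ => if ¬ IsRankProfileMatrix A R then 1 else 0) h ≤ 1 - rho S ^ (2 * n) := by
  have hpos := one_sub_rho_pow_nonneg hS (2 * n)
  have hQ : ∀ (R : Matrix (Fin m) (Fin n) F) (_ : List (Msg F)),
      (if ¬ IsRankProfileMatrix A R then (1 : ℝ) else 0) ≤ 1 := by
    intro R _; split_ifs <;> simp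
  have hrows : ∀ (r : ℕ) (I : Fin r → Fin m) (f : PUnit → VProg F m n (Matrix (Fin m) (Fin n) F)),
      StrictMono I → (SpannedByPreceding A.transpose I → ∀ u h, expect A S σ (f u)
        (fun R _ => if ¬ IsRankProfileMatrix A R then 1 else 0) h ≤ 1 - rho S ^ (2 * n)) →
      ∀ h, expect A S σ (minimality timesAT I >>= f)
        (fun R _ => if ¬ IsRankProfileMatrix A R then 1 else 0) h ≤ 1 - rho S ^ (2 * n) := by
    intro r I f hI hf h
    by_cases hsp : SpannedByPreceding A.transpose I
    · exact expect_le_of_bind hS hpos (hf hsp) h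
    · rw [expect, interp_bind]
      refine (expect_minimality_le hS (M := A.transpose) (fun v Q h => ?_) hI hsp
        (fun u h => ?_) h).trans (one_sub_rho_pow_mono hS ?_)
      · rw [interp_timesAT, Matrix.mulVec_transpose]
      · exact expect_le_of_forall A S σ hS zero_le_one _ _ _ hQ
      -- For `n = 0` the spanning condition is empty; otherwise `2 ≤ 2n`.
      · obtain _ | n := n
        · exact absurd (SpannedByPreceding.of_isEmpty _ _) hsp
        · omega
  have hcols : ∀ (r : ℕ) (J : Fin r → Fin n) (f : PUnit → VProg F m n (Matrix (Fin m) (Fin n) F)),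
      StrictMono J → (SpannedByPreceding A J → ∀ u h, expect A S σ (f u)
        (fun R _ => if ¬ IsRankProfileMatrix A R then 1 else 0) h ≤ 1 - rho S ^ (2 * n)) →
      ∀ h, expect A S σ (minimality timesA J >>= f)
        (fun R _ => if ¬ IsRankProfileMatrix A R then 1 else 0) h ≤ 1 - rho S ^ (2 * n) := by
    intro r J f hJ hf h
    by_cases hsp : SpannedByPreceding A J
    · exact expect_le_of_bind hS hpos (hf hsp) h
    · rw [expect, interp_bind]
      refine (expect_minimality_le hS (M := A) (fun v Q h => ?_) hJ hsp
        (fun u h => ?_) h).trans (one_sub_rho_pow_mono hS ?_)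
      · rw [interp_timesA]
      · exact expect_le_of_forall A S σ hS zero_le_one _ _ _ hQ
      · obtain _ | n := n
        · exact absurd (fun i => i.elim0) hsp
        · omega
  have hrpm : ∀ (r : ℕ) (I : Fin r → Fin m) (J : Fin r → Fin n), StrictMono I → StrictMono J →
      SpannedByPreceding A.transpose I → SpannedByPreceding A J → ∀ h,
      expect A S σ (rpmInvertible I J)
        (fun R _ => if ¬ IsRankProfileMatrix A R then 1 else 0) h ≤ 1 - rho S ^ (2 * n) := by
    intro r I J hI hJ hAI hAJ h
    have : r ≤ n := by simpa using Fintype.card_le_of_injective J hJ.injective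
    exact (expect_rpmInvertible_le hS hI hJ hAI hAJ h).trans
      (one_sub_rho_pow_mono hS (by omega))
  cases rowsFirst with
  | true =>
    refine expect_withIncreasing_le hpos (fun I hI h => expect_le_of_bind hS hpos (fun _ h =>
      hrows _ I _ hI (fun hAI _ h => ?_) h) h) (h ++ [.lst (σ.lst h)])
    exact expect_recvIdxs_le (fun j h => expect_withIncreasing_le hpos (fun J hJ h =>
      hcols _ J _ hJ (fun hAJ _ h => hrpm _ I J hI hJ hAI hAJ h) h) h) h
  | false =>
    refine expect_withIncreasing_le hpos (fun J hJ h => expect_le_of_bind hS hpos (fun _ h =>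
      hcols _ J _ hJ (fun hAJ _ h => ?_) h) h) (h ++ [.lst (σ.lst h)])
    exact expect_recvIdxs_le (fun i h => expect_withIncreasing_le hpos (fun I hI h =>
      hrows _ I _ hI (fun hAI _ h => hrpm _ I J hI hJ hAI hAJ h) h) h) h

theorem execution_soundness (rowsFirst : Bool) (A : Matrix (Fin m) (Fin n) F) (S : Finset F)
    (hS : S.Nonempty) (σ : Prover F) :
    (execution rowsFirst A S hS σ).toOuterMeasure
        {res | ∃ R, res.output = some R ∧ ¬ IsRankProfileMatrix A R} ≤
      ENNReal.ofReal (1 - (1 - 1 / (S.card : ℝ)) ^ (2 * n)) := by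
  classical
  refine (toOuterMeasure_run A S hS σ _ (fun R => ¬ IsRankProfileMatrix A R) [] 0).trans_le
    (ENNReal.ofReal_le_ofReal ?_)
  convert expect_rpmVerifier_le hS rowsFirst []
  rfl

end SoundnessTheorem

section Codes

variable {F : Type u} [Field F]

/-! ### Straight-line parts of the Prover's program -/

/-- A part of a Prover's program, in continuation-passing style: given the size of the memory and
what to do with its result and the new size of the memory. -/
def Code (F : Type u) (α : Type) : Type u := ℕ → (α → ℕ → ProverProg F) → ProverProg F

instance : Monad (Code F) where
  pure a := fun s k => k a s
  bind x f := fun s k => x s fun a s' => f a s' k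

namespace Code

/-- Append a constant to the memory; the result is its address. -/
def konst (c : F) : Code F ℕ := fun s k => .const c (k s (s + 1))

/-- Append the result of an operation to the memory; the result is its address. -/
def arithm (o : ArithOp) (i j : ℕ) : Code F ℕ := fun s k => .op o i j (k s (s + 1))

/-- Test whether a cell holds zero. -/
def isZero (i : ℕ) : Code F Bool := fun s k => .test i (k true s) (k false s)

/-- Execute `f 0`, …, `f (r - 1)` in this order. -/
def tab {β : Type} : (r : ℕ) → (Fin r → Code F β) → Code F (Fin r → β)
  | 0, _ => pure Fin.elim0
  | r + 1, f => do
    let a ← f 0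
    let t ← tab r fun i => f i.succ
    pure (Fin.cons a t)

end Code

/-- Without communication, `x` turns the memory `mem` into `mem'`, at the cost `t`, with the result
`a`. -/
structure Evals {α : Type} (x : Code F α) (mem : List F) (a : α) (mem' : List F) (t : ℕ) :
    Prop where
  isPrefix : mem <+: mem'
  reply : ∀ k h, (x mem.length k).reply mem h = (k a mem'.length).reply mem' h
  cost : ∀ k h, (x mem.length k).cost mem h = (k a mem'.length).cost mem' h + t

/-- Without communication, `x` reaches a result and a memory that satisfy `Q`, at a cost at most
`t`. -/
def Computes {α : Type} (x : Code F α) (mem : List F) (t : ℝ) (Q : α → List F → Prop) : Prop :=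
  ∃ a mem' t', Evals x mem a mem' t' ∧ (t' : ℝ) ≤ t ∧ Q a mem'

namespace Computes

variable {α β : Type} {mem : List F} {t : ℝ}

theorem mono {x : Code F α} {Q Q' : α → List F → Prop} {t' : ℝ} (h : Computes x mem t Q)
    (ht : t ≤ t') (hQ : ∀ a mem', mem <+: mem' → Q a mem' → Q' a mem') : Computes x mem t' Q' := by
  obtain ⟨a, mem', t₀, he, h1, h2⟩ := h
  exact ⟨a, mem', t₀, he, h1.trans ht, hQ _ _ he.isPrefix h2⟩

theorem pure {a : α} {Q : α → List F → Prop} (ht : 0 ≤ t) (hQ : Q a mem) :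
    Computes (pure a) mem t Q :=
  ⟨a, mem, 0, ⟨List.prefix_rfl, fun _ _ => rfl, fun _ _ => rfl⟩, by simpa using ht, hQ⟩

/-- The total budget `T` is fixed in advance and the continuation receives what is left, so a chain
of steps ends in a single inequality. -/
theorem bind {x : Code F α} {f : α → Code F β} {Q : α → List F → Prop} {Q' : β → List F → Prop}
    {T : ℝ} (hx : Computes x mem t Q)
    (hf : ∀ a mem', mem <+: mem' → Q a mem' → Computes (f a) mem' (T - t) Q') :
    Computes (x >>= f) mem T Q' := by
  obtain ⟨a, mem', t₁, he, h1, h2⟩ := hx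
  obtain ⟨b, mem'', t₂, he', h1', h2'⟩ := hf a mem' he.isPrefix h2
  refine ⟨b, mem'', t₂ + t₁, ⟨he.isPrefix.trans he'.isPrefix, fun k h => ?_, fun k h => ?_⟩, ?_,
    h2'⟩
  · exact (he.reply _ h).trans (he'.reply k h)
  · refine (he.cost _ h).trans ?_
    rw [he'.cost k h, add_assoc]
  · push_cast
    linarith

end Computes

/-- The cell `i` of the memory holds `v`. -/
def Holds (mem : List F) (i : ℕ) (v : F) : Prop := mem[i]? = some v

/-- Memory only grows, so addresses stay valid. A formulation with a default value would lack this
property for absent cells. -/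
theorem Holds.mono {mem mem' : List F} {i : ℕ} {v : F} (h : Holds mem i v) (hm : mem <+: mem') :
    Holds mem' i v := by
  obtain ⟨t, rfl⟩ := hm
  unfold Holds at *
  rw [List.getElem?_append_left, h]
  exact (List.getElem?_eq_some_iff.1 h).1

theorem Holds.getD {mem : List F} {i : ℕ} {v : F} (h : Holds mem i v) : mem.getD i 0 = v := by
  unfold Holds at h
  rw [List.getD_eq_getElem?_getD, h, Option.getD_some]

theorem holds_length (mem : List F) (v : F) : Holds (mem ++ [v]) mem.length v := by
  simp [Holds]

/-- The cells `X i j` hold the entries of a matrix. -/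
def HoldsMat {a b : ℕ} (mem : List F) (X : Fin a → Fin b → ℕ) (M : Matrix (Fin a) (Fin b) F) :
    Prop :=
  ∀ i j, Holds mem (X i j) (M i j)

theorem HoldsMat.mono {a b : ℕ} {mem mem' : List F} {X : Fin a → Fin b → ℕ}
    {M : Matrix (Fin a) (Fin b) F} (h : HoldsMat mem X M) (hm : mem <+: mem') :
    HoldsMat mem' X M :=
  fun i j => (h i j).mono hm

theorem computes_konst (mem : List F) (c : F) :
    Computes (Code.konst c) mem 0 fun i mem' => Holds mem' i c :=
  ⟨mem.length, mem ++ [c], 0, ⟨List.prefix_append _ _, fun k h => by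
    simp [Code.konst, ProverProg.reply], fun k h => by simp [Code.konst, ProverProg.cost]⟩,
    by simp, holds_length _ _⟩

theorem computes_arithm {mem : List F} (o : ArithOp) {i j : ℕ} {x y : F} (hi : Holds mem i x)
    (hj : Holds mem j y) :
    Computes (Code.arithm o i j) mem 1 fun k mem' => Holds mem' k (o.eval x y) :=
  ⟨mem.length, mem ++ [o.eval x y], 1, ⟨List.prefix_append _ _, fun k h => by
    simp [Code.arithm, ProverProg.reply, -List.getD_eq_getElem?_getD, hi.getD, hj.getD],
    fun k h => by
      simp [Code.arithm, ProverProg.cost, -List.getD_eq_getElem?_getD, hi.getD, hj.getD]⟩,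
    by simp, holds_length _ _⟩

open Classical in
theorem computes_isZero {mem : List F} {i : ℕ} {x : F} (hi : Holds mem i x) :
    Computes (Code.isZero i) mem 1 fun b _ => b = decide (x = 0) :=
  ⟨decide (x = 0), mem, 1, ⟨List.prefix_rfl, fun k h => by
    by_cases hx : x = 0 <;>
      simp [Code.isZero, ProverProg.reply, -List.getD_eq_getElem?_getD, hi.getD, hx],
    fun k h => by
      by_cases hx : x = 0 <;>
        simp [Code.isZero, ProverProg.cost, -List.getD_eq_getElem?_getD, hi.getD, hx]⟩,
    by simp, rfl⟩

/-- Each `f i` starts from a memory enlarged by its predecessors, and its result must survive the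
enlargement by its successors. -/
theorem computes_tab {β : Type} {r : ℕ} {f : Fin r → Code F β} {mem : List F} {t : ℝ}
    {Q : Fin r → β → List F → Prop}
    (hmono : ∀ i a m₁ m₂, m₁ <+: m₂ → Q i a m₁ → Q i a m₂)
    (hf : ∀ i mem', mem <+: mem' → Computes (f i) mem' t (Q i)) :
    Computes (Code.tab r f) mem (r * t) fun g mem' => ∀ i, Q i (g i) mem' := by
  induction r generalizing mem with
  | zero => exact Computes.pure (by simp) fun i => i.elim0
  | succ r ih =>
    refine (hf 0 mem List.prefix_rfl).bind fun a m₁ h₁ ha => ?_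
    have e : ((r + 1 : ℕ) : ℝ) * t - t = r * t := by push_cast; ring
    rw [e]
    refine (ih (Q := fun i => Q i.succ) (fun i => hmono i.succ)
      fun i mem' hm => hf i.succ mem' (h₁.trans hm)).bind fun g m₂ h₂ hg => ?_
    rw [sub_self]
    refine Computes.pure le_rfl fun i => ?_
    refine Fin.cases ?_ (fun i => ?_) i
    · exact hmono _ _ _ _ h₂ ha
    · exact hg i

theorem computes_tab_mat {a b : ℕ} {f : Fin a → Fin b → Code F ℕ} {mem : List F} {t : ℝ}
    {M : Matrix (Fin a) (Fin b) F}
    (hf : ∀ i j mem', mem <+: mem' → Computes (f i j) mem' t fun k mem'' => Holds mem'' k (M i j)) :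
    Computes (Code.tab a fun i => Code.tab b (f i)) mem (a * (b * t)) fun X mem' =>
      HoldsMat mem' X M :=
  computes_tab (Q := fun i (X : Fin b → ℕ) mem' => ∀ j, Holds mem' (X j) (M i j))
    (by intro i X m₁ m₂ hm h j; exact (h j).mono hm)
    fun i m₁ h₁ => computes_tab (Q := fun j k mem' => Holds mem' k (M i j))
      (fun _ _ _ _ hm h => h.mono hm) fun j m₂ h₂ => hf i j m₂ (h₁.trans h₂)

/-! ### Matrix products -/

/-- Execute a straight-line program whose memory is found at the addresses `env`; the cell `z` holds
`0`. The result is the list of the addresses of its final memory. -/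
def compileSLP : List (Instr F) → List ℕ → ℕ → Code F (List ℕ)
  | [], env, _ => pure env
  | .const c :: p, env, z => do
    let a ← Code.konst c
    compileSLP p (env ++ [a]) z
  | .op o i j :: p, env, z => do
    let a ← Code.arithm o (env.getD i z) (env.getD j z)
    compileSLP p (env ++ [a]) z

/-- Straight-line programs read absent cells as `0`; the compiled program reads the cell `z`
instead. -/
theorem holds_getD {mem : List F} {env : List ℕ} {vals : List F} {z : ℕ} (hz : Holds mem z 0)
    (h : List.Forall₂ (Holds mem) env vals) (i : ℕ) : Holds mem (env.getD i z) (vals.getD i 0) := by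
  induction h generalizing i with
  | nil => simpa using hz
  | cons hd _ ih =>
    cases i with
    | zero => simpa using hd
    | succ i => simpa using ih i

theorem computes_compileSLP (p : List (Instr F)) {mem : List F} {env : List ℕ} {vals : List F}
    {z : ℕ} (hz : Holds mem z 0) (h : List.Forall₂ (Holds mem) env vals) :
    Computes (compileSLP p env z) mem (slpCost p) fun env' mem' =>
      List.Forall₂ (Holds mem') env' (runSLP p vals) := by
  induction p generalizing mem env vals with
  | nil => exact Computes.pure (by simp [slpCost]) h
  | cons ins p ih =>
    have hmono : ∀ {m₁ : List F}, mem <+: m₁ → List.Forall₂ (Holds m₁) env vals := fun hm =>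
      h.imp fun _ _ hx => hx.mono hm
    cases ins with
    | const c =>
      refine (computes_konst mem c).bind fun a m₁ h₁ ha => ?_
      rw [sub_zero]
      exact ih (hz.mono h₁) (List.rel_append (hmono h₁) (.cons ha .nil))
    | op o i j =>
      refine (computes_arithm o (holds_getD hz h i) (holds_getD hz h j)).bind fun a m₁ h₁ ha => ?_
      have e : ((slpCost (.op o i j :: p) : ℕ) : ℝ) - 1 = slpCost p := by
        simp [slpCost]
      rw [e]
      exact ih (hz.mono h₁) (List.rel_append (hmono h₁) (.cons ha .nil))

/-- A family of straight-line programs for the multiplication of square matrices. -/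
structure FastMul (F : Type u) [Field F] (ω c : ℝ) where
  prog : ℕ → List (Instr F)
  out : ∀ k, Fin k → Fin k → ℕ
  cost_le : ∀ k, (slpCost (prog k) : ℝ) ≤ c * (k : ℝ) ^ ω
  eval_eq : ∀ k (X Y : Matrix (Fin k) (Fin k) F) (i j : Fin k),
    (runSLP (prog k) (entries X ++ entries Y)).getD (out k i j) 0 = (X * Y) i j

theorem MatMulFeasible.exists_fastMul {ω c : ℝ} (h : MatMulFeasible F ω c) :
    Nonempty (FastMul F ω c) := by
  choose p out h1 h2 using h
  exact ⟨⟨p, out, h1, h2⟩⟩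

theorem FastMul.nonneg {ω c : ℝ} (fm : FastMul F ω c) : 0 ≤ c := by
  have := fm.cost_le 1
  simp only [Nat.cast_one, Real.one_rpow, mul_one] at this
  exact (Nat.cast_nonneg _).trans this

namespace FastMul

variable {ω c : ℝ} (fm : FastMul F ω c)

/-- The product of two square matrices. -/
def mulSquare {k : ℕ} (X Y : Fin k → Fin k → ℕ) (z : ℕ) : Code F (Fin k → Fin k → ℕ) := do
  let env ← compileSLP (fm.prog k) (List.ofFn (fun p : Fin (k * k) => X p.divNat p.modNat) ++
    List.ofFn fun p : Fin (k * k) => Y p.divNat p.modNat) z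
  pure fun i j => env.getD (fm.out k i j) z

theorem forall₂_ofFn {α β : Type*} {R : α → β → Prop} {k : ℕ} {f : Fin k → α} {g : Fin k → β}
    (h : ∀ i, R (f i) (g i)) : List.Forall₂ R (List.ofFn f) (List.ofFn g) := by
  rw [List.forall₂_iff_get]
  exact ⟨by simp, fun i h1 h2 => by simpa using h _⟩

theorem computes_mulSquare {k : ℕ} {X Y : Fin k → Fin k → ℕ} {z : ℕ} {mem : List F}
    {M N : Matrix (Fin k) (Fin k) F} (hz : Holds mem z 0) (hX : HoldsMat mem X M)
    (hY : HoldsMat mem Y N) :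
    Computes (fm.mulSquare X Y z) mem (slpCost (fm.prog k)) fun Z mem' =>
      HoldsMat mem' Z (M * N) := by
  refine (computes_compileSLP (fm.prog k) hz (vals := entries M ++ entries N)
    (List.rel_append (forall₂_ofFn fun p => hX _ _) (forall₂_ofFn fun p => hY _ _))).bind
    fun env m₁ h₁ henv => ?_
  rw [sub_self]
  refine Computes.pure le_rfl fun i j => ?_
  rw [← fm.eval_eq]
  exact holds_getD (hz.mono h₁) henv _

/-- The product of an `a × b` and a `b × d` matrix, by square tiles of size `b`. -/
def mul {a b d : ℕ} (X : Fin a → Fin b → ℕ) (Y : Fin b → Fin d → ℕ) :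
    Code F (Fin a → Fin d → ℕ) := do
  let z ← Code.konst 0
  let W ← Code.tab (a / b + 1) fun u => Code.tab (d / b + 1) fun v => fm.mulSquare
    (fun i k => if h : (u : ℕ) * b + i < a then X ⟨_, h⟩ k else z)
    (fun k j => if h : (v : ℕ) * b + j < d then Y k ⟨_, h⟩ else z) z
  pure fun i j => if hb : 0 < b then
    W ⟨i / b, Nat.lt_succ_of_le (Nat.div_le_div_right i.2.le)⟩
      ⟨j / b, Nat.lt_succ_of_le (Nat.div_le_div_right j.2.le)⟩
      ⟨i % b, Nat.mod_lt _ hb⟩ ⟨j % b, Nat.mod_lt _ hb⟩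
    else z

/-- Since `a, b ≤ m`, the rounded-up tiles satisfy `(a / b + 1) b ≤ 2 m`, and likewise for the
columns. The cost `c b^ω` of a tile then adds up to at most `(2 m) (2 n) c b^(ω-2)`. -/
theorem tiles_cost_le (hω : 2 < ω) {a b d m n : ℕ} (ha : a ≤ m) (hd : d ≤ n) (hbm : b ≤ m)
    (hbn : b ≤ n) : (((a / b + 1 : ℕ) : ℝ) * (((d / b + 1 : ℕ) : ℝ) * slpCost (fm.prog b))) ≤
      4 * c * m * n * (b : ℝ) ^ (ω - 2) := by
  have hc := fm.nonneg
  have h := fm.cost_le b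
  -- For `b = 0` there is a single tile, and its cost is at most `c 0^ω = 0`.
  rcases Nat.eq_zero_or_pos b with rfl | hb
  · rw [Nat.cast_zero, Real.zero_rpow (by linarith), mul_zero] at h
    have h0 : (slpCost (fm.prog 0) : ℝ) = 0 := le_antisymm h (Nat.cast_nonneg _)
    rw [h0, Nat.cast_zero, Real.zero_rpow (by linarith)]
    simp
  have hb' : (0 : ℝ) < b := by exact_mod_cast hb
  have key : ∀ x y : ℕ, x ≤ y → b ≤ y → (((x / b + 1 : ℕ) : ℝ)) * b ≤ 2 * y := by
    intro x y hx hby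
    have : (x / b + 1) * b ≤ 2 * y := by
      have := Nat.div_mul_le_self x b
      rw [add_mul]
      omega
    exact_mod_cast this
  have e : (b : ℝ) ^ ω = b * b * (b : ℝ) ^ (ω - 2) := by
    rw [Real.rpow_sub hb']
    field_simp
    norm_num
  have h1 := key a m ha hbm
  have h2 := key d n hd hbn
  calc (((a / b + 1 : ℕ) : ℝ) * (((d / b + 1 : ℕ) : ℝ) * slpCost (fm.prog b)))
      ≤ ((a / b + 1 : ℕ) : ℝ) * (((d / b + 1 : ℕ) : ℝ) * (c * (b : ℝ) ^ ω)) := by gcongr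
    _ = (((a / b + 1 : ℕ) : ℝ) * b) * (((d / b + 1 : ℕ) : ℝ) * b) * (c * (b : ℝ) ^ (ω - 2)) := by
        rw [e]; ring
    _ ≤ (2 * m) * (2 * n) * (c * (b : ℝ) ^ (ω - 2)) := by gcongr
    _ = _ := by ring

theorem computes_mul (hω : 2 < ω) {a b d m n : ℕ} (ha : a ≤ m) (hd : d ≤ n) (hbm : b ≤ m)
    (hbn : b ≤ n) {X : Fin a → Fin b → ℕ} {Y : Fin b → Fin d → ℕ} {mem : List F}
    {M : Matrix (Fin a) (Fin b) F} {N : Matrix (Fin b) (Fin d) F} (hX : HoldsMat mem X M)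
    (hY : HoldsMat mem Y N) :
    Computes (fm.mul X Y) mem (4 * c * m * n * (b : ℝ) ^ (ω - 2)) fun Z mem' =>
      HoldsMat mem' Z (M * N) := by
  refine (computes_konst mem 0).bind fun z m₁ h₁ hz => ?_
  -- The tiles, padded with zeros beyond the last row or column.
  let M' : ℕ → Matrix (Fin b) (Fin b) F := fun u =>
    Matrix.of fun i k => if h : u * b + i < a then M ⟨_, h⟩ k else 0
  let N' : ℕ → Matrix (Fin b) (Fin b) F := fun v =>
    Matrix.of fun k j => if h : v * b + j < d then N k ⟨_, h⟩ else 0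
  refine (computes_tab (Q := fun u (Wu : Fin (d / b + 1) → Fin b → Fin b → ℕ) mem' =>
      ∀ v, HoldsMat mem' (Wu v) (M' u * N' v))
      (by intro i X m₁ m₂ hm h v; exact (h v).mono hm)
    fun u m₂ h₂ => computes_tab (Q := fun v W mem' => HoldsMat mem' W (M' u * N' v))
      (fun _ _ _ _ hm h => h.mono hm) fun v m₃ h₃ => fm.computes_mulSquare
        (hz.mono (h₂.trans h₃)) (fun i k => ?_) fun k j => ?_).bind fun W m₂ h₂ hW => ?_
  · simp only [M', Matrix.of_apply]
    split_ifs with h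
    · exact (hX _ _).mono (h₁.trans (h₂.trans h₃))
    · exact hz.mono (h₂.trans h₃)
  · simp only [N', Matrix.of_apply]
    split_ifs with h
    · exact (hY _ _).mono (h₁.trans (h₂.trans h₃))
    · exact hz.mono (h₂.trans h₃)
  · have := fm.tiles_cost_le hω ha hd hbm hbn
    refine Computes.pure (by linarith) fun i j => ?_
    split_ifs with hb
    · have h := hW ⟨i / b, Nat.lt_succ_of_le (Nat.div_le_div_right i.2.le)⟩
        ⟨j / b, Nat.lt_succ_of_le (Nat.div_le_div_right j.2.le)⟩
        ⟨i % b, Nat.mod_lt _ hb⟩ ⟨j % b, Nat.mod_lt _ hb⟩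
      convert h using 1
      simp only [Matrix.mul_apply, M', N', Matrix.of_apply]
      refine Finset.sum_congr rfl fun k _ => ?_
      have hi : (i : ℕ) / b * b + i % b = i := Nat.div_add_mod' _ _
      have hj : (j : ℕ) / b * b + j % b = j := Nat.div_add_mod' _ _
      simp only [hi, hj, i.2, j.2, dite_true]
    · obtain rfl : b = 0 := by omega
      rw [Matrix.mul_apply, Finset.univ_eq_empty, Finset.sum_empty]
      exact hz.mono h₂

/-- `Z - X Y`. -/
def mulSub {a b d : ℕ} (Z : Fin a → Fin d → ℕ) (X : Fin a → Fin b → ℕ) (Y : Fin b → Fin d → ℕ) :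
    Code F (Fin a → Fin d → ℕ) :=
  if b = 0 then pure Z else do
    let W ← fm.mul X Y
    Code.tab a fun i => Code.tab d fun j => Code.arithm .sub (Z i j) (W i j)

theorem computes_mulSub (hω : 2 < ω) {a b d m n : ℕ} (ha : a ≤ m) (hd : d ≤ n) (hbm : b ≤ m)
    (hbn : b ≤ n) {Z : Fin a → Fin d → ℕ} {X : Fin a → Fin b → ℕ} {Y : Fin b → Fin d → ℕ}
    {mem : List F} {K : Matrix (Fin a) (Fin d) F}
    {M : Matrix (Fin a) (Fin b) F} {N : Matrix (Fin b) (Fin d) F} (hZ : HoldsMat mem Z K)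
    (hX : HoldsMat mem X M) (hY : HoldsMat mem Y N) :
    Computes (fm.mulSub Z X Y) mem ((4 * c + 1) * m * n * (b : ℝ) ^ (ω - 2)) fun Z mem' =>
      HoldsMat mem' Z (K - M * N) := by
  have hc := fm.nonneg
  unfold mulSub
  -- For `b = 0` the bound is `0^(ω-2) = 0` and leaves no room for the `a d` subtractions; hence the
  -- separate case.
  split_ifs with hb
  · subst hb
    refine Computes.pure (by positivity) fun i j => ?_
    rw [Matrix.sub_apply, Matrix.mul_apply, Finset.univ_eq_empty, Finset.sum_empty, sub_zero]
    exact hZ i j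
  · refine (fm.computes_mul hω ha hd hbm hbn hX hY).bind fun W m₁ h₁ hW => ?_
    refine (computes_tab_mat (M := K - M * N) (t := 1) fun i j m₂ h₂ => ?_).mono ?_
      fun _ _ _ h => h
    · exact computes_arithm .sub ((hZ i j).mono (h₁.trans h₂)) ((hW i j).mono h₂)
    · have hb1 : (1 : ℝ) ≤ b := by exact_mod_cast Nat.one_le_iff_ne_zero.2 hb
      have h1 : (1 : ℝ) ≤ (b : ℝ) ^ (ω - 2) := Real.one_le_rpow hb1 (by linarith)
      have h2 : (a : ℝ) * d ≤ m * n := by gcongr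
      have h3 : (m : ℝ) * n * 1 ≤ m * n * (b : ℝ) ^ (ω - 2) := by gcongr
      linarith

end FastMul
end Codes

/-! ### Elimination on the rows of a matrix -/

section Blocks

variable {α : Type*} {a b c d : ℕ}

/-- The array with the given blocks. -/
def blocks (X : Fin a → Fin c → α) (Y : Fin a → Fin d → α) (Z : Fin b → Fin c → α)
    (W : Fin b → Fin d → α) : Fin (a + b) → Fin (c + d) → α :=
  Fin.append (fun i => Fin.append (X i) (Y i)) fun i => Fin.append (Z i) (W i)

variable (X : Fin a → Fin c → α) (Y : Fin a → Fin d → α) (Z : Fin b → Fin c → α)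
  (W : Fin b → Fin d → α)

@[simp] theorem blocks_castAdd_castAdd (i : Fin a) (j : Fin c) :
    blocks X Y Z W (Fin.castAdd b i) (Fin.castAdd d j) = X i j := by simp [blocks]

@[simp] theorem blocks_castAdd_natAdd (i : Fin a) (j : Fin d) :
    blocks X Y Z W (Fin.castAdd b i) (Fin.natAdd c j) = Y i j := by simp [blocks]

@[simp] theorem blocks_natAdd_castAdd (i : Fin b) (j : Fin c) :
    blocks X Y Z W (Fin.natAdd a i) (Fin.castAdd d j) = Z i j := by simp [blocks]

@[simp] theorem blocks_natAdd_natAdd (i : Fin b) (j : Fin d) :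
    blocks X Y Z W (Fin.natAdd a i) (Fin.natAdd c j) = W i j := by simp [blocks]

/-- The matrix with the given blocks. -/
def blockMat (X : Matrix (Fin a) (Fin c) α) (Y : Matrix (Fin a) (Fin d) α)
    (Z : Matrix (Fin b) (Fin c) α) (W : Matrix (Fin b) (Fin d) α) :
    Matrix (Fin (a + b)) (Fin (c + d)) α :=
  Matrix.of (blocks (fun i j => X i j) (fun i j => Y i j) (fun i j => Z i j) fun i j => W i j)

/-- The matrix with the rows of `X`, followed by those of `Y`. -/
def stack (X : Matrix (Fin a) (Fin c) α) (Y : Matrix (Fin b) (Fin c) α) :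
    Matrix (Fin (a + b)) (Fin c) α :=
  Matrix.of (Fin.append (fun i j => X i j) fun i j => Y i j)

section Matrices

variable (X : Matrix (Fin a) (Fin c) α) (Y : Matrix (Fin a) (Fin d) α)
    (Z : Matrix (Fin b) (Fin c) α) (W : Matrix (Fin b) (Fin d) α)

@[simp] theorem blockMat_castAdd_castAdd (i : Fin a) (j : Fin c) :
    blockMat X Y Z W (Fin.castAdd b i) (Fin.castAdd d j) = X i j := by simp [blockMat]

@[simp] theorem blockMat_castAdd_natAdd (i : Fin a) (j : Fin d) :
    blockMat X Y Z W (Fin.castAdd b i) (Fin.natAdd c j) = Y i j := by simp [blockMat]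

@[simp] theorem blockMat_natAdd_castAdd (i : Fin b) (j : Fin c) :
    blockMat X Y Z W (Fin.natAdd a i) (Fin.castAdd d j) = Z i j := by simp [blockMat]

@[simp] theorem blockMat_natAdd_natAdd (i : Fin b) (j : Fin d) :
    blockMat X Y Z W (Fin.natAdd a i) (Fin.natAdd c j) = W i j := by simp [blockMat]

@[simp] theorem stack_castAdd (i : Fin a) (j : Fin c) : stack X Z (Fin.castAdd b i) j = X i j := by
  simp [stack]

@[simp] theorem stack_natAdd (i : Fin b) (j : Fin c) : stack X Z (Fin.natAdd a i) j = Z i j := by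
  simp [stack]

end Matrices

@[simp] theorem castAdd_lt_castAdd_iff {i j : Fin a} :
    Fin.castAdd b i < Fin.castAdd b j ↔ i < j :=
  Iff.rfl

theorem castAdd_ne_natAdd (i : Fin a) (j : Fin b) : Fin.castAdd b i ≠ Fin.natAdd a j := by
  simp only [ne_eq, Fin.ext_iff, Fin.val_castAdd, Fin.val_natAdd]
  omega

end Blocks

theorem HoldsMat.blockMat {F : Type u} {a b c d : ℕ} {mem : List F}
    {x : Fin a → Fin c → ℕ} {y : Fin a → Fin d → ℕ} {z : Fin b → Fin c → ℕ} {w : Fin b → Fin d → ℕ}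
    {X : Matrix (Fin a) (Fin c) F} {Y : Matrix (Fin a) (Fin d) F}
    {Z : Matrix (Fin b) (Fin c) F} {W : Matrix (Fin b) (Fin d) F} (hx : HoldsMat mem x X)
    (hy : HoldsMat mem y Y) (hz : HoldsMat mem z Z) (hw : HoldsMat mem w W) :
    HoldsMat mem (blocks x y z w) (blockMat X Y Z W) := by
  intro i j
  induction i using Fin.addCases with
  | left i =>
    induction j using Fin.addCases with
    | left j => simpa using hx i j
    | right j => simpa using hy i j
  | right i =>
    induction j using Fin.addCases with
    | left j => simpa using hz i j
    | right j => simpa using hw i j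

theorem HoldsMat.stack {F : Type u} {a b c : ℕ} {mem : List F}
    {x : Fin a → Fin c → ℕ} {z : Fin b → Fin c → ℕ}
    {X : Matrix (Fin a) (Fin c) F} {Z : Matrix (Fin b) (Fin c) F} (hx : HoldsMat mem x X)
    (hz : HoldsMat mem z Z) : HoldsMat mem (Fin.append x z) (stack X Z) := by
  intro i j
  induction i using Fin.addCases with
  | left i => simpa using hx i j
  | right i => simpa using hz i j

section Elim

variable {F : Type u} [Field F]

/-- A decomposition `A = C U`, where `C` is in column echelon form with unit pivots in the rows `I`,
and the rows of `U` have their first nonzero entries in the distinct columns `J`, below which the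
entries of `U` are zero. The matrices `S` and `T` are the inverses of the pivot rows of `C` and of
the pivot columns of `U`. -/
structure IsElim {m n r : ℕ} (A : Matrix (Fin m) (Fin n) F) (I : Fin r → Fin m) (J : Fin r → Fin n)
    (C : Matrix (Fin m) (Fin r) F) (U : Matrix (Fin r) (Fin n) F)
    (S T : Matrix (Fin r) (Fin r) F) : Prop where
  eq_mul : A = C * U
  strictMono : StrictMono I
  C_zero : ∀ i k, i < I k → C i k = 0
  C_one : ∀ k, C (I k) k = 1
  U_zero : ∀ k j, j < J k → U k j = 0
  U_ne : ∀ k, U k (J k) ≠ 0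
  U_cleared : ∀ k k', k' < k → U k (J k') = 0
  S_mul : S * C.submatrix I id = 1
  T_mul : T * U.submatrix id J = 1

namespace IsElim

section Facts

variable {m n r : ℕ} {A : Matrix (Fin m) (Fin n) F} {I : Fin r → Fin m} {J : Fin r → Fin n}
  {C : Matrix (Fin m) (Fin r) F} {U : Matrix (Fin r) (Fin n) F} {S T : Matrix (Fin r) (Fin r) F}

theorem injective (h : IsElim A I J C U S T) : Function.Injective J := by
  intro k k' hk
  by_contra hne
  rcases lt_or_gt_of_ne hne with hlt | hlt
  · exact h.U_ne k' (hk ▸ h.U_cleared k' k hlt)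
  · exact h.U_ne k (hk ▸ h.U_cleared k k' hlt)

theorem isRankProfileMatrix (h : IsElim A I J C U S T) :
    IsRankProfileMatrix A (unitColumns F I * (unitColumns F J).transpose) ∧ A.rank = r :=
  isRankProfileMatrix_of_echelon h.strictMono.injective h.injective h.eq_mul h.C_zero
    (fun k => by rw [h.C_one]; exact one_ne_zero) h.U_zero h.U_ne

end Facts

variable {a b n r s : ℕ} {A₁ : Matrix (Fin a) (Fin n) F} {A₂ : Matrix (Fin b) (Fin n) F}
  {I₁ : Fin r → Fin a} {J₁ : Fin r → Fin n}
  {C₁ : Matrix (Fin a) (Fin r) F} {U₁ : Matrix (Fin r) (Fin n) F}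
  {S₁ T₁ : Matrix (Fin r) (Fin r) F} {G : Matrix (Fin b) (Fin r) F}
  {I₂ : Fin s → Fin b} {J₂ : Fin s → Fin n}
  {C₂ : Matrix (Fin b) (Fin s) F} {U₂ : Matrix (Fin s) (Fin n) F}
  {S₂ T₂ : Matrix (Fin s) (Fin s) F}

/-- `G` is chosen so that `A₂ - G U₁` vanishes in the columns `J₁`. As `S₂` inverts the pivot rows
of `C₂`, the rows of `U₂` are combinations of rows of this Schur complement and vanish there too. -/
theorem schur_zero (h₁ : IsElim A₁ I₁ J₁ C₁ U₁ S₁ T₁) (hG : G = A₂.submatrix id J₁ * T₁)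
    (h₂ : IsElim (A₂ - G * U₁) I₂ J₂ C₂ U₂ S₂ T₂) (k : Fin s) (j : Fin r) : U₂ k (J₁ j) = 0 := by
  have e1 : (A₂ - G * U₁).submatrix id J₁ = 0 := by
    have : (A₂ - G * U₁).submatrix id J₁ = A₂.submatrix id J₁ - G * U₁.submatrix id J₁ := by
      ext i j
      simp [Matrix.mul_apply]
    rw [this, hG, Matrix.mul_assoc, h₁.T_mul, Matrix.mul_one, sub_self]
  have e2 : U₂.submatrix id J₁ = S₂ * ((A₂ - G * U₁).submatrix id J₁).submatrix I₂ id := by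
    have : ((A₂ - G * U₁).submatrix id J₁).submatrix I₂ id =
        C₂.submatrix I₂ id * U₂.submatrix id J₁ := by
      rw [h₂.eq_mul]
      ext i j
      simp [Matrix.mul_apply]
    rw [this, ← Matrix.mul_assoc, h₂.S_mul, Matrix.one_mul]
  have := congrFun₂ e2 k j
  rw [e1] at this
  simpa using this

/-- By `schur_zero` the pivot columns of the stacked `U` are block upper triangular, while the pivot
rows of `C` are block lower triangular; their inverses follow blockwise. The form `0 - _` is what
`mulSub` computes from a zero cell. -/
theorem merge (h₁ : IsElim A₁ I₁ J₁ C₁ U₁ S₁ T₁) (hG : G = A₂.submatrix id J₁ * T₁)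
    (h₂ : IsElim (A₂ - G * U₁) I₂ J₂ C₂ U₂ S₂ T₂) :
    IsElim (stack A₁ A₂)
      (Fin.append (fun k => Fin.castAdd b (I₁ k)) fun k => Fin.natAdd a (I₂ k)) (Fin.append J₁ J₂)
      (blockMat C₁ 0 G C₂) (stack U₁ U₂)
      (blockMat S₁ 0 (0 - S₂ * G.submatrix I₂ id * S₁) S₂)
      (blockMat T₁ (0 - T₁ * U₁.submatrix id J₂ * T₂) 0 T₂) where
  eq_mul := by
    ext i j
    refine Fin.addCases (fun i => ?_) (fun i => ?_) i
    · simpa [Matrix.mul_apply, Fin.sum_univ_add] using congrFun₂ h₁.eq_mul i j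
    · have := congrFun₂ h₂.eq_mul i j
      rw [Matrix.sub_apply, sub_eq_iff_eq_add'] at this
      simpa [Matrix.mul_apply, Fin.sum_univ_add] using this
  strictMono := by
    intro k k' hk
    induction k using Fin.addCases with
    | left k =>
      induction k' using Fin.addCases with
      | left k' => simpa using h₁.strictMono (by simpa using hk)
      | right k' =>
        simp only [Fin.append_left, Fin.append_right, Fin.lt_def, Fin.val_castAdd, Fin.val_natAdd]
        omega
    | right k =>
      induction k' using Fin.addCases with
      | left k' =>
        simp only [Fin.lt_def, Fin.val_castAdd, Fin.val_natAdd] at hk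
        omega
      | right k' => simpa using h₂.strictMono (by simpa using hk)
  C_zero := by
    intro i k hk
    induction k using Fin.addCases with
    | left k =>
      induction i using Fin.addCases with
      | left i => simpa using h₁.C_zero i k (by simpa using hk)
      | right i =>
        simp only [Fin.append_left, Fin.lt_def, Fin.val_castAdd, Fin.val_natAdd] at hk
        omega
    | right k =>
      induction i using Fin.addCases with
      | left i => simp
      | right i => simpa using h₂.C_zero i k (by simpa using hk)
  C_one := by
    intro k
    induction k using Fin.addCases with
    | left k => simpa using h₁.C_one k
    | right k => simpa using h₂.C_one k
  U_zero := by
    intro k j hj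
    induction k using Fin.addCases with
    | left k => simpa using h₁.U_zero k j (by simpa using hj)
    | right k => simpa using h₂.U_zero k j (by simpa using hj)
  U_ne := by
    intro k
    induction k using Fin.addCases with
    | left k => simpa using h₁.U_ne k
    | right k => simpa using h₂.U_ne k
  U_cleared := by
    intro k k' hk
    induction k using Fin.addCases with
    | left k =>
      induction k' using Fin.addCases with
      | left k' => simpa using h₁.U_cleared k k' (by simpa using hk)
      | right k' =>
        simp only [Fin.lt_def, Fin.val_castAdd, Fin.val_natAdd] at hk
        omega
    | right k =>
      induction k' using Fin.addCases with
      | left k' => simpa using h₁.schur_zero hG h₂ k k'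
      | right k' => simpa using h₂.U_cleared k k' (by simpa using hk)
  S_mul := by
    have e : (0 - S₂ * G.submatrix I₂ id * S₁) * C₁.submatrix I₁ id + S₂ * G.submatrix I₂ id = 0 := by
      rw [zero_sub, Matrix.neg_mul, Matrix.mul_assoc, h₁.S_mul, Matrix.mul_one, neg_add_cancel]
    ext k k'
    induction k using Fin.addCases with
    | left k =>
      induction k' using Fin.addCases with
      | left k' =>
        simpa [Matrix.mul_apply, Fin.sum_univ_add, Matrix.one_apply] using congrFun₂ h₁.S_mul k k'
      | right k' =>
        have := castAdd_ne_natAdd k k'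
        simp [Matrix.mul_apply, Fin.sum_univ_add, this]
    | right k =>
      induction k' using Fin.addCases with
      | left k' =>
        have h := (castAdd_ne_natAdd k' k).symm
        have := congrFun₂ e k k'
        rw [Matrix.add_apply, Matrix.mul_apply, Matrix.mul_apply (M := S₂)] at this
        rw [Matrix.mul_apply, Fin.sum_univ_add, Matrix.one_apply_ne h]
        simpa using this
      | right k' =>
        simpa [Matrix.mul_apply, Fin.sum_univ_add, Matrix.one_apply] using congrFun₂ h₂.S_mul k k'
  T_mul := by
    have e : T₁ * U₁.submatrix id J₂ + (0 - T₁ * U₁.submatrix id J₂ * T₂) * U₂.submatrix id J₂ =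
        0 := by
      rw [zero_sub, Matrix.neg_mul, Matrix.mul_assoc _ T₂, h₂.T_mul, Matrix.mul_one,
        add_neg_cancel]
    have z := h₁.schur_zero hG h₂
    ext k k'
    induction k using Fin.addCases with
    | left k =>
      induction k' using Fin.addCases with
      | left k' =>
        simpa [Matrix.mul_apply, Fin.sum_univ_add, Matrix.one_apply, z] using
          congrFun₂ h₁.T_mul k k'
      | right k' =>
        have h := castAdd_ne_natAdd k k'
        have := congrFun₂ e k k'
        rw [Matrix.add_apply, Matrix.mul_apply, Matrix.mul_apply (M := 0 - _)] at this
        rw [Matrix.mul_apply, Fin.sum_univ_add, Matrix.one_apply_ne h]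
        simpa using this
    | right k =>
      induction k' using Fin.addCases with
      | left k' =>
        have h := (castAdd_ne_natAdd k' k).symm
        simp [Matrix.mul_apply, Fin.sum_univ_add, h, z]
      | right k' =>
        simpa [Matrix.mul_apply, Fin.sum_univ_add, Matrix.one_apply] using congrFun₂ h₂.T_mul k k'

end IsElim

/-! ### The cost recursion -/

/-- The factor by which the measure `m r ^ θ` decreases when the rows are halved. -/
noncomputable def decay (θ : ℝ) : ℝ := (2 / 3 : ℝ) ^ min θ 1

theorem decay_lt_one {θ : ℝ} (hθ : 0 < θ) : decay θ < 1 :=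
  Real.rpow_lt_one (by norm_num) (by norm_num) (lt_min hθ one_pos)

/-- For `θ ≥ 1` each part has at most two thirds of the rows and `x ↦ x^θ` is superadditive. For `θ
≤ 1` concavity bounds the mean of `a^θ` and `b^θ`, weighted by the rows, by the power of the
weighted mean of `a` and `b`, which is at most `2/3 (a + b)`. -/
theorem halving_le {θ : ℝ} (hθ : 0 < θ) {m₁ m₂ a b : ℕ} (h₁ : 3 * m₁ ≤ 2 * (m₁ + m₂))
    (h₂ : 3 * m₂ ≤ 2 * (m₁ + m₂)) :
    (m₁ : ℝ) * (a : ℝ) ^ θ + m₂ * (b : ℝ) ^ θ ≤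
      decay θ * ((m₁ + m₂ : ℕ) : ℝ) * ((a + b : ℕ) : ℝ) ^ θ := by
  have h₁' : (m₁ : ℝ) ≤ 2 / 3 * (m₁ + m₂) := by
    have : (3 : ℝ) * m₁ ≤ 2 * (m₁ + m₂) := by exact_mod_cast h₁
    linarith
  have h₂' : (m₂ : ℝ) ≤ 2 / 3 * (m₁ + m₂) := by
    have : (3 : ℝ) * m₂ ≤ 2 * (m₁ + m₂) := by exact_mod_cast h₂
    linarith
  have ha : (0 : ℝ) ≤ a := Nat.cast_nonneg _
  have hb : (0 : ℝ) ≤ b := Nat.cast_nonneg _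
  unfold decay
  push_cast
  rcases le_total 1 θ with h | h
  · rw [min_eq_right h, Real.rpow_one]
    have := Real.add_rpow_le_rpow_add ha hb h
    calc (m₁ : ℝ) * (a : ℝ) ^ θ + m₂ * (b : ℝ) ^ θ
        ≤ 2 / 3 * (m₁ + m₂) * (a : ℝ) ^ θ + 2 / 3 * (m₁ + m₂) * (b : ℝ) ^ θ := by gcongr
      _ = 2 / 3 * (m₁ + m₂) * ((a : ℝ) ^ θ + (b : ℝ) ^ θ) := by ring
      _ ≤ _ := by gcongr
  · rw [min_eq_left h]
    rcases Nat.eq_zero_or_pos (m₁ + m₂) with hm | hm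
    · obtain ⟨rfl, rfl⟩ : m₁ = 0 ∧ m₂ = 0 := by omega
      simp
    have hm' : (0 : ℝ) < m₁ + m₂ := by exact_mod_cast hm
    have hj := (Real.concaveOn_rpow hθ.le h).2 (Set.mem_Ici.2 ha) (Set.mem_Ici.2 hb)
      (show (0 : ℝ) ≤ m₁ / (m₁ + m₂) by positivity) (show (0 : ℝ) ≤ m₂ / (m₁ + m₂) by positivity)
      (by rw [← add_div, div_self hm'.ne'])
    simp only [smul_eq_mul] at hj
    have h3 : (m₁ : ℝ) / (m₁ + m₂) * a + (m₂ : ℝ) / (m₁ + m₂) * b ≤ 2 / 3 * (a + b) := by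
      have e1 : (m₁ : ℝ) / (m₁ + m₂) ≤ 2 / 3 := by rwa [div_le_iff₀ hm']
      have e2 : (m₂ : ℝ) / (m₁ + m₂) ≤ 2 / 3 := by rwa [div_le_iff₀ hm']
      have := mul_le_mul_of_nonneg_right e1 ha
      have := mul_le_mul_of_nonneg_right e2 hb
      linarith
    have h4 := hj.trans (Real.rpow_le_rpow (by positivity) h3 hθ.le)
    rw [Real.mul_rpow (by norm_num) (by positivity)] at h4
    calc (m₁ : ℝ) * (a : ℝ) ^ θ + m₂ * (b : ℝ) ^ θ
        = (m₁ + m₂) * ((m₁ : ℝ) / (m₁ + m₂) * (a : ℝ) ^ θ +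
          (m₂ : ℝ) / (m₁ + m₂) * (b : ℝ) ^ θ) := by field_simp
      _ ≤ (m₁ + m₂) * ((2 / 3) ^ θ * (a + b : ℝ) ^ θ) := by gcongr
      _ = _ := by ring

/-! ### The elimination algorithm -/

/-- The recursive subdivision of the rows of a matrix. -/
inductive RowTree
  | nil
  | leaf
  | node (l r : RowTree)

namespace RowTree

/-- The number of rows. -/
def size : RowTree → ℕ
  | nil => 0
  | leaf => 1
  | node l r => size l + size r

/-- Each part has at most two thirds of the rows. -/
def Balanced : RowTree → Prop
  | nil => True
  | leaf => True
  | node l r => 3 * size l ≤ 2 * (size l + size r) ∧ 3 * size r ≤ 2 * (size l + size r) ∧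
      Balanced l ∧ Balanced r

/-- The extreme case of halving is three rows split into one and two, whence the ratio two thirds.
-/
theorem exists_balanced (m : ℕ) : ∃ t : RowTree, t.Balanced ∧ t.size = m := by
  induction m using Nat.strong_induction_on with
  | _ m ih =>
    rcases Nat.lt_or_ge m 2 with hm | hm
    · interval_cases m
      · exact ⟨nil, trivial, rfl⟩
      · exact ⟨leaf, trivial, rfl⟩
    · obtain ⟨l, hl, hl'⟩ := ih (m / 2) (by omega)
      obtain ⟨r, hr, hr'⟩ := ih (m - m / 2) (by omega)
      refine ⟨node l r, ⟨?_, ?_, hl, hr⟩, ?_⟩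
      · rw [hl', hr']; omega
      · rw [hl', hr']; omega
      · rw [size, hl', hr']; omega

end RowTree

/-- The first of the cells that does not hold zero. -/
def findNonzero : (n : ℕ) → (Fin n → ℕ) → Code F (Option (Fin n))
  | 0, _ => pure none
  | n + 1, X => do
    let b ← Code.isZero (X 0)
    if b then do
      let o ← findNonzero n fun j => X j.succ
      pure (o.map Fin.succ)
    else pure (some 0)

theorem computes_findNonzero {n : ℕ} {X : Fin n → ℕ} {v : Fin n → F} {mem : List F}
    (hX : ∀ j, Holds mem (X j) (v j)) :
    Computes (findNonzero n X) mem n fun o _ => (o = none → v = 0) ∧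
      ∀ j, o = some j → v j ≠ 0 ∧ ∀ i < j, v i = 0 := by
  induction n generalizing mem with
  | zero => exact Computes.pure (by simp) ⟨fun _ => Subsingleton.elim _ _, fun j => j.elim0⟩
  | succ n ih =>
    refine (computes_isZero (hX 0)).bind fun b m₁ h₁ hb => ?_
    subst hb
    by_cases h0 : v 0 = 0
    · simp only [h0, decide_true, if_true]
      refine ((ih (v := fun j => v j.succ) fun j => (hX j.succ).mono h₁).mono
        (t' := ((n + 1 : ℕ) : ℝ) - 1) (by push_cast; linarith) fun _ _ _ h => h).bind
        fun o m₂ h₂ ho => ?_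
      rw [sub_self]
      refine Computes.pure le_rfl ⟨fun hn => ?_, fun j hj => ?_⟩
      · have := ho.1 (by simpa using hn)
        funext j
        exact Fin.cases h0 (fun j => congrFun this j) j
      · obtain ⟨j', hj', rfl⟩ := Option.map_eq_some_iff.1 hj
        obtain ⟨ho1, ho2⟩ := ho.2 j' hj'
        refine ⟨ho1, fun i => Fin.cases (fun _ => h0) (fun i hi => ho2 i (by simpa using hi)) i⟩
    · simp only [h0, decide_false]
      refine Computes.pure (by push_cast; linarith [Nat.cast_nonneg (α := ℝ) n])
        ⟨by simp, fun j hj => ?_⟩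
      obtain rfl : 0 = j := by simpa using hj
      exact ⟨h0, fun i hi => absurd hi (by simp)⟩

/-- The result of an elimination: the pivots, and the addresses of the entries of the matrices of
the decomposition. -/
structure Elim (m n : ℕ) where
  r : ℕ
  I : Fin r → Fin m
  J : Fin r → Fin n
  C : Fin m → Fin r → ℕ
  U : Fin r → Fin n → ℕ
  S : Fin r → Fin r → ℕ
  T : Fin r → Fin r → ℕ

/-- The memory holds a decomposition of `A`. -/
def Elim.Valid {m n : ℕ} (E : Elim m n) (A : Matrix (Fin m) (Fin n) F) (mem : List F) : Prop :=
  ∃ C U S T, IsElim A E.I E.J C U S T ∧ HoldsMat mem E.C C ∧ HoldsMat mem E.U U ∧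
    HoldsMat mem E.S S ∧ HoldsMat mem E.T T

/-- The decomposition without pivots. -/
def Elim.empty (m n : ℕ) : Elim m n :=
  ⟨0, Fin.elim0, Fin.elim0, fun _ => Fin.elim0, Fin.elim0, Fin.elim0, Fin.elim0⟩

theorem Elim.empty_valid {m n : ℕ} {A : Matrix (Fin m) (Fin n) F} (hA : A = 0) (mem : List F) :
    (Elim.empty m n).Valid A mem :=
  ⟨0, 0, (0 : Matrix (Fin 0) (Fin 0) F), (0 : Matrix (Fin 0) (Fin 0) F),
    ⟨by rw [hA, Matrix.mul_zero], fun k => k.elim0, fun _ k => k.elim0,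
    fun k => k.elim0, fun k => k.elim0, fun k => k.elim0, fun k => k.elim0,
    by ext k; exact k.elim0, by ext k; exact k.elim0⟩, fun _ k => k.elim0, fun k => k.elim0,
    fun k => k.elim0, fun k => k.elim0⟩

/-- The decomposition of a matrix with one row. -/
def elimRow {n : ℕ} (X : Fin 1 → Fin n → ℕ) : Code F (Elim 1 n) := do
  match ← findNonzero n (X 0) with
  | none => pure (Elim.empty 1 n)
  | some j => do
    let e ← Code.konst 1
    let d ← Code.arithm .div e (X 0 j)
    pure ⟨1, fun _ => 0, fun _ => j, fun _ _ => e, X, fun _ _ => e, fun _ _ => d⟩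

/-- At most `n` tests, and one division exactly when the row is nonzero, that is, when the rank is
one. -/
theorem computes_elimRow {n : ℕ} {X : Fin 1 → Fin n → ℕ} {A : Matrix (Fin 1) (Fin n) F}
    {mem : List F} (hX : HoldsMat mem X A) :
    Computes (elimRow X) mem (n + A.rank) fun E mem' => E.Valid A mem' := by
  refine (computes_findNonzero (hX 0)).bind fun o m₁ h₁ ho => ?_
  rcases o with _ | j
  · refine Computes.pure (by simp) (Elim.empty_valid ?_ _)
    ext i j
    rw [Subsingleton.elim i 0]
    exact congrFun (ho.1 rfl) j
  · obtain ⟨hj, hlt⟩ := ho.2 j rfl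
    have hE : IsElim A (fun _ : Fin 1 => 0) (fun _ => j) (Matrix.of fun _ _ => 1) A
        (Matrix.of fun _ _ => 1) (Matrix.of fun _ _ => 1 / A 0 j) := by
      refine ⟨?_, ?_, ?_, ?_, ?_, ?_, ?_, ?_, ?_⟩
      · ext i j
        simp [Matrix.mul_apply, Subsingleton.elim i 0]
      · intro k k' h
        exact absurd h (by simp [Subsingleton.elim k k'])
      · intro i k h
        exact absurd h (by simp [Subsingleton.elim i 0])
      · exact fun _ => rfl
      · intro k i h
        rw [Subsingleton.elim k 0]
        exact hlt i h
      · intro k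
        rw [Subsingleton.elim k 0]
        exact hj
      · intro k k' h
        exact absurd h (by simp [Subsingleton.elim k k'])
      · ext i j
        simp [Matrix.mul_apply, Matrix.one_apply, Subsingleton.elim i j]
      · ext i j'
        simp [Matrix.mul_apply, Matrix.one_apply, Subsingleton.elim i j', Subsingleton.elim j' 0, hj]
    rw [hE.isRankProfileMatrix.2]
    refine (computes_konst m₁ 1).bind fun e m₂ h₂ he => ?_
    refine (computes_arithm .div he ((hX 0 j).mono (h₁.trans h₂))).bind fun d m₃ h₃ hd => ?_
    refine Computes.pure (by simp) ⟨_, _, _, _, hE, fun _ _ => he.mono h₃, fun i j => ?_,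
      fun _ _ => he.mono h₃, fun _ _ => hd⟩
    exact (hX i j).mono (h₁.trans (h₂.trans h₃))

variable {ω c : ℝ} (fm : FastMul F ω c)

/-- The decomposition of a matrix from decompositions of its first rows and of the Schur complement
of these in the others. -/
def elimMerge {a b n : ℕ} (E : Elim a n) (G : Fin b → Fin E.r → ℕ) (E' : Elim b n) :
    Code F (Elim (a + b) n) := do
  let z ← Code.konst 0
  let V ← fm.mul E.T fun k l => E.U k (E'.J l)
  let T ← fm.mulSub (fun _ _ => z) V E'.T
  let W ← fm.mul E'.S fun k l => G (E'.I k) l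
  let S ← fm.mulSub (fun _ _ => z) W E.S
  pure ⟨E.r + E'.r, Fin.append (fun k => Fin.castAdd b (E.I k)) fun k => Fin.natAdd a (E'.I k),
    Fin.append E.J E'.J, blocks E.C (fun _ _ => z) G E'.C, Fin.append E.U E'.U,
    blocks E.S (fun _ _ => z) S E'.S, blocks E.T T (fun _ _ => z) E'.T⟩

/-- The decomposition of a matrix from procedures for its first and for its last rows. -/
def elimNode {a b n : ℕ} (f : (Fin a → Fin n → ℕ) → Code F (Elim a n))
    (g : (Fin b → Fin n → ℕ) → Code F (Elim b n)) (X : Fin (a + b) → Fin n → ℕ) :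
    Code F (Elim (a + b) n) := do
  let E ← f fun i => X (Fin.castAdd b i)
  let G ← fm.mul (fun i k => X (Fin.natAdd a i) (E.J k)) E.T
  let Y ← fm.mulSub (fun i => X (Fin.natAdd a i)) G E.U
  let E' ← g Y
  elimMerge fm E G E'

/-- The decomposition of a matrix, by elimination on its rows. -/
def elim {n : ℕ} : (t : RowTree) → (Fin t.size → Fin n → ℕ) → Code F (Elim t.size n)
  | .nil, _ => pure (Elim.empty 0 n)
  | .leaf, X => elimRow X
  | .node l r, X => elimNode fm (elim l) (elim r) X

/-- Four products, each with one of the two ranks as inner dimension; the inverses `S` and `T` are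
maintained so that no triangular system has to be solved. -/
theorem computes_elimMerge (hω : 2 < ω) {a b n : ℕ} {E : Elim a n} {E' : Elim b n}
    {G : Fin b → Fin E.r → ℕ} {A₁ : Matrix (Fin a) (Fin n) F} {A₂ : Matrix (Fin b) (Fin n) F}
    {C₁ : Matrix (Fin a) (Fin E.r) F} {U₁ : Matrix (Fin E.r) (Fin n) F}
    {S₁ T₁ : Matrix (Fin E.r) (Fin E.r) F} {G' : Matrix (Fin b) (Fin E.r) F} {mem : List F}
    (h₁ : IsElim A₁ E.I E.J C₁ U₁ S₁ T₁) (hC : HoldsMat mem E.C C₁) (hU : HoldsMat mem E.U U₁)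
    (hS : HoldsMat mem E.S S₁) (hT : HoldsMat mem E.T T₁) (hG : HoldsMat mem G G')
    (hG' : G' = A₂.submatrix id E.J * T₁) (h₂ : E'.Valid (A₂ - G' * U₁) mem) :
    Computes (elimMerge fm E G E') mem
      (4 * ((4 * c + 1) * (a + b : ℕ) * n * ((E.r + E'.r : ℕ) : ℝ) ^ (ω - 2)))
      fun E'' mem' => E''.Valid (stack A₁ A₂) mem' ∧ E''.r = E.r + E'.r := by
  obtain ⟨C₂, U₂, S₂, T₂, h₂, hC₂, hU₂, hS₂, hT₂⟩ := h₂
  have hc := fm.nonneg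
  have ra : E.r ≤ a + b := (by simpa using Fintype.card_le_of_injective _ h₁.strictMono.injective :
    E.r ≤ a).trans (Nat.le_add_right _ _)
  have rb : E'.r ≤ a + b := (by simpa using Fintype.card_le_of_injective _ h₂.strictMono.injective :
    E'.r ≤ b).trans (Nat.le_add_left _ _)
  have rn : E.r ≤ n := by simpa using Fintype.card_le_of_injective _ h₁.injective
  have rn' : E'.r ≤ n := by simpa using Fintype.card_le_of_injective _ h₂.injective
  set M : ℝ := (4 * c + 1) * (a + b : ℕ) * n * ((E.r + E'.r : ℕ) : ℝ) ^ (ω - 2) with hM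
  have p1 : ((E.r : ℕ) : ℝ) ^ (ω - 2) ≤ ((E.r + E'.r : ℕ) : ℝ) ^ (ω - 2) :=
    Real.rpow_le_rpow (by positivity) (by push_cast; linarith [Nat.cast_nonneg (α := ℝ) E'.r])
      (by linarith)
  have p2 : ((E'.r : ℕ) : ℝ) ^ (ω - 2) ≤ ((E.r + E'.r : ℕ) : ℝ) ^ (ω - 2) :=
    Real.rpow_le_rpow (by positivity) (by push_cast; linarith [Nat.cast_nonneg (α := ℝ) E.r])
      (by linarith)
  have q1 : (4 * c + 1) * (a + b : ℕ) * n * ((E.r : ℕ) : ℝ) ^ (ω - 2) ≤ M := by rw [hM]; gcongr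
  have q2 : (4 * c + 1) * (a + b : ℕ) * n * ((E'.r : ℕ) : ℝ) ^ (ω - 2) ≤ M := by rw [hM]; gcongr
  have q3 : 4 * c * (a + b : ℕ) * n * ((E.r : ℕ) : ℝ) ^ (ω - 2) ≤ M := by
    refine le_trans ?_ q1
    gcongr
    linarith
  have q4 : 4 * c * (a + b : ℕ) * n * ((E'.r : ℕ) : ℝ) ^ (ω - 2) ≤ M := by
    refine le_trans ?_ q2
    gcongr
    linarith
  refine (computes_konst mem 0).bind fun z m₁ l₁ hz => ?_
  refine ((fm.computes_mul hω (m := a + b) (n := n) ra rn' ra rn (hT.mono l₁)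
    (N := U₁.submatrix id E'.J) fun k l => (hU k _).mono l₁).mono q3
    fun _ _ _ h => h).bind fun V m₂ l₂ hV => ?_
  refine ((fm.computes_mulSub hω (m := a + b) (n := n) ra rn' rb rn'
    (K := 0) (fun _ _ => hz.mono l₂) hV (hT₂.mono (l₁.trans l₂))).mono q2
    fun _ _ _ h => h).bind fun T m₃ l₃ hTT => ?_
  refine ((fm.computes_mul hω (m := a + b) (n := n) rb rn rb rn'
    (hS₂.mono (l₁.trans (l₂.trans l₃)))
    (N := G'.submatrix E'.I id) fun k l => (hG _ l).mono (l₁.trans (l₂.trans l₃))).mono q4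
    fun _ _ _ h => h).bind fun W m₄ l₄ hW => ?_
  refine ((fm.computes_mulSub hω (m := a + b) (n := n) rb rn ra rn
    (K := 0) (fun _ _ => hz.mono (l₂.trans (l₃.trans l₄))) hW
    (hS.mono (l₁.trans (l₂.trans (l₃.trans l₄))))).mono q1
    fun _ _ _ h => h).bind fun S m₅ l₅ hSS => ?_
  have l₂₅ := l₂.trans (l₃.trans (l₄.trans l₅))
  have l₁₅ := l₁.trans l₂₅
  refine Computes.pure (by linarith) ⟨⟨_, _, _, _, h₁.merge hG' h₂,
    HoldsMat.blockMat (hC.mono l₁₅) (fun _ _ => hz.mono l₂₅) (hG.mono l₁₅) (hC₂.mono l₁₅),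
    HoldsMat.stack (hU.mono l₁₅) (hU₂.mono l₁₅),
    HoldsMat.blockMat (hS.mono l₁₅) (fun _ _ => hz.mono l₂₅) hSS (hS₂.mono l₁₅),
    HoldsMat.blockMat (hT.mono l₁₅) (hTT.mono (l₄.trans l₅)) (fun _ _ => hz.mono l₂₅)
      (hT₂.mono l₁₅)⟩, rfl⟩

theorem Elim.Valid.rank_eq {m n : ℕ} {E : Elim m n} {A : Matrix (Fin m) (Fin n) F} {mem : List F}
    (h : E.Valid A mem) : A.rank = E.r := by
  obtain ⟨_, _, _, _, h, -⟩ := h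
  exact h.isRankProfileMatrix.2

/-- The constant in the cost of the elimination. -/
noncomputable def elimConst (ω c : ℝ) : ℝ := 6 * (4 * c + 1) / (1 - decay (ω - 2))

theorem one_le_elimConst {ω c : ℝ} (hω : 2 < ω) (hc : 0 ≤ c) : 1 ≤ elimConst ω c := by
  have h1 := decay_lt_one (θ := ω - 2) (by linarith)
  have h2 : 0 ≤ decay (ω - 2) := Real.rpow_nonneg (by norm_num) _
  rw [elimConst, le_div_iff₀ (by linarith)]
  linarith

/-- The ranks of the first rows and of the Schur complement add up to the rank of the whole.
`halving_le` thus bounds the two recursive costs by `decay` times the measure of the node, and the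
term `m n` for the tests is additive in the rows. -/
theorem computes_elimNode (hω : 2 < ω) {a b n : ℕ} (ha : 3 * a ≤ 2 * (a + b))
    (hb : 3 * b ≤ 2 * (a + b)) {f : (Fin a → Fin n → ℕ) → Code F (Elim a n)}
    {g : (Fin b → Fin n → ℕ) → Code F (Elim b n)}
    (hf : ∀ {X : Fin a → Fin n → ℕ} {A : Matrix (Fin a) (Fin n) F} {mem : List F},
      HoldsMat mem X A → Computes (f X) mem
        (a * n + elimConst ω c * (a * n * (A.rank : ℝ) ^ (ω - 2))) fun E mem' => E.Valid A mem')
    (hg : ∀ {X : Fin b → Fin n → ℕ} {A : Matrix (Fin b) (Fin n) F} {mem : List F},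
      HoldsMat mem X A → Computes (g X) mem
        (b * n + elimConst ω c * (b * n * (A.rank : ℝ) ^ (ω - 2))) fun E mem' => E.Valid A mem')
    {X : Fin (a + b) → Fin n → ℕ} {A : Matrix (Fin (a + b)) (Fin n) F} {mem : List F}
    (hX : HoldsMat mem X A) :
    Computes (elimNode fm f g X) mem
      ((a + b : ℕ) * n + elimConst ω c * ((a + b : ℕ) * n * (A.rank : ℝ) ^ (ω - 2)))
      fun E mem' => E.Valid A mem' := by
  have hc := fm.nonneg
  -- Two products at the node and four in the merge, each at most `(4 c + 1) m n r^(ω-2)`; the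
  -- constant solves `K = decay K + 6 (4 c + 1)`.
  have hK : elimConst ω c * (1 - decay (ω - 2)) = 6 * (4 * c + 1) := by
    have h1 := decay_lt_one (θ := ω - 2) (by linarith)
    exact div_mul_cancel₀ _ (by linarith)
  have hK1 := one_le_elimConst hω hc
  obtain ⟨A₁, A₂, rfl⟩ : ∃ A₁ A₂, A = stack (a := a) (b := b) A₁ A₂ :=
    ⟨A.submatrix (Fin.castAdd b) id, A.submatrix (Fin.natAdd a) id, by
      ext i j
      induction i using Fin.addCases <;> simp⟩
  refine (hf (A := A₁) fun i j => by simpa using hX (Fin.castAdd b i) j).bind fun E m₁ l₁ hE => ?_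
  rw [hE.rank_eq]
  obtain ⟨C₁, U₁, S₁, T₁, h₁, hC, hU, hS, hT⟩ := hE
  have hX₂ : HoldsMat mem (fun i => X (Fin.natAdd a i)) A₂ := fun i j => by
    simpa using hX (Fin.natAdd a i) j
  have ra : E.r ≤ a + b := (by simpa using Fintype.card_le_of_injective _ h₁.strictMono.injective :
    E.r ≤ a).trans (Nat.le_add_right _ _)
  have rn : E.r ≤ n := by simpa using Fintype.card_le_of_injective _ h₁.injective
  refine (fm.computes_mul hω (m := a + b) (n := n) (Nat.le_add_left _ _) rn ra rn
    (M := A₂.submatrix id E.J) (fun i k => (hX₂ i _).mono l₁) hT).bind fun G m₂ l₂ hG => ?_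
  refine (fm.computes_mulSub hω (m := a + b) (n := n) (Nat.le_add_left _ _) le_rfl ra rn
    (hX₂.mono (l₁.trans l₂)) hG (hU.mono l₂)).bind fun Y m₃ l₃ hY => ?_
  refine (hg hY).bind fun E' m₄ l₄ hE' => ?_
  rw [hE'.rank_eq]
  have l₂₄ := l₂.trans (l₃.trans l₄)
  obtain ⟨R, mem'', t, he, ht, hR, hr⟩ := computes_elimMerge fm hω h₁ (hC.mono l₂₄) (hU.mono l₂₄)
    (hS.mono l₂₄) (hT.mono l₂₄) (hG.mono (l₃.trans l₄)) rfl hE'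
  refine ⟨R, mem'', t, he, ht.trans ?_, hR⟩
  rw [hR.rank_eq, hr]
  have h3 := halving_le (θ := ω - 2) (by linarith) (a := E.r) (b := E'.r) ha hb
  have p1 : ((E.r : ℕ) : ℝ) ^ (ω - 2) ≤ ((E.r + E'.r : ℕ) : ℝ) ^ (ω - 2) :=
    Real.rpow_le_rpow (by positivity) (by push_cast; linarith [Nat.cast_nonneg (α := ℝ) E'.r])
      (by linarith)
  set x := ((E.r : ℕ) : ℝ) ^ (ω - 2)
  set y := ((E'.r : ℕ) : ℝ) ^ (ω - 2)
  set w := ((E.r + E'.r : ℕ) : ℝ) ^ (ω - 2)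
  set s : ℝ := ((a + b : ℕ) : ℝ) with hs
  have hs' : s = a + b := by rw [hs, Nat.cast_add]
  have hx : 0 ≤ x := Real.rpow_nonneg (by positivity) _
  have q1 : (4 * c + 1) * s * n * x ≤ (4 * c + 1) * s * n * w := by gcongr
  have q2 : 4 * c * s * n * x ≤ (4 * c + 1) * s * n * x := by gcongr; linarith
  have q3 : elimConst ω c * n * (a * x + b * y) ≤
      elimConst ω c * n * (decay (ω - 2) * s * w) := by gcongr
  have q4 : elimConst ω c * n * s * w = elimConst ω c * n * (decay (ω - 2) * s * w) +
      6 * ((4 * c + 1) * s * n * w) := by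
    linear_combination n * s * w * hK
  rw [hs'] at q1 q2 q3 q4 ⊢
  linarith

theorem computes_elim (hω : 2 < ω) {n : ℕ} (t : RowTree) (ht : t.Balanced)
    {X : Fin t.size → Fin n → ℕ} {A : Matrix (Fin t.size) (Fin n) F} {mem : List F}
    (hX : HoldsMat mem X A) :
    Computes (elim fm t X) mem
      (t.size * n + elimConst ω c * (t.size * n * (A.rank : ℝ) ^ (ω - 2)))
      fun E mem' => E.Valid A mem' := by
  induction t generalizing mem with
  | nil => exact Computes.pure (by simp [RowTree.size]) (Elim.empty_valid (by ext i; exact i.elim0) _)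
  | leaf =>
    refine (computes_elimRow hX).mono ?_ fun _ _ _ h => h
    have h1 : A.rank ≤ 1 := A.rank_le_height
    have h2 : A.rank ≤ n := A.rank_le_width
    have hK := one_le_elimConst hω fm.nonneg
    -- A rank of one requires `n ≥ 1`, and then the single division fits into `K n`.
    have key : ∀ s : ℕ, s ≤ 1 → s ≤ n → (n + s : ℝ) ≤
        (1 : ℕ) * n + elimConst ω c * ((1 : ℕ) * n * (s : ℝ) ^ (ω - 2)) := by
      intro s hs hn
      interval_cases s
      · have : 0 ≤ elimConst ω c * (n * (0 : ℝ) ^ (ω - 2)) := by positivity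
        simpa using this
      · have : (1 : ℝ) ≤ n := by exact_mod_cast hn
        simp only [Nat.cast_one, one_mul, Real.one_rpow, mul_one]
        nlinarith
    exact key _ h1 h2
  | node l r hl hr =>
    obtain ⟨h1, h2, h3, h4⟩ := ht
    exact computes_elimNode fm hω h1 h2 (fun hX => hl h3 hX) (fun hX => hr h4 hX) hX

end Elim

section Online

variable {F : Type u} [Field F]

/-! ### Communication of the Prover's program -/

namespace Code

/-- Receive a field element; the result is its address. -/
def recv : Code F ℕ := fun s k => .recv (k s (s + 1))

/-- Send the content of a cell. -/
def send (i : ℕ) : Code F Unit := fun s k => .sendFld i (k () s)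

/-- Send an index. -/
def sendIdx (a : ℕ) : Code F Unit := fun s k => .sendIdx a (k () s)

/-- Send a list of indices. -/
def sendLst (l : List ℕ) : Code F Unit := fun s k => .sendLst l (k () s)

/-- Execute `f (r - 1)`, …, `f 0` in this order, updating a state. -/
def loopDown {S : Type} : (r : ℕ) → (Fin r → S → Code F S) → S → Code F S
  | 0, _, s => pure s
  | r + 1, f, s => do
    let s' ← f (Fin.last r) s
    loopDown r (fun i => f i.castSucc) s'

/-- Execute `f 0`, …, `f (r - 1)` in this order, updating a state. -/
def loopUp {S : Type} : (r : ℕ) → (Fin r → S → Code F S) → S → Code F S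
  | 0, _, s => pure s
  | r + 1, f, s => do
    let s' ← f 0 s
    loopUp r (fun i => f i.succ) s'

/-- The dot product of the vectors found at the given addresses. -/
def dot : (r : ℕ) → (Fin r → ℕ) → (Fin r → ℕ) → Code F ℕ
  | 0, _, _ => konst 0
  | r + 1, X, Y => do
    let p ← arithm .mul (X 0) (Y 0)
    let s ← dot r (fun i => X i.succ) fun i => Y i.succ
    arithm .add p s

/-- The sums of the last coordinates of a vector, from each position on. -/
def suffixSums : (r : ℕ) → (Fin r → ℕ) → Code F (Fin (r + 1) → ℕ)
  | 0, _ => do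
    let z ← konst 0
    pure fun _ => z
  | r + 1, X => do
    let s ← suffixSums r fun i => X i.succ
    let t ← arithm .add (X 0) (s 0)
    pure (Fin.cons t s)

end Code

theorem computes_dot {r : ℕ} {X Y : Fin r → ℕ} {x y : Fin r → F} {mem : List F}
    (hX : ∀ i, Holds mem (X i) (x i)) (hY : ∀ i, Holds mem (Y i) (y i)) :
    Computes (Code.dot r X Y) mem (2 * r) fun a mem' => Holds mem' a (∑ i, x i * y i) := by
  induction r generalizing mem with
  | zero => exact (computes_konst mem 0).mono (by simp) (by simp)
  | succ r ih =>
    refine (computes_arithm .mul (hX 0) (hY 0)).bind fun p m₁ l₁ hp => ?_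
    refine (ih (fun i => (hX i.succ).mono l₁) fun i => (hY i.succ).mono l₁).bind
      fun s m₂ l₂ hs => ?_
    refine (computes_arithm .add (hp.mono l₂) hs).mono (by push_cast; linarith) fun a m₃ _ h => ?_
    rw [Fin.sum_univ_succ]
    exact h

theorem computes_suffixSums {r : ℕ} {X : Fin r → ℕ} {x : Fin r → F} {mem : List F}
    (hX : ∀ i, Holds mem (X i) (x i)) :
    Computes (Code.suffixSums r X) mem r fun S mem' =>
      ∀ j, Holds mem' (S j) (∑ l : Fin r, if (j : ℕ) ≤ l then x l else 0) := by
  induction r generalizing mem with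
  | zero =>
    refine (computes_konst mem 0).bind fun z m₁ l₁ hz => Computes.pure (by simp) fun j => ?_
    simpa using hz
  | succ r ih =>
    refine (ih fun i => (hX i.succ).mono List.prefix_rfl).bind fun s m₁ l₁ hs => ?_
    refine (computes_arithm .add ((hX 0).mono l₁) (hs 0)).bind fun t m₂ l₂ ht => ?_
    refine Computes.pure (by simp) fun j => ?_
    rw [Fin.sum_univ_succ]
    refine Fin.cases ?_ (fun j => ?_) j
    · simpa [ArithOp.eval] using ht
    · simpa using (hs j).mono l₂

/-! ### Joint executions of the Prover's program and the Verifier -/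

variable {m n : ℕ} (P : ProverProg F) (A : Matrix (Fin m) (Fin n) F)

/-- After the exchange `h`, it remains to execute the program `q` from the memory `mem`. -/
def At (h : List (Msg F)) (q : ProverProg F) (mem : List F) : Prop :=
  ∀ h', P.reply (entries A) (h ++ h') = q.reply mem h'

/-- If the Verifier executes `p` with the Prover who runs the program `P` and is about to execute
`x` from the memory `mem`, he accepts for all samples, and the results and the new memory
satisfy `Q`. -/
def Interact {α : Type} {β : Type u} (p : VProg F m n β) (x : Code F α) (mem : List F)
    (Q : α → β → List F → Prop) : Prop :=
  ∀ (k : α → ℕ → ProverProg F) (h : List (Msg F)) (R : β → List (Msg F) → Prop),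
    At P A h (x mem.length k) mem →
    (∀ a b mem' h', mem <+: mem' → Q a b mem' → At P A h' (k a mem'.length) mem' → R b h') →
    Ensures A (P.toProver A) p R h

variable {P A} {α γ : Type} {β δ : Type u} {mem : List F}

namespace Interact

theorem mono {p : VProg F m n β} {x : Code F α} {Q Q' : α → β → List F → Prop}
    (h : Interact P A p x mem Q) (hQ : ∀ a b mem', mem <+: mem' → Q a b mem' → Q' a b mem') :
    Interact P A p x mem Q' :=
  fun k h₀ R hat hR => h k h₀ R hat fun a b mem' h' l hq => hR a b mem' h' l (hQ a b mem' l hq)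

theorem pure {a : α} {b : β} {Q : α → β → List F → Prop} (h : Q a b mem) :
    Interact P A (pure b) (Pure.pure a) mem Q :=
  fun _ _ _ hat hR => hR a b mem _ List.prefix_rfl h hat

theorem bind {p : VProg F m n β} {f : β → VProg F m n δ} {x : Code F α} {g : α → Code F γ}
    {Q : α → β → List F → Prop} {Q' : γ → δ → List F → Prop} (hp : Interact P A p x mem Q)
    (hf : ∀ a b mem', mem <+: mem' → Q a b mem' → Interact P A (f b) (g a) mem' Q') :
    Interact P A (p >>= f) (x >>= g) mem Q' := by
  intro k h R hat hR
  rw [Ensures, interp_bind]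
  exact hp (fun a s => g a s k) h _ hat fun a b m₁ h₁ l₁ hq hat₁ =>
    hf a b m₁ l₁ hq k h₁ R hat₁ fun c d m₂ h₂ l₂ => hR c d m₂ h₂ (l₁.trans l₂)

/-- The Prover computes alone: no message is exchanged, so the history stays in step. -/
theorem compute {p : VProg F m n β} {x : Code F α} {g : α → Code F γ} {t : ℝ}
    {Q : α → List F → Prop} {Q' : γ → β → List F → Prop} (hx : Computes x mem t Q)
    (hg : ∀ a mem', mem <+: mem' → Q a mem' → Interact P A p (g a) mem' Q') :
    Interact P A p (x >>= g) mem Q' := by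
  obtain ⟨a, m₁, t₁, he, -, hq⟩ := hx
  intro k h R hat hR
  refine hg a m₁ he.isPrefix hq k h R (fun h' => ?_)
    fun c d m₂ h₂ l₂ => hR c d m₂ h₂ (he.isPrefix.trans l₂)
  rw [hat h']
  exact he.reply _ h'

/-- The Verifier acts alone with an unpredictable result, such as samples he keeps. -/
theorem verifier {p : VProg F m n β} {f : β → VProg F m n δ} {x : Code F α}
    {Q : α → δ → List F → Prop}
    (hp : ∀ R h, (∀ b, R b h) → Ensures A (P.toProver A) p R h)
    (hf : ∀ b, Interact P A (f b) x mem Q) : Interact P A (p >>= f) x mem Q := by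
  intro k h R hat hR
  rw [Ensures, interp_bind]
  exact hp _ h fun b => hf b k h R hat hR

/-- The Verifier acts alone with the known result `b`. -/
theorem step {p : VProg F m n β} {f : β → VProg F m n δ} {x : Code F α}
    {Q : α → δ → List F → Prop} {b : β}
    (hp : ∀ R h, R b h → Ensures A (P.toProver A) p R h)
    (hf : Interact P A (f b) x mem Q) : Interact P A (p >>= f) x mem Q := by
  intro k h R hat hR
  rw [Ensures, interp_bind]
  exact hp _ h (hf k h R hat hR)

theorem challenge : Interact P A challenge Code.recv mem fun i a mem' => Holds mem' i a := by
  intro k h R hat hR a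
  refine hR mem.length a (mem ++ [a]) _ (List.prefix_append _ _) (holds_length _ _) fun h' => ?_
  rw [List.append_assoc, hat]
  simp [Code.recv, ProverProg.reply]

theorem response {i : ℕ} {v : F} (hi : Holds mem i v) :
    Interact P A response (Code.send i) mem fun _ b mem' => b = v ∧ mem' = mem := by
  intro k h R hat hR
  have e : (P.toProver A).fld h = v := by
    -- The message due now is the reply of the program when nothing follows the exchange `h`.
    have := hat []
    rw [List.append_nil] at this
    simp [ProverProg.toProver, this, Code.send, ProverProg.reply, -List.getD_eq_getElem?_getD,
      hi.getD]
  refine hR () _ mem _ List.prefix_rfl ⟨e, rfl⟩ fun h' => ?_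
  rw [List.append_assoc, hat]
  rfl

theorem recvLst {f : List ℕ → VProg F m n δ} {g : Unit → Code F γ} {l : List ℕ}
    {Q : γ → δ → List F → Prop} (hf : Interact P A (f l) (g ()) mem Q) :
    Interact P A (.recvLst f) (Code.sendLst l >>= g) mem Q := by
  intro k h R hat hR
  have e : (P.toProver A).lst h = l := by
    have := hat []
    rw [List.append_nil] at this
    simp only [ProverProg.toProver, this]
    rfl
  rw [Ensures, interp, e]
  refine hf k _ R (fun h' => ?_) hR
  rw [List.append_assoc, hat]
  rfl

theorem recvIdxs {r : ℕ} {f : (Fin r → ℕ) → VProg F m n δ} {g : (Fin r → Unit) → Code F γ}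
    {q : Fin r → ℕ} {Q : γ → δ → List F → Prop}
    (hf : ∀ a, Interact P A (f q) (g a) mem Q) :
    Interact P A (recvIdxs r f) (Code.tab r (fun i => Code.sendIdx (q i)) >>= g) mem Q := by
  induction r with
  | zero =>
    have := hf Fin.elim0
    rwa [Subsingleton.elim q Fin.elim0] at this
  | succ r ih =>
    intro k h R hat hR
    have e : (P.toProver A).idx h = q 0 := by
      have := hat []
      rw [List.append_nil] at this
      simp only [ProverProg.toProver, this]
      rfl
    rw [RPMCert.recvIdxs, Ensures, interp, e]
    refine ih (q := fun i => q i.succ) (f := fun t => f (Fin.cons (q 0) t))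
      (g := fun t => g (Fin.cons () t)) (fun a => ?_) k _ R (fun h' => ?_) hR
    · have := hf (Fin.cons () a)
      rwa [← Fin.cons_self_tail q] at this
    · rw [List.append_assoc, hat]
      rfl

theorem sendVec {r : ℕ} {v : Fin r → F} :
    Interact P A (sendVec r v) (Code.tab r fun _ => Code.recv) mem
      fun X _ mem' => ∀ i, Holds mem' (X i) (v i) := by
  induction r generalizing mem with
  | zero => exact fun k h R hat hR => hR Fin.elim0 _ mem _ List.prefix_rfl (fun i => i.elim0) hat
  | succ r ih =>
    intro k h R hat hR
    refine ih (v := fun i => v i.succ) (mem := mem ++ [v 0])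
      (fun t s => k (Fin.cons mem.length t) s) _ R (fun h' => ?_) fun X b m₁ h₁ l₁ hX hat₁ =>
        hR _ b m₁ h₁ ((List.prefix_append _ _).trans l₁) (fun i => ?_) hat₁
    · rw [List.append_assoc, hat, List.length_append]
      rfl
    · refine Fin.cases ?_ (fun i => ?_) i
      · exact (holds_length mem (v 0)).mono l₁
      · exact hX i

theorem forUp_response {r : ℕ} {Y : Fin r → ℕ} {y : Fin r → F} (hY : ∀ i, Holds mem (Y i) (y i)) :
    Interact P A (forUp r fun _ => RPMCert.response) (Code.tab r fun i => Code.send (Y i)) mem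
      fun _ b _ => b = y := by
  induction r generalizing mem with
  | zero => exact Interact.pure (Subsingleton.elim _ _)
  | succ r ih =>
    refine (response (hY 0)).bind fun _ b m₁ l₁ hb => ?_
    refine (ih fun i => (hY i.succ).mono l₁).bind fun _ t m₂ l₂ ht => Interact.pure ?_
    rw [hb.1, ht]
    exact Fin.cons_self_tail y

/-- The invariant at stage `j` concerns the rounds with indices at least `j`. The vector `t` has its
full length throughout, with placeholders for the rounds still to come, which avoids vectors of
varying length. -/
theorem forDown {S : Type} {r : ℕ} {f : Fin r → VProg F m n β} {g : Fin r → S → Code F S}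
    {Inv : ℕ → S → (Fin r → β) → List F → Prop}
    (hf : ∀ (j : Fin r) s t mem', mem <+: mem' → Inv (j + 1) s t mem' →
      Interact P A (f j) (g j s) mem' fun s' b mem'' => Inv j s' (Function.update t j b) mem'')
    {s : S} {t : Fin r → β} (h : Inv r s t mem) :
    Interact P A (forDown r f) (Code.loopDown r g s) mem fun s' t' mem' => Inv 0 s' t' mem' := by
  induction r generalizing mem s with
  | zero => exact Interact.pure (by rwa [Subsingleton.elim t Fin.elim0] at h)
  | succ r ih =>
    intro k h₀ R hat hR
    rw [Ensures, interp_forDown_succ]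
    refine hf (Fin.last r) s t mem List.prefix_rfl h _ _ _ hat
      fun s' b m₁ h₁ l₁ hi hat₁ => ?_
    refine ih (f := fun i => f i.castSucc) (g := fun i => g i.castSucc)
      (Inv := fun j s t mem => Inv j s (Fin.snoc (α := fun _ => β) t b) mem)
      (t := fun i => t i.castSucc) (fun j s t m₂ l₂ hj => ?_) ?_ k h₁ _ hat₁
      fun s t m₂ h₂ l₂ => hR _ _ m₂ h₂ (l₁.trans l₂)
    · have := hf j.castSucc s (Fin.snoc (α := fun _ => β) t b) m₂ (l₁.trans l₂) hj
      simpa only [Fin.snoc_update, Fin.val_castSucc] using this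
    · refine (congrArg (fun t => Inv r s' t m₁) ?_).mpr hi
      funext i
      refine Fin.lastCases ?_ (fun i => ?_) i
      · simp
      · simp

theorem forUp {S : Type} {r : ℕ} {f : Fin r → VProg F m n β} {g : Fin r → S → Code F S}
    {Inv : ℕ → S → (Fin r → β) → List F → Prop}
    (hf : ∀ (j : Fin r) s t mem', mem <+: mem' → Inv j s t mem' →
      Interact P A (f j) (g j s) mem' fun s' b mem'' => Inv (j + 1) s' (Function.update t j b) mem'')
    {s : S} {t : Fin r → β} (h : Inv 0 s t mem) :
    Interact P A (forUp r f) (Code.loopUp r g s) mem fun s' t' mem' => Inv r s' t' mem' := by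
  induction r generalizing mem s with
  | zero => exact Interact.pure (by rwa [Subsingleton.elim t Fin.elim0] at h)
  | succ r ih =>
    intro k h₀ R hat hR
    rw [Ensures, interp_forUp_succ]
    refine hf 0 s t mem List.prefix_rfl h _ _ _ hat
      fun s' b m₁ h₁ l₁ hi hat₁ => ?_
    refine ih (f := fun i => f i.succ) (g := fun i => g i.succ)
      (Inv := fun j s t mem => Inv (j + 1) s (Fin.cons (α := fun _ => β) b t) mem)
      (t := fun i => t i.succ) (fun j s t m₂ l₂ hj => ?_) ?_ k h₁ _ hat₁
      fun s t m₂ h₂ l₂ => hR _ _ m₂ h₂ (l₁.trans l₂)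
    · have := hf j.succ s (Fin.cons (α := fun _ => β) b t) m₂ (l₁.trans l₂) hj
      simpa only [Fin.cons_update, Fin.val_succ] using this
    · refine (congrArg (fun t => Inv 1 s' t m₁) ?_).mpr hi
      funext i
      refine Fin.cases ?_ (fun i => ?_) i
      · simp
      · simp

end Interact

theorem ensures_forUp_draw {σ : Prover F} {r : ℕ} {R : (Fin r → F) → List (Msg F) → Prop}
    {h : List (Msg F)} (hR : ∀ b, R b h) : Ensures A σ (forUp r fun _ => draw) R h := by
  induction r with
  | zero => exact hR _
  | succ r ih =>
    rw [Ensures, interp_forUp_succ, interp_draw]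
    exact fun a => ih fun b => hR _

/-! ### Responses to successive challenges -/

/-- In each round, last index first, receive a challenge and answer from the challenges known so
far. -/
def respondDown {r : ℕ} (g : Fin r → (Fin r → ℕ) → Code F ℕ) : Code F (Fin r → ℕ) := do
  let z ← Code.konst 0
  Code.loopDown r (fun j st => do
    let a ← Code.recv
    let y ← g j (Function.update st j a)
    let _ ← Code.send y
    pure (Function.update st j a)) fun _ => z

/-- In each round, first index first, receive a challenge and answer from the challenges known so
far. -/
def respondUp {r : ℕ} (g : Fin r → (Fin r → ℕ) → Code F ℕ) : Code F (Fin r → ℕ) := do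
  let z ← Code.konst 0
  Code.loopUp r (fun j st => do
    let a ← Code.recv
    let y ← g j (Function.update st j a)
    let _ ← Code.send y
    pure (Function.update st j a)) fun _ => z

theorem holds_update {r : ℕ} {st : Fin r → ℕ} {x : Fin r → F} {mem' : List F} {a : ℕ} {v : F}
    {j : Fin r} (hl : mem <+: mem') (h : ∀ l, Holds mem (st l) (x l)) (ha : Holds mem' a v)
    (l : Fin r) :
    Holds mem' (Function.update st j a l) (Function.update x j v l) := by
  by_cases hlj : l = j
  · subst hlj
    simpa using ha
  · simpa [hlj] using (h l).mono hl

/-- By `hY` an answer depends only on the challenges already received. Computed with placeholders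
for the others, it agrees with the value at the final vector. -/
theorem interact_respondDown {r : ℕ} {g : Fin r → (Fin r → ℕ) → Code F ℕ}
    {Y : Fin r → (Fin r → F) → F} {c : ℝ}
    (hg : ∀ j st x mem', mem <+: mem' → (∀ l, Holds mem' (st l) (x l)) →
      Computes (g j st) mem' c fun a mem'' => Holds mem'' a (Y j x))
    (hY : ∀ j x x', (∀ l, j ≤ l → x l = x' l) → Y j x = Y j x') :
    Interact P A (forDown r fun _ => do
        let x ← challenge
        let y ← response
        pure (x, y)) (respondDown g) mem
      fun _ t _ => ∀ j, (t j).2 = Y j fun l => (t l).1 := by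
  refine Interact.compute (computes_konst mem 0) fun z m₁ l₁ hz => ?_
  refine (Interact.forDown (Inv := fun j st t mem' => (∀ l, Holds mem' (st l) (t l).1) ∧
    ∀ l : Fin r, j ≤ l → (t l).2 = Y l fun l' => (t l').1) (t := fun _ => (0, 0))
    (fun j st t m₂ l₂ hi => ?_) ⟨fun _ => hz, fun l hl => absurd l.2 (by omega)⟩).mono
    fun s t m₂ l₂ h j => h.2 j (Nat.zero_le _)
  refine Interact.challenge.bind fun a x m₃ l₃ ha => ?_
  have h₃ : ∀ l, Holds m₃ (Function.update st j a l)
      (Function.update (fun l => (t l).1) j x l) := holds_update l₃ hi.1 ha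
  refine Interact.compute (hg j _ _ m₃ (l₁.trans (l₂.trans l₃)) h₃) fun y m₄ l₄ hy => ?_
  refine (Interact.response hy).bind fun _ b m₅ l₅ hb => Interact.pure ?_
  have e : ∀ b, (fun l => (Function.update t j (x, b) l).1) =
      Function.update (fun l => (t l).1) j x := by
    intro b
    ext l
    by_cases hl : l = j
    · subst hl; simp
    · simp [hl]
  refine ⟨fun l => ?_, fun l hl => ?_⟩
  · have := (h₃ l).mono (l₄.trans l₅)
    rwa [← e b] at this
  · rw [e]
    by_cases hlj : l = j
    · subst hlj
      simpa using hb.1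
    · have hlt : (j : ℕ) < l := lt_of_le_of_ne hl fun h => hlj (Fin.ext h.symm)
      rw [Function.update_of_ne hlj, hi.2 l hlt]
      refine hY l _ _ fun l' hl' => ?_
      rw [Function.update_of_ne]
      rintro rfl
      exact absurd hl' (by simpa using hlt)

theorem interact_respondUp {r : ℕ} {g : Fin r → (Fin r → ℕ) → Code F ℕ}
    {Y : Fin r → (Fin r → F) → F} {c : ℝ}
    (hg : ∀ j st x mem', mem <+: mem' → (∀ l, Holds mem' (st l) (x l)) →
      Computes (g j st) mem' c fun a mem'' => Holds mem'' a (Y j x))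
    (hY : ∀ j x x', (∀ l, l ≤ j → x l = x' l) → Y j x = Y j x') :
    Interact P A (forUp r fun _ => do
        let x ← challenge
        let y ← response
        pure (x, y)) (respondUp g) mem
      fun _ t _ => ∀ j, (t j).2 = Y j fun l => (t l).1 := by
  refine Interact.compute (computes_konst mem 0) fun z m₁ l₁ hz => ?_
  refine (Interact.forUp (Inv := fun j st t mem' => (∀ l, Holds mem' (st l) (t l).1) ∧
    ∀ l : Fin r, (l : ℕ) < j → (t l).2 = Y l fun l' => (t l').1) (t := fun _ => (0, 0))
    (fun j st t m₂ l₂ hi => ?_) ⟨fun _ => hz, fun l hl => absurd hl (by omega)⟩).mono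
    fun s t m₂ l₂ h j => h.2 j j.2
  refine Interact.challenge.bind fun a x m₃ l₃ ha => ?_
  have h₃ : ∀ l, Holds m₃ (Function.update st j a l)
      (Function.update (fun l => (t l).1) j x l) := holds_update l₃ hi.1 ha
  refine Interact.compute (hg j _ _ m₃ (l₁.trans (l₂.trans l₃)) h₃) fun y m₄ l₄ hy => ?_
  refine (Interact.response hy).bind fun _ b m₅ l₅ hb => Interact.pure ?_
  have e : ∀ b, (fun l => (Function.update t j (x, b) l).1) =
      Function.update (fun l => (t l).1) j x := by
    intro b
    ext l
    by_cases hl : l = j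
    · subst hl; simp
    · simp [hl]
  refine ⟨fun l => ?_, fun l hl => ?_⟩
  · have := (h₃ l).mono (l₄.trans l₅)
    rwa [← e b] at this
  · rw [e]
    by_cases hlj : l = j
    · subst hlj
      simpa using hb.1
    · have hlt : (l : ℕ) < j := lt_of_le_of_ne (Nat.le_of_lt_succ hl) fun h => hlj (Fin.ext h)
      rw [Function.update_of_ne hlj, hi.2 l hlt]
      refine hY l _ _ fun l' hl' => ?_
      rw [Function.update_of_ne]
      rintro rfl
      exact absurd hl' (by simpa using hlt)

end Online

section Provers

variable {F : Type u} [Field F] {m n : ℕ}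

/-! ### The honest Prover in the sub-protocols -/

/-- The honest Prover in the certificate of linear independence: `L` holds the inverse of the
submatrix on the rows `ι` and the columns to be certified. -/
def lowerRankProver {r : ℕ} (a : ℕ) (L : Fin r → Fin r → ℕ) (ι : Fin r → Fin a) : Code F Unit := do
  let X ← Code.tab a fun _ => Code.recv
  let Y ← Code.tab r fun j => Code.dot r (L j) fun k => X (ι k)
  let _ ← Code.tab r fun j => Code.send (Y j)
  pure ()

/-- The honest Prover in the certificate of minimality: `R` holds the coefficients of all columns
in terms of the columns `c`. -/
def minimalityProver {b r : ℕ} (c : Fin r → Fin b) (R : Fin r → Fin b → ℕ) : Code F Unit := do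
  let V ← Code.tab b fun _ => Code.recv
  let _ ← respondDown fun j st => do
    let S ← Code.suffixSums r st
    let W ← Code.tab b fun i => Code.arithm .mul (V i)
      (S ⟨segment c i - 1, (Nat.sub_le _ _).trans_lt (segment c i).2⟩)
    Code.dot b (R j) W
  pure ()

/-- The honest Prover in the interactive part of the certificate of an LDUP decomposition. -/
def ldupProver : (r : ℕ) → (U L : Fin r → Fin r → ℕ) → Code F Unit
  | 0, _, _ => pure ()
  | r + 1, U, L => do
    let z ← Code.konst 0
    let _ ← Code.loopDown r (fun i (st : (Fin r → ℕ) × (Fin r → ℕ) × (Fin r → ℕ)) => do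
      let a ← Code.recv
      let b ← Code.recv
      let x ← Code.dot r (fun k => if i ≤ k then U i.castSucc k.succ else z)
        (Function.update st.1 i a)
      let _ ← Code.send x
      let y ← Code.dot r (fun k => if i ≤ k then U i.castSucc k.succ else z)
        (Function.update st.2.1 i b)
      let _ ← Code.send y
      let l ← Code.recv
      let w ← Code.dot r (fun k => if i ≤ k then L k.succ i.castSucc else z)
        (Function.update st.2.2 i l)
      let _ ← Code.send w
      pure (Function.update st.1 i a, Function.update st.2.1 i b, Function.update st.2.2 i l))
      (fun _ => z, fun _ => z, fun _ => z)
    pure ()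

/-- The honest Prover in the certificate for the rank profile matrix of an invertible matrix. -/
def rpmProver {r : ℕ} (p : Fin r → Fin r) (D : Fin r → ℕ) (U L : Fin r → Fin r → ℕ) :
    Code F Unit := do
  let _ ← Code.tab r fun i => Code.sendIdx (p i)
  let _ ← Code.tab r fun i => Code.send (D i)
  let _ ← respondUp fun i st => Code.dot r st fun j => U (p j) (p i)
  let _ ← ldupProver r U L
  pure ()

variable {P : ProverProg F} {A : Matrix (Fin m) (Fin n) F}

variable (P A) in
/-- The procedure `mul` multiplies by `M`. -/
def IsMul {a b : ℕ} (mul : (Fin b → F) → VProg F m n (Fin a → F)) (M : Matrix (Fin a) (Fin b) F) :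
    Prop :=
  ∀ v R h, R (M.mulVec v) h → Ensures A (P.toProver A) (mul v) R h

theorem isMul_timesA : IsMul P A timesA A := fun _ _ _ h => h

theorem isMul_timesAT : IsMul P A timesAT A.transpose := by
  intro v R h hR
  rw [Matrix.mulVec_transpose] at hR
  exact hR

theorem ensures_check {σ : Prover F} {p : Prop} (hp : p) {R : PUnit → List (Msg F) → Prop}
    {h : List (Msg F)} (hR : R PUnit.unit h) : Ensures A σ (check p) R h := by
  rw [Ensures, interp_check, if_pos hp]
  exact hR

theorem ensures_suffixSums {σ : Prover F} {r : ℕ} {x : Fin (r + 1) → F}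
    {R : (Fin (r + 1) → F) → List (Msg F) → Prop} {h : List (Msg F)}
    (hR : R (fun j => ∑ k, if j ≤ k then x k else 0) h) : Ensures A σ (suffixSums r x) R h := by
  rw [Ensures, interp_suffixSums]
  exact hR

theorem ensures_forUp_arith {σ : Prover F} {r : ℕ} {o : ArithOp} {x y : Fin r → F}
    {R : (Fin r → F) → List (Msg F) → Prop} {h : List (Msg F)}
    (hR : R (fun i => o.eval (x i) (y i)) h) :
    Ensures A σ (forUp r fun i => arith o (x i) (y i)) R h := by
  rw [Ensures, interp_forUp_arith]
  exact hR

theorem ensures_dot {σ : Prover F} {r : ℕ} {x y : Fin r → F} {R : F → List (Msg F) → Prop}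
    {h : List (Msg F)} (hR : R (∑ i, x i * y i) h) : Ensures A σ (dot r x y) R h := by
  rw [Ensures, interp_dot]
  exact hR

theorem Interact.check {α : Type} {p : Prop} (hp : p) {a : α} {mem : List F} :
    Interact P A (check p) (Pure.pure a) mem fun _ _ _ => True :=
  fun _ _ _ hat hR => ensures_check hp (hR a _ _ _ List.prefix_rfl trivial hat)

theorem mulVec_extend {a b r : ℕ} (M : Matrix (Fin a) (Fin b) F) {c : Fin r → Fin b}
    (hc : Function.Injective c) (d : Fin r → F) (z : Fin b → F) (i : Fin a) :
    M.mulVec (Function.extend c d z) i = M.mulVec z i + ∑ j, (d j - z (c j)) * M i (c j) := by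
  have := sum_extend hc d z fun k => M i k
  simpa [Matrix.mulVec, dotProduct, mul_comm] using this

variable {a b r : ℕ} {mul : (Fin b → F) → VProg F m n (Fin a → F)} {M : Matrix (Fin a) (Fin b) F}
  {mem : List F}

/-- The coordinates `ι` of the received product are `M_{ι,c} α`, and `L'` recovers `α` from them.
Using only `r` coordinates keeps the cost quadratic in `r`. -/
theorem interact_lowerRank (hmul : IsMul P A mul M) {c : Fin r → Fin b}
    (hc : Function.Injective c) {ι : Fin r → Fin a} {L : Fin r → Fin r → ℕ}
    {L' : Matrix (Fin r) (Fin r) F} (hL : HoldsMat mem L L') (hLM : L' * M.submatrix ι c = 1) :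
    Interact P A (lowerRank mul c) (lowerRankProver a L ι) mem fun _ _ _ => True := by
  refine Interact.verifier (fun R h hR => ensures_forUp_draw hR) fun α => ?_
  refine Interact.step (hmul _) ?_
  refine Interact.sendVec.bind fun X _ m₁ l₁ hX => ?_
  refine Interact.compute (computes_tab (Q := fun j k mem' => Holds mem' k
    (∑ k, L' j k * M.mulVec (Function.extend c α 0) (ι k))) (fun _ _ _ _ hm h => h.mono hm)
    fun j m₂ l₂ => computes_dot (fun k => (hL j k).mono (l₁.trans l₂)) fun k => (hX _).mono l₂)
    fun Y m₂ l₂ hY => ?_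
  refine (Interact.forUp_response hY).bind fun _ β m₃ l₃ hβ => Interact.check ?_
  have e : β = (L' * M.submatrix ι c).mulVec α := by
    rw [hβ, ← Matrix.mulVec_mulVec]
    funext j
    simp only [mulVec_extend M hc, Matrix.mulVec_zero, Pi.zero_apply, zero_add, sub_zero]
    simp only [Matrix.mulVec, dotProduct, Matrix.submatrix_apply, mul_comm (α _)]
  rw [e, hLM, Matrix.one_mulVec]

/-- The honest response is `y = R' z` with `z = Diag(v) W x`, so that `M z = M_c R' z = M_c y`. Row
`j` of `R'` vanishes before `c j`, hence `y j` needs only the challenges received so far. -/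
theorem interact_minimality (hmul : IsMul P A mul M) {c : Fin r → Fin b} (hc : StrictMono c)
    {R : Fin r → Fin b → ℕ} {R' : Matrix (Fin r) (Fin b) F} (hR : HoldsMat mem R R')
    (hM : M = M.submatrix id c * R') (h0 : ∀ j i, i < c j → R' j i = 0) :
    Interact P A (minimality mul c) (minimalityProver c R) mem fun _ _ _ => True := by
  refine Interact.verifier (fun R h hR => ensures_forUp_draw hR) fun v => ?_
  refine Interact.sendVec.bind fun V _ m₁ l₁ hV => ?_
  -- The Prover's vector starts at `x₁`, since `x₀` is never sent; hence `segment c i - 1`. The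
  -- truncation at `segment c i = 0` is harmless, as `R' j i = 0` there.
  refine (interact_respondDown (Y := fun j x => ∑ i, R' j i *
    (v i * ∑ l : Fin r, if (segment c i - 1 : ℕ) ≤ l then x l else 0)) (c := r + (b * 1 + 2 * b))
    (fun j st x m₂ l₂ hst => ?_) fun j x x' hx => ?_).bind fun _ t m₂ l₂ ht => ?_
  · refine (computes_suffixSums hst).bind fun S m₃ l₃ hS => ?_
    rw [add_sub_cancel_left]
    refine (computes_tab (Q := fun i k mem' => Holds mem' k
      (v i * ∑ l : Fin r, if (segment c i - 1 : ℕ) ≤ l then x l else 0))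
      (fun _ _ _ _ hm h => h.mono hm) fun i m₄ l₄ => computes_arithm .mul
        ((hV i).mono (l₂.trans (l₃.trans l₄))) ((hS _).mono l₄)).bind fun W m₄ l₄ hW => ?_
    rw [add_sub_cancel_left]
    exact computes_dot (fun i => (hR j i).mono (l₁.trans (l₂.trans (l₃.trans l₄)))) hW
  · refine Finset.sum_congr rfl fun i _ => ?_
    rcases lt_or_ge i (c j) with hi | hi
    · rw [h0 j i hi, zero_mul, zero_mul]
    · have hj := (lt_segment_iff hc i j).2 hi
      congr 2
      refine Finset.sum_congr rfl fun l _ => ?_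
      split_ifs with hl
      · exact hx l (Fin.le_def.2 (by omega))
      · rfl
  refine Interact.verifier (fun R h hR a => hR a) fun x₀ => ?_
  refine Interact.step (fun _ _ => ensures_suffixSums) ?_
  refine Interact.step (fun _ _ => ensures_forUp_arith) ?_
  refine Interact.step (fun _ _ => ensures_forUp_arith) ?_
  refine Interact.step (hmul _) (Interact.check ?_)
  funext k
  rw [mulVec_extend M hc.injective]
  simp only [ArithOp.eval, sub_sub_cancel_left, Pi.zero_apply]
  set z : Fin b → F := fun i => v i * ∑ k, if segment c i ≤ k then
    (Fin.cons x₀ fun j => (t j).1 : Fin (r + 1) → F) k else 0 with hz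
  have hy : ∀ j, (t j).2 = R'.mulVec z j := by
    intro j
    rw [ht j]
    refine Finset.sum_congr rfl fun i _ => ?_
    change R' j i * _ = R' j i * z i
    rcases lt_or_ge i (c j) with hi | hi
    · rw [h0 j i hi, zero_mul, zero_mul]
    · have hj := (lt_segment_iff hc i j).2 hi
      have hs : ¬ segment c i ≤ 0 := by
        rw [Fin.le_def]
        change ¬ _ ≤ 0
        omega
      rw [hz]
      dsimp only
      rw [Fin.sum_univ_succ, if_neg hs, zero_add]
      congr 2
      refine Finset.sum_congr rfl fun l _ => ?_
      have : (segment c i - 1 : ℕ) ≤ l ↔ segment c i ≤ l.succ := by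
        rw [Fin.le_def, Fin.val_succ]
        omega
      simp only [this, Fin.cons_succ]
  have e : M.mulVec z k = ∑ j, (t j).2 * M k (c j) := by
    conv_lhs => rw [hM, ← Matrix.mulVec_mulVec]
    simp only [Matrix.mulVec, dotProduct, Matrix.submatrix_apply, id, hy]
    exact Finset.sum_congr rfl fun j _ => mul_comm _ _
  rw [e, ← Finset.sum_add_distrib]
  exact Finset.sum_eq_zero fun j _ => by ring

/-- The product of the upper triangular part of a matrix and a vector. -/
def upperMulVec {r : ℕ} (G : Fin r → Fin r → F) (i : Fin r) (x : Fin r → F) : F :=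
  ∑ k, (if i ≤ k then G i k else 0) * x k

theorem upperMulVec_congr {r : ℕ} (G : Fin r → Fin r → F) {i : Fin r} {x x' : Fin r → F}
    (h : ∀ l, i ≤ l → x l = x' l) : upperMulVec G i x = upperMulVec G i x' := by
  refine Finset.sum_congr rfl fun k _ => ?_
  split_ifs with hk
  · rw [h k hk]
  · rw [zero_mul, zero_mul]

theorem proj_update {β γ : Type*} {r : ℕ} (f : β → γ) (t : Fin r → β) (j : Fin r) (b : β) :
    (fun l => f (Function.update t j b l)) = Function.update (fun l => f (t l)) j (f b) := by
  funext l
  by_cases hl : l = j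
  · subst hl
    simp
  · simp [hl]

theorem computes_dot_upper {r : ℕ} {z : ℕ} {U : Fin r → Fin r → ℕ} {G : Fin r → Fin r → F}
    {X : Fin r → ℕ} {x : Fin r → F} {mem : List F} (i : Fin r) (hz : Holds mem z 0)
    (hU : ∀ k, Holds mem (U i k) (G i k)) (hX : ∀ l, Holds mem (X l) (x l)) :
    Computes (Code.dot r (fun k => if i ≤ k then U i k else z) X) mem (2 * r)
      fun a mem' => Holds mem' a (upperMulVec G i x) := by
  refine computes_dot (fun k => ?_) hX
  split_ifs
  · exact hU k
  · exact hz

/-- Since `U` is unit upper triangular, `U φ - φ` at `i` involves only challenges of larger index,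
all known when the response is due; the same holds for `Lᵀ λ - λ`. -/
theorem interact_ldupRounds {U L : Fin r → Fin r → ℕ} {U' L' : Matrix (Fin r) (Fin r) F}
    (hU : HoldsMat mem U U') (hL : HoldsMat mem L L') (hU1 : ∀ k, U' k k = 1)
    (hL1 : ∀ k, L' k k = 1) (hU0 : ∀ i k, k < i → U' i k = 0) (hL0 : ∀ i k, i < k → L' i k = 0) :
    Interact P A (ldupRounds r) (ldupProver r U L) mem fun _ t _ =>
      t.x = U'.mulVec t.φ ∧ t.y = U'.mulVec t.ψ ∧ t.z = L'.transpose.mulVec t.l := by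
  cases r with
  | zero => exact Interact.pure ⟨Subsingleton.elim _ _, Subsingleton.elim _ _, Subsingleton.elim _ _⟩
  | succ r =>
  refine Interact.compute (computes_konst mem 0) fun z m₁ l₁ hz => ?_
  -- In round `i` the challenge has index `i.succ` and the response index `i.castSucc`, so the
  -- strictly upper part of `U` becomes the upper part of `G`, diagonal included.
  let G : Fin r → Fin r → F := fun i k => U' i.castSucc k.succ
  let H : Fin r → Fin r → F := fun i k => L' k.succ i.castSucc
  have key : Interact P A (forDown r fun _ => ldupRound) (Code.loopDown r _ _) m₁ _ :=
    Interact.forDown (β := F × F × F × F × F × F)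
    (S := (Fin r → ℕ) × (Fin r → ℕ) × (Fin r → ℕ)) (r := r)
    (f := fun _ => ldupRound) (g := fun i st => do
      let a ← Code.recv
      let b ← Code.recv
      let x ← Code.dot r (fun k => if i ≤ k then U i.castSucc k.succ else z)
        (Function.update st.1 i a)
      let _ ← Code.send x
      let y ← Code.dot r (fun k => if i ≤ k then U i.castSucc k.succ else z)
        (Function.update st.2.1 i b)
      let _ ← Code.send y
      let l ← Code.recv
      let w ← Code.dot r (fun k => if i ≤ k then L k.succ i.castSucc else z)
        (Function.update st.2.2 i l)
      let _ ← Code.send w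
      pure (Function.update st.1 i a, Function.update st.2.1 i b, Function.update st.2.2 i l))
    (Inv := fun j st t mem' =>
      (∀ l, Holds mem' (st.1 l) (t l).1) ∧ (∀ l, Holds mem' (st.2.1 l) (t l).2.1) ∧
      (∀ l, Holds mem' (st.2.2 l) (t l).2.2.2.2.1) ∧ ∀ l : Fin r, j ≤ l →
        (t l).2.2.1 = upperMulVec G l (fun l => (t l).1) ∧
        (t l).2.2.2.1 = upperMulVec G l (fun l => (t l).2.1) ∧
        (t l).2.2.2.2.2 = upperMulVec H l fun l => (t l).2.2.2.2.1)
    (t := fun _ => (0, 0, 0, 0, 0, 0)) (s := (fun _ => z, fun _ => z, fun _ => z))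
    (fun j st t m₂ l₂ hi => by
      obtain ⟨hi1, hi2, hi3, hi4⟩ := hi
      refine Interact.challenge.bind fun a φ m₃ l₃ ha => ?_
      refine Interact.challenge.bind fun b ψ m₄ l₄ hb => ?_
      refine Interact.compute (computes_dot_upper (G := G) (U := fun i k => U i.castSucc k.succ) j
        (hz.mono (l₂.trans (l₃.trans l₄)))
        (fun k => (hU _ _).mono (l₁.trans (l₂.trans (l₃.trans l₄))))
        (holds_update (l₃.trans l₄) hi1 (ha.mono l₄))) fun x m₅ l₅ hx => ?_
      refine (Interact.response hx).bind fun _ x' m₆ l₆ hx' => ?_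
      have l₂₆ := l₃.trans (l₄.trans (l₅.trans l₆))
      refine Interact.compute (computes_dot_upper (G := G) (U := fun i k => U i.castSucc k.succ) j
        (hz.mono (l₂.trans l₂₆)) (fun k => (hU _ _).mono (l₁.trans (l₂.trans l₂₆)))
        (holds_update l₂₆ hi2 (hb.mono (l₅.trans l₆)))) fun y m₇ l₇ hy => ?_
      refine (Interact.response hy).bind fun _ y' m₈ l₈ hy' => ?_
      refine Interact.challenge.bind fun c l m₉ l₉ hc => ?_
      have l₂₉ := l₂₆.trans (l₇.trans (l₈.trans l₉))
      have l₄₉ := l₅.trans (l₆.trans (l₇.trans (l₈.trans l₉)))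
      refine Interact.compute (computes_dot_upper (G := H) (U := fun i k => L k.succ i.castSucc) j
        (hz.mono (l₂.trans l₂₉)) (fun k => (hL _ _).mono (l₁.trans (l₂.trans l₂₉)))
        (holds_update l₂₉ hi3 hc)) fun w m₁₀ l₁₀ hw => ?_
      refine (Interact.response hw).bind fun _ w' m₁₁ l₁₁ hw' => Interact.pure ?_
      have l' := l₁₀.trans l₁₁
      have e1 := proj_update (fun q : F × F × F × F × F × F => q.1) t j (φ, ψ, x', y', l, w')
      have e2 := proj_update (fun q : F × F × F × F × F × F => q.2.1) t j (φ, ψ, x', y', l, w')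
      have e3 := proj_update (fun q : F × F × F × F × F × F => q.2.2.2.2.1) t j
        (φ, ψ, x', y', l, w')
      dsimp only at e1 e2 e3
      refine ⟨fun i => ?_, fun i => ?_, fun i => ?_, fun i hi => ?_⟩
      · rw [congrFun e1 i]
        exact holds_update (l₂₉.trans l') hi1 (ha.mono (l₄.trans (l₄₉.trans l'))) i
      · rw [congrFun e2 i]
        exact holds_update (l₂₉.trans l') hi2 (hb.mono (l₄₉.trans l')) i
      · rw [congrFun e3 i]
        exact holds_update (l₂₉.trans l') hi3 (hc.mono l') i
      · rw [e1, e2, e3]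
        by_cases hij : i = j
        · subst hij
          simp only [Function.update_self]
          exact ⟨hx'.1, hy'.1, hw'.1⟩
        · have hlt : (j : ℕ) < i := lt_of_le_of_ne hi fun h => hij (Fin.ext h.symm)
          have hup : ∀ (x : Fin r → F) (a : F) (l : Fin r), i ≤ l →
              x l = Function.update x j a l := by
            intro x a l hl
            rw [Function.update_of_ne]
            rintro rfl
            exact absurd (Fin.le_def.1 hl) (by omega)
          rw [Function.update_of_ne hij]
          obtain ⟨g1, g2, g3⟩ := hi4 i hlt
          exact ⟨g1.trans (upperMulVec_congr G (hup _ _)), g2.trans (upperMulVec_congr G (hup _ _)),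
            g3.trans (upperMulVec_congr H (hup _ _))⟩)
    ⟨fun _ => hz, fun _ => hz, fun _ => hz, fun l hl => absurd l.2 (by omega)⟩
  -- Splits `V φ` into the unit diagonal, which the Verifier adds himself, and the strictly upper
  -- part, which is sent and ends with a zero.
  have fin : ∀ (V : Matrix (Fin (r + 1)) (Fin (r + 1)) F), (∀ k, V k k = 1) →
      (∀ i k, k < i → V i k = 0) → ∀ (φ₁ : F) (φ x : Fin r → F),
      (∀ l, x l = upperMulVec (fun i k => V i.castSucc k.succ) l φ) →
      (fun k => (Fin.cons φ₁ φ : Fin (r + 1) → F) k +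
        (Fin.snoc (α := fun _ => F) x 0 : Fin (r + 1) → F) k) = V.mulVec (Fin.cons φ₁ φ) := by
    intro V h1 h0 φ₁ φ x hx
    have e : ∀ k j, V k j * (Fin.cons φ₁ φ : Fin (r + 1) → F) j =
        (if k = j then (Fin.cons φ₁ φ : Fin (r + 1) → F) j else 0) +
          if k < j then V k j * (Fin.cons φ₁ φ : Fin (r + 1) → F) j else 0 := by
      intro k j
      rcases lt_trichotomy k j with h | rfl | h
      · simp [h, h.ne]
      · simp [h1]
      · simp [h0 k j h, h.ne']
    funext k
    have e' : V.mulVec (Fin.cons φ₁ φ) k = ∑ j, V k j * (Fin.cons φ₁ φ : Fin (r + 1) → F) j := rfl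
    rw [e', Finset.sum_congr rfl fun j _ => e k j, Finset.sum_add_distrib, Finset.sum_ite_eq,
      if_pos (Finset.mem_univ k), Fin.sum_univ_succ, if_neg (by simp), zero_add]
    congr 1
    induction k using Fin.lastCases with
    | last =>
      rw [Fin.snoc_last]
      refine (Finset.sum_eq_zero fun i _ => if_neg ?_).symm
      exact (Fin.le_last _).not_gt
    | cast l =>
      rw [Fin.snoc_castSucc, hx l]
      refine Finset.sum_congr rfl fun i _ => ?_
      have h : l.castSucc < i.succ ↔ l ≤ i := Fin.castSucc_lt_succ_iff
      simp only [h, ite_mul, zero_mul]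
      rfl
  intro k h R hat hR
  rw [Ensures, interp_ldupRounds_succ]
  refine key (fun _ s => k () s) h _ hat fun s t m₂ h₂ l₂ hi hat₂ φ₁ ψ₁ ν₁ => ?_
  refine hR () _ m₂ h₂ l₂ ⟨?_, ?_, ?_⟩ hat₂
  · exact fin U' hU1 hU0 _ _ _ fun l => (hi.2.2.2 l (Nat.zero_le _)).1
  · exact fin U' hU1 hU0 _ _ _ fun l => (hi.2.2.2 l (Nat.zero_le _)).2.1
  · exact fin L'.transpose (fun k => hL1 k) (fun i k h => hL0 k i h) _ _ _
      fun l => (hi.2.2.2 l (Nat.zero_le _)).2.2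

/-- The answer `f = (Pᵀ U P)ᵀ e` needs at round `i` only `e j` with `j ≤ i`, by triangularity. With
`x = U φ`, `y = U ψ`, `z = Lᵀ λ` the tests become identities for `B = L D U P`. -/
theorem interact_rpmInvertible {I : Fin r → Fin m} {J : Fin r → Fin n}
    (hI : Function.Injective I) {p : Equiv.Perm (Fin r)} {D : Fin r → ℕ} {D' : Fin r → F}
    (hD : ∀ i, Holds mem (D i) (D' i)) (hD0 : ∀ i, D' i ≠ 0)
    {U L : Fin r → Fin r → ℕ} {U' L' : Matrix (Fin r) (Fin r) F}
    (hU : HoldsMat mem U U') (hL : HoldsMat mem L L') (hU1 : ∀ k, U' k k = 1)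
    (hL1 : ∀ k, L' k k = 1) (hU0 : ∀ i k, k < i → U' i k = 0) (hL0 : ∀ i k, i < k → L' i k = 0)
    (hUp : ∀ i j, i < j → U' (p j) (p i) = 0)
    (hB : ∀ i j, A (I i) (J j) = ∑ k, L' i k * D' k * U' k (p j)) :
    Interact P A (rpmInvertible I J) (rpmProver p D U L) mem
      fun _ R _ => R = unitColumns F I * unitColumns F p * (unitColumns F J).transpose := by
  refine Interact.recvIdxs (q := fun i => (p i : ℕ)) fun _ => ?_
  have ep : ∀ K : (Fin r → Fin r) → VProg F m n (Matrix (Fin m) (Fin n) F),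
      withPermutation (fun i => (p i : ℕ)) K = K p := fun K => by
    rw [withPermutation, dif_pos ⟨fun i j h => p.injective (Fin.ext h), fun j => (p j).2⟩]
  rw [ep]
  refine (Interact.forUp_response hD).bind fun _ d m₁ l₁ hd => ?_
  subst hd
  refine Interact.step (fun R h hR => ensures_check hD0 hR) ?_
  refine (interact_respondUp (Y := fun i x => ∑ j, x j * U' (p j) (p i)) (c := 2 * r)
    (fun i st x m₂ l₂ hx => computes_dot hx fun j => (hU _ _).mono (l₁.trans l₂))
    fun i x x' hx => ?_).bind fun _ ef m₂ l₂ hef => ?_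
  · refine Finset.sum_congr rfl fun j _ => ?_
    rcases lt_or_ge i j with hij | hij
    · rw [hUp i j hij, mul_zero, mul_zero]
    · rw [hx j hij]
  refine (interact_ldupRounds (hU.mono (l₁.trans l₂)) (hL.mono (l₁.trans l₂)) hU1 hL1 hU0
    hL0).bind fun _ t m₃ l₃ ht => ?_
  obtain ⟨hx, hy, hz⟩ := ht
  refine Interact.step (fun R h hR => hR) ?_
  refine Interact.step (fun _ _ => ensures_forUp_arith) ?_
  simp only [ArithOp.eval]
  have e1 : ∀ φ : Fin r → F, ∑ i, t.z i * d i * U'.mulVec φ i =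
      ∑ j, A.vecMul (Function.extend I t.l 0) (J j) * φ (p j) := by
    intro φ
    simp only [vecMul_extend hI, hB, hz, Matrix.mulVec, dotProduct, Matrix.transpose_apply,
      Finset.mul_sum, Finset.sum_mul]
    rw [Finset.sum_comm]
    rw [← Equiv.sum_comp p]
    refine Finset.sum_congr rfl fun j _ => ?_
    rw [Finset.sum_comm]
    refine Finset.sum_congr rfl fun i _ => Finset.sum_congr rfl fun k _ => ?_
    ring
  refine Interact.step (fun _ _ => ensures_dot) ?_
  refine Interact.step (fun _ _ => ensures_dot) ?_
  refine Interact.step (fun R h hR => ensures_check (by rw [hx]; exact e1 _) hR) ?_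
  refine Interact.step (fun _ _ => ensures_dot) ?_
  refine Interact.step (fun _ _ => ensures_dot) ?_
  refine Interact.step (fun R h hR => ensures_check (by rw [hy]; exact e1 _) hR) ?_
  refine Interact.step (fun _ _ => ensures_dot) ?_
  refine Interact.step (fun _ _ => ensures_dot) ?_
  refine Interact.step (fun R h hR => ensures_check ?_ hR) (Interact.pure rfl)
  simp only [hx, hef, Matrix.mulVec, dotProduct, Finset.sum_mul, Finset.mul_sum]
  rw [Finset.sum_comm' (s := Finset.univ) (t := fun _ => Finset.univ) (t' := Finset.univ)
    (s' := fun _ => Finset.univ) (by simp), ← Equiv.sum_comp p]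
  exact Finset.sum_congr rfl fun i _ => Finset.sum_congr rfl fun j _ => by ring

end Provers

section Honest

variable {F : Type u} [Field F] {m n : ℕ}

/-! ### The honest Prover -/

/-- Let `U` be in row echelon form up to the order of its rows, with pivots in the columns `J` below
which its entries are zero. Then the coefficients of the columns of `U` in terms of the pivot
columns have the same zeros as `U` in front of the pivots. -/
theorem coeff_eq_zero_of_lt {r : ℕ} {U R : Matrix (Fin r) (Fin n) F} {J : Fin r → Fin n}
    (hUR : U = U.submatrix id J * R) (h0 : ∀ k j, j < J k → U k j = 0) (h1 : ∀ k, U k (J k) ≠ 0)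
    (hc : ∀ k k', k' < k → U k (J k') = 0) (k : Fin r) (j : Fin n) : j < J k → R k j = 0 := by
  -- Descending induction on `k`. In `U k j = ∑ U k (J k') R k' j`, the terms with `k' < k` are
  -- cleared. For `k' > k`, either `j < J k'` and the induction applies, or `J k' ≤ j < J k` and `U`
  -- vanishes there.
  refine WellFounded.induction (r := fun a b : Fin r => a > b) wellFounded_gt
    (C := fun k => j < J k → R k j = 0) k fun k ih hj => ?_
  have e : U k j = ∑ k', U k (J k') * R k' j := congrFun₂ hUR k j
  rw [h0 k j hj, Finset.sum_eq_single k] at e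
  · exact (mul_eq_zero.1 e.symm).resolve_left (h1 k)
  · intro k' _ hk
    rcases lt_or_gt_of_ne hk with h | h
    · rw [hc k k' h, zero_mul]
    · rcases lt_or_ge j (J k') with hj' | hj'
      · rw [ih k' h hj', mul_zero]
      · rw [h0 k _ (hj'.trans_lt hj), zero_mul]
  · exact fun h => absurd (Finset.mem_univ k) h

namespace IsElim

variable {r : ℕ} {A : Matrix (Fin m) (Fin n) F} {I : Fin r → Fin m} {J : Fin r → Fin n}
  {C : Matrix (Fin m) (Fin r) F} {U : Matrix (Fin r) (Fin n) F} {S T : Matrix (Fin r) (Fin r) F}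

theorem inv_mul (h : IsElim A I J C U S T) : T * S * A.submatrix I J = 1 := by
  have e : A.submatrix I J = C.submatrix I id * U.submatrix id J := by
    rw [h.eq_mul]
    ext i j
    simp [Matrix.mul_apply]
  rw [e, Matrix.mul_assoc, ← Matrix.mul_assoc S, h.S_mul, Matrix.one_mul, h.T_mul]

theorem inv_mul_perm (h : IsElim A I J C U S T) (p : Equiv.Perm (Fin r)) :
    (T * S).submatrix p id * A.submatrix I (J ∘ p) = 1 := by
  have e : (T * S).submatrix p id * A.submatrix I (J ∘ p) =
      (T * S * A.submatrix I J).submatrix p p := by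
    ext i j
    simp [Matrix.mul_apply]
  rw [e, h.inv_mul, Matrix.submatrix_one_equiv]

theorem transpose_inv_mul (h : IsElim A I J C U S T) :
    (T * S).transpose * A.transpose.submatrix J I = 1 := by
  have := mul_eq_one_comm.1 h.inv_mul
  rw [← Matrix.transpose_submatrix, ← Matrix.transpose_mul, this, Matrix.transpose_one]

/-- `T * U` expresses all columns in terms of the pivot columns; sorting these permutes its rows. -/
theorem columns (h : IsElim A I J C U S T) (p : Equiv.Perm (Fin r)) :
    A = A.submatrix id (J ∘ p) * (T * U).submatrix p id := by
  have e : A.submatrix id (J ∘ p) * (T * U).submatrix p id = A.submatrix id J * (T * U) := by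
    ext i j
    rw [Matrix.mul_apply, Matrix.mul_apply (M := A.submatrix id J)]
    exact Equiv.sum_comp p fun k => A i (J k) * (T * U) k j
  have e' : A.submatrix id J = C * U.submatrix id J := by
    conv_lhs => rw [h.eq_mul]
    ext i j
    simp [Matrix.mul_apply]
  rw [e, e', Matrix.mul_assoc, ← Matrix.mul_assoc _ T, mul_eq_one_comm.1 h.T_mul,
    Matrix.one_mul, ← h.eq_mul]

theorem columns_zero (h : IsElim A I J C U S T) (k : Fin r) (j : Fin n) (hj : j < J k) :
    (T * U) k j = 0 := by
  refine coeff_eq_zero_of_lt ?_ h.U_zero h.U_ne h.U_cleared k j hj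
  rw [← Matrix.mul_assoc, mul_eq_one_comm.1 h.T_mul, Matrix.one_mul]

theorem rows (h : IsElim A I J C U S T) :
    A.transpose = A.transpose.submatrix id I * (C * S).transpose := by
  have e : A.submatrix I id = C.submatrix I id * U := by
    conv_lhs => rw [h.eq_mul]
    ext i j
    simp [Matrix.mul_apply]
  have : A = C * S * A.submatrix I id := by
    rw [e, Matrix.mul_assoc, ← Matrix.mul_assoc S, h.S_mul, Matrix.one_mul, ← h.eq_mul]
  conv_lhs => rw [this, Matrix.transpose_mul]
  rfl

/-- The transpose of `C` is an echelon form with sorted pivots, so the same argument as for the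
columns applies. -/
theorem rows_zero (h : IsElim A I J C U S T) (k : Fin r) (i : Fin m) (hi : i < I k) :
    (C * S).transpose k i = 0 := by
  refine coeff_eq_zero_of_lt (U := C.transpose) ?_ (fun k i hi => h.C_zero i k hi)
    (fun k => ?_) (fun k k' hk => h.C_zero _ _ (h.strictMono hk)) k i hi
  · have : C.transpose.submatrix id I = (C.submatrix I id).transpose := rfl
    rw [this, ← Matrix.transpose_mul, Matrix.mul_assoc, h.S_mul, Matrix.mul_one]
  · rw [Matrix.transpose_apply, h.C_one]
    exact one_ne_zero

end IsElim

/-- The addresses of what the honest Prover computes in advance: an elimination, the inverse of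
the submatrix on the pivots, the coefficients of the columns and rows in terms of the pivot columns
and rows, and the pivot columns of `U` divided by the pivots. -/
structure Preparation (m n : ℕ) extends Elim m n where
  N : Fin r → Fin r → ℕ
  R : Fin r → Fin n → ℕ
  Q : Fin m → Fin r → ℕ
  V : Fin r → Fin r → ℕ

/-- The memory holds a preparation for `A`. -/
def Preparation.Valid (O : Preparation m n) (A : Matrix (Fin m) (Fin n) F) (mem : List F) : Prop :=
  ∃ C U S T, IsElim A O.I O.J C U S T ∧ HoldsMat mem O.C C ∧ HoldsMat mem O.U U ∧
    HoldsMat mem O.N (T * S) ∧ HoldsMat mem O.R (T * U) ∧ HoldsMat mem O.Q (C * S) ∧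
    HoldsMat mem O.V (Matrix.of fun k l => U k (O.J l) / U k (O.J k))

section Prepare

variable {ω c : ℝ} (fm : FastMul F ω c)

/-- What the honest Prover computes in advance. -/
def prepare (t : RowTree) (n : ℕ) : Code F (Preparation t.size n) := do
  let E ← elim fm t fun i j => i * n + j
  let N ← fm.mul E.T E.S
  let R ← fm.mul E.T E.U
  let Q ← fm.mul E.C E.S
  let V ← Code.tab E.r fun k => Code.tab E.r fun l =>
    Code.arithm .div (E.U k (E.J l)) (E.U k (E.J k))
  pure ⟨E, N, R, Q, V⟩

theorem holdsMat_entries (A : Matrix (Fin m) (Fin n) F) :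
    HoldsMat (entries A) (fun i j => (i : ℕ) * n + j) A := by
  intro i j
  have hlt : (i : ℕ) * n + j < m * n := by
    calc (i : ℕ) * n + j < i * n + n := by omega
      _ = (i + 1) * n := by ring
      _ ≤ m * n := Nat.mul_le_mul_right _ i.2
  have hn : 0 < n := by omega
  rw [Holds, entries, List.getElem?_ofFn, dif_pos hlt]
  congr 2
  · ext
    simp only [Fin.coe_divNat]
    rw [Nat.mul_comm, Nat.mul_add_div hn, Nat.div_eq_of_lt j.2, add_zero]
  · ext
    simp only [Fin.coe_modNat]
    rw [Nat.mul_comm, Nat.mul_add_mod, Nat.mod_eq_of_lt j.2]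

/-- Beyond the elimination, three products at `4 c` each account for `12 c`, and the `r²` divisions
for the additional `1`. -/
theorem computes_prepare (hω : 2 < ω) {t : RowTree} (ht : t.Balanced)
    (A : Matrix (Fin t.size) (Fin n) F) :
    Computes (prepare fm t n) (entries A)
      (t.size * n * (1 + (elimConst ω c + 12 * c + 1) * (A.rank : ℝ) ^ (ω - 2)))
      fun O mem => O.Valid A mem := by
  refine (computes_elim fm hω t ht (holdsMat_entries A)).bind fun E m₁ l₁ hE => ?_
  rw [hE.rank_eq]
  obtain ⟨C, U, S, T, h, hC, hU, hS, hT⟩ := hE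
  have rm : E.r ≤ t.size := by simpa using Fintype.card_le_of_injective _ h.strictMono.injective
  have rn : E.r ≤ n := by simpa using Fintype.card_le_of_injective _ h.injective
  refine (fm.computes_mul hω rm rn rm rn hT hS).bind fun N m₂ l₂ hN => ?_
  refine (fm.computes_mul hω rm le_rfl rm rn (hT.mono l₂) (hU.mono l₂)).bind fun R m₃ l₃ hR => ?_
  refine (fm.computes_mul hω le_rfl rn rm rn (hC.mono (l₂.trans l₃))
    (hS.mono (l₂.trans l₃))).bind fun Q m₄ l₄ hQ => ?_
  have l₂₄ := l₂.trans (l₃.trans l₄)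
  refine (computes_tab_mat (t := 1) (M := Matrix.of fun k l => U k (E.J l) / U k (E.J k))
    fun k l mem' hm => computes_arithm .div ((hU k _).mono (l₂₄.trans hm))
      ((hU k _).mono (l₂₄.trans hm))).bind fun V m₅ l₅ hV => ?_
  refine Computes.pure ?_ ⟨C, U, S, T, h, hC.mono (l₂₄.trans l₅), hU.mono (l₂₄.trans l₅),
    hN.mono (l₃.trans (l₄.trans l₅)), hR.mono (l₄.trans l₅), hQ.mono l₅, hV⟩
  have key : (E.r : ℝ) * (E.r * 1) ≤ t.size * n * (E.r : ℝ) ^ (ω - 2) := by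
    rcases Nat.eq_zero_or_pos E.r with h0 | h0
    · rw [h0]
      simp only [Nat.cast_zero, zero_mul]
      positivity
    · have h1 : (1 : ℝ) ≤ (E.r : ℝ) ^ (ω - 2) :=
        Real.one_le_rpow (by exact_mod_cast h0) (by linarith)
      calc (E.r : ℝ) * (E.r * 1) ≤ t.size * (n * 1) := by gcongr
        _ = t.size * n * 1 := by ring
        _ ≤ _ := by gcongr
  linarith

end Prepare

/-- The order of the pivot columns. -/
def Elim.perm (E : Elim m n) : Equiv.Perm (Fin E.r) := Tuple.sort E.J

/-- The honest Prover, once her computations in advance are done. -/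
def online : Bool → Preparation m n → Code F Unit
  | true, O => do
    let _ ← Code.sendLst (List.ofFn fun i => (O.I i : ℕ))
    let _ ← lowerRankProver n (fun k j => O.N j k) O.J
    let _ ← minimalityProver O.I fun k i => O.Q i k
    let _ ← Code.tab O.r fun j => Code.sendIdx (O.J (O.perm j))
    let _ ← minimalityProver (O.J ∘ O.perm) fun k j => O.R (O.perm k) j
    rpmProver O.perm (fun k => O.U k (O.J k)) O.V fun k l => O.C (O.I k) l
  | false, O => do
    let _ ← Code.sendLst (List.ofFn fun j => (O.J (O.perm j) : ℕ))
    let _ ← lowerRankProver m (fun j k => O.N (O.perm j) k) O.I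
    let _ ← minimalityProver (O.J ∘ O.perm) fun k j => O.R (O.perm k) j
    let _ ← Code.tab O.r fun i => Code.sendIdx (O.I i)
    let _ ← minimalityProver O.I fun k i => O.Q i k
    rpmProver O.perm (fun k => O.U k (O.J k)) O.V fun k l => O.C (O.I k) l

/-- The length of the received list equals `r` only propositionally; the equality of dependent pairs
transports length and entries together. -/
theorem apply_ofFn {β : Sort*} {r : ℕ} (K : ∀ r, (Fin r → ℕ) → β) (q : Fin r → ℕ) :
    K (List.ofFn q).length (List.ofFn q).get = K r q :=
  congrArg (fun s : Σ r, Fin r → ℕ => K s.1 s.2) (List.equivSigmaTuple.apply_symm_apply ⟨r, q⟩)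

theorem withIncreasing_of_strictMono {β : Type u} {r b : ℕ} {c : Fin r → Fin b} (hc : StrictMono c)
    (K : (Fin r → Fin b) → VProg F m n β) : withIncreasing b (fun j => (c j : ℕ)) K = K c := by
  rw [withIncreasing, dif_pos ⟨fun i j h => hc h, fun j => (c j).2⟩]

variable {P : ProverProg F} {A : Matrix (Fin m) (Fin n) F} {mem : List F}

/-- The decomposition of the pivot submatrix is `L = C_I`, `D` the pivots of `U`, and the pivot
columns of `U` divided by `D`. These are unit upper triangular because entries below the pivots are
cleared. -/
theorem interact_online (rowsFirst : Bool) {O : Preparation m n} (hO : O.Valid A mem) :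
    Interact P A (rpmVerifier F m n rowsFirst) (online rowsFirst O) mem
      fun _ R _ => IsRankProfileMatrix A R := by
  obtain ⟨C, U, S, T, h, hC, hU, hN, hR, hQ, hV⟩ := hO
  have hJ : StrictMono (O.J ∘ O.perm) :=
    (Tuple.monotone_sort O.J).strictMono_of_injective (h.injective.comp O.perm.injective)
  have fin : ∀ m₁, mem <+: m₁ → Interact P A (rpmInvertible O.I (O.J ∘ O.perm))
      (rpmProver O.perm (fun k => O.U k (O.J k)) O.V fun k l => O.C (O.I k) l) m₁
      fun _ R _ => IsRankProfileMatrix A R := by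
    intro m₁ l₁
    refine (interact_rpmInvertible h.strictMono.injective (p := O.perm)
      (D' := fun k => U k (O.J k)) (L' := C.submatrix O.I id) (fun k => (hU k _).mono l₁) h.U_ne
      (hV.mono l₁) (fun k l => (hC _ l).mono l₁) (fun k => div_self (h.U_ne k)) h.C_one
      (fun i k hk => ?_) (fun i k hk => h.C_zero _ _ (h.strictMono hk)) (fun i j hij => ?_)
      fun i j => ?_).mono fun _ R _ _ hR => ?_
    · simp [h.U_cleared i k hk]
    -- The sorting permutation makes `Pᵀ U P` upper triangular: a smaller sorted column lies in
    -- front of the pivot of row `O.perm j`.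
    · have e : U (O.perm j) (O.J (O.perm i)) = 0 := h.U_zero _ _ (hJ hij)
      simp [e]
    · conv_lhs => rw [h.eq_mul]
      rw [Matrix.mul_apply]
      refine Finset.sum_congr rfl fun k _ => ?_
      simp only [Matrix.submatrix_apply, id, Matrix.of_apply, Function.comp_apply]
      rw [mul_assoc, mul_div_cancel₀ _ (h.U_ne k)]
    · rw [hR, unitColumns_mul_perm, Function.comp_assoc, Equiv.self_comp_symm,
        Function.comp_id]
      exact h.isRankProfileMatrix.1
  have hR' : HoldsMat mem (fun k j => O.R (O.perm k) j) ((T * U).submatrix O.perm id) :=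
    fun k j => hR _ _
  have hQ' : HoldsMat mem (fun k i => O.Q i k) (C * S).transpose := fun k i => hQ _ _
  have eJ : (fun j => (O.J (O.perm j) : ℕ)) = fun j => ((O.J ∘ O.perm) j : ℕ) := rfl
  cases rowsFirst with
  | true =>
    refine Interact.recvLst ((congrArg (fun p => Interact P A p _ mem _) (apply_ofFn (fun r q =>
      withIncreasing m q fun I => do
        lowerRank timesAT I
        minimality timesAT I
        recvIdxs r fun j => withIncreasing n j fun J => do
          minimality timesA J
          rpmInvertible I J) _)).mpr ?_)
    rw [withIncreasing_of_strictMono h.strictMono]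
    refine (interact_lowerRank isMul_timesAT h.strictMono.injective
      (L' := (T * S).transpose) (fun k j => hN _ _) h.transpose_inv_mul).bind fun _ _ m₁ l₁ _ => ?_
    refine (interact_minimality isMul_timesAT h.strictMono (hQ'.mono l₁) h.rows
      h.rows_zero).bind fun _ _ m₂ l₂ _ => ?_
    refine Interact.recvIdxs (q := fun j => (O.J (O.perm j) : ℕ)) fun _ => ?_
    rw [eJ, withIncreasing_of_strictMono hJ]
    refine (interact_minimality isMul_timesA hJ (hR'.mono (l₁.trans l₂)) (h.columns O.perm)
      fun k j hj => h.columns_zero _ _ hj).bind fun _ _ m₃ l₃ _ => ?_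
    exact fin m₃ (l₁.trans (l₂.trans l₃))
  | false =>
    refine Interact.recvLst ((congrArg (fun p => Interact P A p _ mem _) (apply_ofFn (fun r q =>
      withIncreasing n q fun J => do
        lowerRank timesA J
        minimality timesA J
        recvIdxs r fun i => withIncreasing m i fun I => do
          minimality timesAT I
          rpmInvertible I J) _)).mpr ?_)
    rw [eJ, withIncreasing_of_strictMono hJ]
    refine (interact_lowerRank isMul_timesA hJ.injective
      (L' := (T * S).submatrix O.perm id) (fun k j => hN _ _) (h.inv_mul_perm O.perm)).bind
      fun _ _ m₁ l₁ _ => ?_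
    refine (interact_minimality isMul_timesA hJ (hR'.mono l₁) (h.columns O.perm)
      fun k j hj => h.columns_zero _ _ hj).bind fun _ _ m₂ l₂ _ => ?_
    refine Interact.recvIdxs (q := fun i => (O.I i : ℕ)) fun _ => ?_
    rw [withIncreasing_of_strictMono h.strictMono]
    refine (interact_minimality isMul_timesAT h.strictMono (hQ'.mono (l₁.trans l₂)) h.rows
      h.rows_zero).bind fun _ _ m₃ l₃ _ => ?_
    exact fin m₃ (l₁.trans (l₂.trans l₃))

/-! ### The cost of the interactive part -/

/-- For all memories and challenges, the execution of `x` costs at most `T`. -/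
def CostLe {α : Type} (x : Code F α) (T : ℕ) : Prop :=
  ∀ s k mem h B, (∀ a s' mem' h', (k a s').cost mem' h' ≤ B) → (x s k).cost mem h ≤ B + T

namespace CostLe

variable {α β : Type} {T T' : ℕ}

theorem mono {x : Code F α} (h : CostLe x T) (hT : T ≤ T') : CostLe x T' :=
  fun s k mem c B hB => (h s k mem c B hB).trans (Nat.add_le_add_left hT B)

theorem pure (a : α) : CostLe (pure a : Code F α) 0 := fun _ _ _ _ _ hB => hB _ _ _ _

theorem bind {x : Code F α} {f : α → Code F β} (hx : CostLe x T) (hf : ∀ a, CostLe (f a) T') :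
    CostLe (x >>= f) (T + T') := by
  intro s k mem h B hB
  refine (hx s _ mem h (B + T') fun a s' mem' h' => hf a s' k mem' h' B hB).trans ?_
  omega

theorem konst (c : F) : CostLe (Code.konst c) 0 := fun _ _ _ _ _ hB => hB _ _ _ _

theorem arithm (o : ArithOp) (i j : ℕ) : CostLe (F := F) (Code.arithm o i j) 1 :=
  fun _ _ _ _ _ hB => Nat.add_le_add_right (hB _ _ _ _) 1

theorem recv : CostLe (F := F) Code.recv 0 := by
  intro s k mem h B hB
  cases h with
  -- A list of challenges that is too short stops the program at no further cost.
  | nil => exact Nat.zero_le _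
  | cons a h => exact hB _ _ _ _

theorem send (i : ℕ) : CostLe (F := F) (Code.send i) 0 := fun _ _ _ _ _ hB => hB _ _ _ _

theorem sendIdx (i : ℕ) : CostLe (F := F) (Code.sendIdx i) 0 := fun _ _ _ _ _ hB => hB _ _ _ _

theorem sendLst (l : List ℕ) : CostLe (F := F) (Code.sendLst l) 0 := fun _ _ _ _ _ hB => hB _ _ _ _

theorem tab {r : ℕ} {f : Fin r → Code F β} (hf : ∀ i, CostLe (f i) T) :
    CostLe (Code.tab r f) (r * T) := by
  induction r with
  | zero => exact (pure _).mono (Nat.zero_le _)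
  | succ r ih =>
    exact ((hf 0).bind fun a => (ih fun i => hf i.succ).bind fun t => pure _).mono
      (by rw [add_mul]; omega)

theorem loopDown {r : ℕ} {f : Fin r → β → Code F β} (hf : ∀ i s, CostLe (f i s) T) (s : β) :
    CostLe (Code.loopDown r f s) (r * T) := by
  induction r generalizing s with
  | zero => exact (pure _).mono (Nat.zero_le _)
  | succ r ih =>
    exact ((hf _ s).bind fun a => ih (fun i => hf i.castSucc) a).mono (by rw [add_mul]; omega)

theorem loopUp {r : ℕ} {f : Fin r → β → Code F β} (hf : ∀ i s, CostLe (f i s) T) (s : β) :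
    CostLe (Code.loopUp r f s) (r * T) := by
  induction r generalizing s with
  | zero => exact (pure _).mono (Nat.zero_le _)
  | succ r ih =>
    exact ((hf _ s).bind fun a => ih (fun i => hf i.succ) a).mono (by rw [add_mul]; omega)

theorem dot (r : ℕ) (X Y : Fin r → ℕ) : CostLe (F := F) (Code.dot r X Y) (2 * r) := by
  induction r with
  | zero => exact konst 0
  | succ r ih =>
    exact ((arithm _ _ _).bind fun p => (ih _ _).bind fun s => arithm _ _ _).mono (by omega)

theorem suffixSums (r : ℕ) (X : Fin r → ℕ) : CostLe (F := F) (Code.suffixSums r X) r := by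
  induction r with
  | zero => exact (konst 0).bind fun z => pure _
  | succ r ih =>
    exact ((ih _).bind fun s => (arithm _ _ _).bind fun t => pure _).mono (by omega)

theorem respondDown {r : ℕ} {g : Fin r → (Fin r → ℕ) → Code F ℕ} (hg : ∀ i st, CostLe (g i st) T) :
    CostLe (respondDown g) (r * T) :=
  ((konst 0).bind fun _ => loopDown (fun i st => recv.bind fun _ => (hg i _).bind fun _ =>
    (send _).bind fun _ => pure _) _).mono (by simp)

theorem respondUp {r : ℕ} {g : Fin r → (Fin r → ℕ) → Code F ℕ} (hg : ∀ i st, CostLe (g i st) T) :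
    CostLe (respondUp g) (r * T) :=
  ((konst 0).bind fun _ => loopUp (fun i st => recv.bind fun _ => (hg i _).bind fun _ =>
    (send _).bind fun _ => pure _) _).mono (by simp)

theorem lowerRankProver {r : ℕ} (a : ℕ) (L : Fin r → Fin r → ℕ) (ι : Fin r → Fin a) :
    CostLe (F := F) (lowerRankProver a L ι) (r * (2 * r)) :=
  ((tab fun _ => recv).bind fun _ => (tab fun _ => dot _ _ _).bind fun _ =>
    (tab fun _ => send _).bind fun _ => pure _).mono (by simp)

theorem minimalityProver {b r : ℕ} (c : Fin r → Fin b) (R : Fin r → Fin b → ℕ) :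
    CostLe (F := F) (minimalityProver c R) (r * (r + 3 * b)) :=
  ((tab fun _ => recv).bind fun _ => (respondDown fun _ _ => (suffixSums _ _).bind fun _ =>
    (tab fun _ => arithm _ _ _).bind fun _ => dot _ _ _).bind fun _ => pure _).mono
    (by rw [mul_zero, zero_add, add_zero]; exact Nat.mul_le_mul_left _ (by omega))

theorem ldupProver (r : ℕ) (U L : Fin r → Fin r → ℕ) :
    CostLe (F := F) (ldupProver r U L) (r * (6 * r)) := by
  cases r with
  | zero => exact pure _
  | succ r =>
    refine ((konst 0).bind fun _ => (loopDown (T := 6 * r) (fun i st => (recv.bind fun _ =>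
      recv.bind fun _ => (dot _ _ _).bind fun _ => (send _).bind fun _ => (dot _ _ _).bind fun _ =>
      (send _).bind fun _ => recv.bind fun _ => (dot _ _ _).bind fun _ => (send _).bind fun _ =>
      pure _).mono (by omega)) _).bind fun _ => pure _).mono ?_
    rw [zero_add, add_zero]
    exact Nat.mul_le_mul (by omega) (by omega)

theorem rpmProver {r : ℕ} (p : Fin r → Fin r) (D : Fin r → ℕ) (U L : Fin r → Fin r → ℕ) :
    CostLe (F := F) (rpmProver p D U L) (r * (8 * r)) :=
  ((tab fun _ => sendIdx _).bind fun _ => (tab fun _ => send _).bind fun _ =>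
    (respondUp fun _ _ => dot _ _ _).bind fun _ => (ldupProver r U L).bind fun _ => pure _).mono
    (by simp only [mul_zero, zero_add, add_zero, ← mul_add]; exact Nat.mul_le_mul_left _ (by omega))

/-- The count is `2r² + r (r + 3m) + r (r + 3n) + 8r²`, with `r ≤ m` and `r ≤ n`. -/
theorem online (rowsFirst : Bool) (O : Preparation m n) (hm : O.r ≤ m) (hn : O.r ≤ n) :
    CostLe (F := F) (online rowsFirst O) (18 * (m * n)) := by
  have h1 : O.r * O.r ≤ m * n := Nat.mul_le_mul hm hn
  have h2 : O.r * n ≤ m * n := Nat.mul_le_mul_right _ hm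
  have h3 : O.r * m ≤ m * n := by
    rw [mul_comm m]
    exact Nat.mul_le_mul_right _ hn
  cases rowsFirst with
  | true =>
    exact ((sendLst _).bind fun _ => (lowerRankProver _ _ _).bind fun _ =>
      (minimalityProver _ _).bind fun _ => (tab fun _ => sendIdx _).bind fun _ =>
      (minimalityProver _ _).bind fun _ => rpmProver _ _ _ _).mono (by nlinarith)
  | false =>
    exact ((sendLst _).bind fun _ => (lowerRankProver _ _ _).bind fun _ =>
      (minimalityProver _ _).bind fun _ => (tab fun _ => sendIdx _).bind fun _ =>
      (minimalityProver _ _).bind fun _ => rpmProver _ _ _ _).mono (by nlinarith)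

end CostLe

/-! ### Completeness -/

section Completeness

variable {ω c : ℝ} (fm : FastMul F ω c)

/-- The program of the honest Prover. -/
def honestProver (rowsFirst : Bool) (t : RowTree) (n : ℕ) : ProverProg F :=
  (prepare fm t n >>= online rowsFirst) (t.size * n) fun _ _ => .halt

/-- The first commitment has as many indices as there are pivots, which turns the bounds in its
length into bounds in the rank. -/
theorem lst_eq_of_at {rowsFirst : Bool} {O : Preparation m n} {k : Unit → ℕ → ProverProg F}
    (h : At P A [] (online rowsFirst O mem.length k) mem) :
    ((P.toProver A).lst []).length = O.r := by
  have := h []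
  rw [List.append_nil] at this
  simp only [ProverProg.toProver, this]
  cases rowsFirst <;> exact List.length_ofFn

/-- The constant adds up as `1` for the tests, `elimConst ω c + 12 c + 1` for the preparation and
`18` for the answers. The maximum with `1` absorbs the terms in `m n` when the rank is zero. -/
theorem honestProver_spec (hω : 2 < ω) {t : RowTree} (ht : t.Balanced) (rowsFirst : Bool)
    (A : Matrix (Fin t.size) (Fin n) F) :
    (∀ h, ((honestProver fm rowsFirst t n).cost (entries A) h : ℝ) ≤
      (elimConst ω c + 12 * c + 20) * t.size * n * (max A.rank 1 : ℝ) ^ (ω - 2)) ∧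
    Ensures A ((honestProver fm rowsFirst t n).toProver A) (rpmVerifier F t.size n rowsFirst)
      (fun R _ => IsRankProfileMatrix A R) [] ∧
    (((honestProver fm rowsFirst t n).toProver A).lst []).length = A.rank := by
  obtain ⟨O, m₁, T, he, hT, hO⟩ := computes_prepare fm hω ht A
  have hlen : (entries A).length = t.size * n := List.length_ofFn
  have hr : A.rank = O.r := by
    obtain ⟨_, _, _, _, h, -⟩ := hO
    exact h.isRankProfileMatrix.2
  have hat : At (honestProver fm rowsFirst t n) A []
      (online rowsFirst O m₁.length fun _ _ => .halt) m₁ := by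
    intro h'
    have := he.reply (fun a s => online rowsFirst a s fun _ _ => .halt) h'
    rw [hlen] at this
    exact this
  refine ⟨fun h => ?_, interact_online rowsFirst hO _ _ _ hat fun _ _ _ _ _ h _ => h, ?_⟩
  · have h1 := he.cost (fun a s => online rowsFirst a s fun _ _ => .halt) h
    rw [hlen] at h1
    have h2 := CostLe.online (F := F) rowsFirst O (hr ▸ A.rank_le_height) (hr ▸ A.rank_le_width)
      m₁.length (fun _ _ => .halt) m₁ h 0 fun _ _ _ _ => le_rfl
    have h3 : (honestProver fm rowsFirst t n).cost (entries A) h ≤ 18 * (t.size * n) + T := by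
      refine (le_of_eq h1).trans ?_
      omega
    have h4 : ((honestProver fm rowsFirst t n).cost (entries A) h : ℝ) ≤
        18 * (t.size * n) + T := by exact_mod_cast h3
    have h5 : (1 : ℝ) ≤ (max A.rank 1 : ℝ) ^ (ω - 2) :=
      Real.one_le_rpow (le_max_right _ _) (by linarith)
    have h6 : (A.rank : ℝ) ^ (ω - 2) ≤ (max A.rank 1 : ℝ) ^ (ω - 2) :=
      Real.rpow_le_rpow (Nat.cast_nonneg _) (le_max_left _ _) (by linarith)
    have hK := one_le_elimConst hω fm.nonneg
    have hc := fm.nonneg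
    set w := (max A.rank 1 : ℝ) ^ (ω - 2)
    have h7 : (t.size * n : ℝ) * (1 + (elimConst ω c + 12 * c + 1) * (A.rank : ℝ) ^ (ω - 2)) ≤
        t.size * n * (1 + (elimConst ω c + 12 * c + 1) * w) := by gcongr
    have h8 : (19 : ℝ) * (t.size * n) * 1 ≤ 19 * (t.size * n) * w := by gcongr
    linarith
  · rw [hr]
    exact lst_eq_of_at hat

end Completeness

end Honest

end RPMCert

/-! ### Completeness, soundness and resources of the protocol. -/

theorem mainTheorem6 (ω c : ℝ) (hω : 2 < ω) :
    -- perfect completeness, with an efficient honest Prover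
    (∃ C : ℝ, ∀ (F : Type*) [Field F], MatMulFeasible F ω c →
      ∀ (m n : ℕ) (rowsFirst : Bool), ∃ P : ProverProg F,
        ∀ A : Matrix (Fin m) (Fin n) F,
          (∀ challenges : List F, (P.cost (entries A) challenges : ℝ) ≤
            C * m * n * (max A.rank 1 : ℝ) ^ (ω - 2)) ∧
          ∀ (S : Finset F) (hS : S.Nonempty),
            ∀ res ∈ (execution rowsFirst A S hS (P.toProver A)).support,
              (∃ R, res.output = some R ∧ IsRankProfileMatrix A R) ∧
              res.comm ≤ m + n + max m n + 17 * A.rank ∧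
              (rowsFirst = decide (n < m) → res.comm ≤ m + n + min m n + 17 * A.rank) ∧
              res.cost ≤ 4 * mu A + m + n + 21 * A.rank) ∧
    -- soundness, and the same bounds with the claimed rank, against every Prover
    (∀ (F : Type*) [Field F] (m n : ℕ) (rowsFirst : Bool) (A : Matrix (Fin m) (Fin n) F)
      (S : Finset F) (hS : S.Nonempty) (σ : Prover F),
        (execution rowsFirst A S hS σ).toOuterMeasure
            {res | ∃ R, res.output = some R ∧ ¬ IsRankProfileMatrix A R} ≤
          ENNReal.ofReal (1 - (1 - 1 / (S.card : ℝ)) ^ (2 * n)) ∧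
        ∀ res ∈ (execution rowsFirst A S hS σ).support,
          res.comm ≤ m + n + max m n + 17 * (σ.lst []).length ∧
          (rowsFirst = decide (n < m) →
            res.comm ≤ m + n + min m n + 17 * (σ.lst []).length) ∧
          res.cost ≤ 4 * mu A + m + n + 21 * (σ.lst []).length) := by
  refine ⟨⟨elimConst ω c + 12 * c + 20, ?_⟩, ?_⟩
  · intro F _ hF m n rowsFirst
    obtain ⟨fm⟩ := hF.exists_fastMul
    -- Replacing `m` by the size of a balanced subdivision avoids casts between row types.
    obtain ⟨t, ht, rfl⟩ := RowTree.exists_balanced m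
    refine ⟨honestProver fm rowsFirst t n, fun A => ?_⟩
    obtain ⟨hcost, hacc, hlen⟩ := honestProver_spec fm hω ht rowsFirst A
    refine ⟨hcost, fun S hS res hres => ?_⟩
    obtain ⟨R, hR, hRPM⟩ := hacc.of_mem_support S hS 0 hres
    have := execution_resources A S hS _ rowsFirst hres
    rw [hlen] at this
    exact ⟨⟨R, hR, hRPM⟩, this⟩
  · intro F _ m n rowsFirst A S hS σ
    exact ⟨execution_soundness rowsFirst A S hS σ, fun res hres =>
      execution_resources A S hS σ rowsFirst hres⟩
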